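/- **Multiplier bootstrap for hyperrectangles.** Let $n\ge 4$ and $p\ge 3$ be integers and let $X_1,\dots,X_n$ be independent random vectors in $\mathbb{R}^p$, $X_i=(X_{i1},\dots,X_{ip})'$, with $\mathrm{E}[X_{ij}]=0$ and $\mathrm{E}[X_{ij}^2]<\infty$ for all $i,j$. Let $Y_1,\dots,Y_n$ be independent centered Gaussian random vectors in $\mathbb{R}^p$ with $Y_i\sim N(0,\mathrm{E}[X_iX_i'])$, and let $e_1,\dots,e_n$ be i.i.d. $N(0,1)$ random variables independent of $X_1^n=(X_1,\dots,X_n)$. Put $\bar X=n^{-1}\sum_{i=1}^n X_i$, \[ S_n^Y=\frac1{\sqrt n}\sum_{i=1}^n Y_i,\qquad S_n^{eX}=\frac1{\sqrt n}\sum_{i=1}^n e_i(X_i-\bar X), \] let $\mathcal{A}^{\mathrm{re}}$ be the class of all sets $\{w\in\mathbb{R}^p: a_j\le w_j\le b_j \text{ for all } j=1,\dots,p\}$ with $-\infty\le a_j\le b_j\le\infty$, and let \[ \rho_n^{MB}(\mathcal{A}^{\mathrm{re}})=\sup_{A\in\mathcal{A}^{\mathrm{re}}}\bigl|\Pr(S_n^{eX}\in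 A\mid X_1^n)-\Pr(S_n^Y\in A)\bigr| , \] where the conditional probability is the regular conditional distribution of $S_n^{eX}$ given $X_1^n$. Let $b,q>0$, $B_n\ge 1$ and $\alpha\in(0,e^{-1})$ be constants. Consider the conditions - (M.1) $n^{-1}\sum_{i=1}^n\mathrm{E}[X_{ij}^2]\ge b$ for all $j=1,\dots,p$; - (M.2) $n^{-1}\sum_{i=1}^n\mathrm{E}[|X_{ij}|^{2+k}]\le B_n^k$ for all $j=1,\dots,p$ and $k=1,2$; - (E.1) $\mathrm{E}[\exp(|X_{ij}|/B_n)]\le 2$ for all $i=1,\dots,n$ and $j=1,\dots,p$; - (E.2) $\mathrm{E}[(\max_{1\le j\le p}|X_{ij}|/B_n)^q]\le 2$ for all $i=1,\dots,n$; and set \[ D_n^{(1)}(\alpha)=\left(\frac{B_n^2\,(\log^5(pn))\,\log^2(1/\alpha)}{n}\right)^{1/6},\qquad D_{n,q}^{(2)}(\alpha)=\left(\frac{B_n^2\log^3(pn)}{\alpha^{2/q}\,n^{1-2/q}}\right)^{1/3}. \] Suppose that (M.1) and (M.2) hold. Then under (E.1), with probability at least $1-\alpha$, \[ \rho_n^{MB}(\mathcal{A}^{\mathrm{re}})\le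 C\,D_n^{(1)}(\alpha), \] where the constant $C$ depends only on $b$; while under (E.2), with probability at least $1-\alpha$, \[ \rho_n^{MB}(\mathcal{A}^{\mathrm{re}})\le C\{D_n^{(1)}(\alpha)+D_{n,q}^{(2)}(\alpha)\}, \] where the constant $C$ depends only on $b$ and $q$. -/

import Mathlib

open MeasureTheory ProbabilityTheory

noncomputable section

namespace HighDimBootstrap

/-- Hyperrectangles `{w : a_j ≤ w_j ≤ b_j for all j}` with `-∞ ≤ a_j ≤ b_j ≤ ∞`. -/
def hyperrectangles (p : ℕ) : Set (Set (Fin p → ℝ)) :=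
  {A | ∃ a b : Fin p → EReal, (∀ j, a j ≤ b j) ∧
    A = {w | ∀ j, a j ≤ (w j : EReal) ∧ (w j : EReal) ≤ b j}}

/-- The normalized sum `n^{-1/2} ∑ᵢ xᵢ`. -/
def normalizedSum {n p : ℕ} (x : Fin n → Fin p → ℝ) : Fin p → ℝ :=
  (Real.sqrt n)⁻¹ • ∑ i, x i

/-- The sample mean `n^{-1} ∑ᵢ xᵢ`. -/
def sampleMean {n p : ℕ} (x : Fin n → Fin p → ℝ) : Fin p → ℝ :=
  (n : ℝ)⁻¹ • ∑ i, x i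

/-- The multiplier bootstrap sum `n^{-1/2} ∑ᵢ eᵢ (xᵢ - x̄)`. -/
def multiplierSum {n p : ℕ} (e : Fin n → ℝ) (x : Fin n → Fin p → ℝ) : Fin p → ℝ :=
  normalizedSum fun i => e i • (x i - sampleMean x)

section Probability

variable {n p : ℕ} {Ω Ω' : Type*} [MeasurableSpace Ω] [MeasurableSpace Ω']

/-- `X₁, …, Xₙ` are independent centered random vectors in `ℝᵖ` whose coordinates have finite
second moments. -/
structure IsCenteredSample (P : Measure Ω) (X : Fin n → Ω → Fin p → ℝ) : Prop where
  measurable : ∀ i, Measurable (X i)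
  indep : iIndepFun X P
  memLp_two : ∀ i j, MemLp (fun ω => X i ω j) 2 P
  mean_zero : ∀ i j, ∫ ω, X i ω j ∂P = 0

/-- `e₁, …, eₙ` are i.i.d. `N(0,1)` random variables that are independent of
`(X₁, …, Xₙ)`. -/
structure IsGaussianMultiplier (P : Measure Ω) (X : Fin n → Ω → Fin p → ℝ)
    (e : Fin n → Ω → ℝ) : Prop where
  measurable : ∀ i, Measurable (e i)
  law : ∀ i, P.map (e i) = gaussianReal 0 1
  indep : iIndepFun e P
  indep_sample : IndepFun (fun ω i => e i ω) (fun ω i => X i ω) P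

/-- `Y₁, …, Yₙ` (possibly living on another probability space) are independent centered Gaussian
random vectors in `ℝᵖ` with `E[Yᵢ Yᵢ'] = E[Xᵢ Xᵢ']`, that is, `Yᵢ ∼ N(0, E[Xᵢ Xᵢ'])`. -/
structure IsGaussianAnalogue (P : Measure Ω) (X : Fin n → Ω → Fin p → ℝ)
    (Q : Measure Ω') (Y : Fin n → Ω' → Fin p → ℝ) : Prop where
  measurable : ∀ i, Measurable (Y i)
  indep : iIndepFun Y Q
  gaussian : ∀ i, IsGaussian (Q.map (Y i))
  mean_zero : ∀ i j, ∫ ω, Y i ω j ∂Q = 0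
  covariance : ∀ i j k, ∫ ω, Y i ω j * Y i ω k ∂Q = ∫ ω, X i ω j * X i ω k ∂P

/-- `ρₙᴹᴮ(𝒜) = sup_{A ∈ 𝒜} |Pr(Sₙᵉˣ ∈ A ∣ X₁, …, Xₙ) - Pr(Sₙʸ ∈ A)|`, a random variable on the
space of the data. The conditional probability is the regular one, i.e. the regular conditional
distribution of `Sₙᵉˣ` given `(X₁, …, Xₙ)`, evaluated at the observed data. -/
def rhoMB (P : Measure Ω) [IsProbabilityMeasure P] (X : Fin n → Ω → Fin p → ℝ)
    (e : Fin n → Ω → ℝ) (Q : Measure Ω') (Y : Fin n → Ω' → Fin p → ℝ)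
    (𝒜 : Set (Set (Fin p → ℝ))) (ω : Ω) : ℝ :=
  ⨆ A : 𝒜,
    |(condDistrib (fun ω' => multiplierSum (fun i => e i ω') (fun i => X i ω'))
          (fun ω' i => X i ω') P (fun i => X i ω)).real (A : Set (Fin p → ℝ))
      - Q.real {ω' | normalizedSum (fun i => Y i ω') ∈ (A : Set (Fin p → ℝ))}|

/-- `n^{-1} ∑ᵢ E[X_{ij}²] ≥ b` for all `j`. -/
def CondM1 (P : Measure Ω) (X : Fin n → Ω → Fin p → ℝ) (b : ℝ) : Prop :=
  ∀ j, b ≤ (n : ℝ)⁻¹ * ∑ i, ∫ ω, X i ω j ^ 2 ∂P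

/-- `n^{-1} ∑ᵢ E[|X_{ij}|^{2+k}] ≤ Bᵏ` for all `j` and `k = 1, 2` (the moments being finite). -/
def CondM2 (P : Measure Ω) (X : Fin n → Ω → Fin p → ℝ) (B : ℝ) : Prop :=
  ∀ j, ∀ k : ℕ, k = 1 ∨ k = 2 →
    (∀ i, Integrable (fun ω => |X i ω j| ^ (2 + k)) P) ∧
      (n : ℝ)⁻¹ * ∑ i, ∫ ω, |X i ω j| ^ (2 + k) ∂P ≤ B ^ k

/-- `E[exp(|X_{ij}| / B)] ≤ 2` for all `i, j` (the expectation being finite). -/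
def CondE1 (P : Measure Ω) (X : Fin n → Ω → Fin p → ℝ) (B : ℝ) : Prop :=
  ∀ i j, Integrable (fun ω => Real.exp (|X i ω j| / B)) P ∧
    ∫ ω, Real.exp (|X i ω j| / B) ∂P ≤ 2

/-- `E[(max_j |X_{ij}| / B)^q] ≤ 2` for all `i` (the expectation being finite). -/
def CondE2 (P : Measure Ω) (X : Fin n → Ω → Fin p → ℝ) (B q : ℝ) : Prop :=
  ∀ i, Integrable (fun ω => (⨆ j, |X i ω j| / B) ^ q) P ∧
    ∫ ω, (⨆ j, |X i ω j| / B) ^ q ∂P ≤ 2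

end Probability

/-- `D_n^{(1)}(α) = (B² log⁵(pn) log²(1/α) / n)^{1/6}`. -/
def D1 (n p : ℕ) (B α : ℝ) : ℝ :=
  (B ^ 2 * Real.log (p * n) ^ 5 * Real.log (1 / α) ^ 2 / n) ^ (1 / 6 : ℝ)

/-- `D_{n,q}^{(2)}(α) = (B² log³(pn) / (α^{2/q} n^{1-2/q}))^{1/3}`. -/
def D2 (n p : ℕ) (B q α : ℝ) : ℝ :=
  (B ^ 2 * Real.log (p * n) ^ 3 / (α ^ (2 / q) * (n : ℝ) ^ (1 - 2 / q))) ^ (1 / 3 : ℝ)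

end HighDimBootstrap

end

noncomputable section

namespace HighDimBootstrap

/-! ### Smooth approximation of orthant indicators by log-sum-exp. -/

section SmoothMax

/-! Given the data, the multiplier sum is a centred Gaussian vector whose covariance is the sample
covariance matrix, while the target is a centred Gaussian vector whose covariance is the averaged
population matrix. The bootstrap error is thus a distance between two Gaussian laws. With `Δ` the
largest entrywise difference of the two matrices and `L = log (pn)`, two facts suffice: the distance
over boxes is of order `(Δ L²)^{1/3}`, and `Δ` is small with high probability.

Comparison (`exists_hyperrectangle_comparison`). A box is an orthant in at most `2p` signed
coordinates. Its indicator is smoothed at scale `δ` by a smooth step applied to a log-sum-exp; the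
Hessian then has `ℓ¹` norm `O(L/δ²)`, with no other dependence on the dimension. Exchanging one
Gaussian law for the other in many small independent increments costs `O(Δ L/δ²)`
(`HasHessianBound.abs_integral_sub_le`). Undoing the smoothing costs `O(δ √L)` by Nazarov's
inequality (`IsCenteredGaussian.anti_concentration`), and balancing the two gives the rate.
Nazarov's inequality is proved by splitting the boundary layer according to the coordinate with the
largest excess: the Mills ratio turns each density into a tail, and these tails are the masses of
disjoint cones.

Concentration (`empirical_second_moment_concentration`). The data are truncated and a Bernstein
bound is applied to each product of coordinates. In the moment generating function the small
products are controlled by fourth moments, through (M.2), and the large ones by the tail condition,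
(E.1) or (E.2). The resulting deviation of order `B √(nL) log(1/α)`, divided by `n` and used as `Δ`,
is what `D1` encodes; under (E.2) the largest coordinates add the term encoded by `D2`. -/

lemma abs_sub_zero_le_of_hasDerivAt {f f' : ℝ → ℝ} {K : ℝ} (hf : ∀ t, HasDerivAt f (f' t) t)
    (hK : ∀ t ∈ Set.Icc (0 : ℝ) 1, |f' t| ≤ K) {t : ℝ} (ht : t ∈ Set.Icc (0 : ℝ) 1) :
    |f t - f 0| ≤ K := by
  have h := (convex_Icc (0 : ℝ) 1).norm_image_sub_le_of_norm_hasDerivWithin_le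
    (f := f) (f' := f') (C := K) (fun x _ => (hf x).hasDerivWithinAt) (fun x hx => hK x hx)
    (x := 0) (y := t) (by simp) ht
  have hK0 : 0 ≤ K := (abs_nonneg _).trans (hK t ht)
  rw [Real.norm_eq_abs, Real.norm_eq_abs, sub_zero, abs_of_nonneg ht.1] at h
  nlinarith [ht.2]

/-- Second order Taylor expansion on `[0, 1]` with a bound on the third derivative. -/
lemma taylor_two_le {f f₁ f₂ f₃ : ℝ → ℝ} {K : ℝ} (h₀ : ∀ t, HasDerivAt f (f₁ t) t)
    (h₁ : ∀ t, HasDerivAt f₁ (f₂ t) t) (h₂ : ∀ t, HasDerivAt f₂ (f₃ t) t)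
    (hK : ∀ t, |f₃ t| ≤ K) : |f 1 - f 0 - f₁ 0 - f₂ 0 / 2| ≤ K := by
  -- The mean value bound on `[0, 1]` is applied three times, to `f₂`, `f₁` and `f` minus their
  -- Taylor polynomials; the usual factor `1/6` is given up.
  have e₂ : ∀ t ∈ Set.Icc (0 : ℝ) 1, |f₂ t - f₂ 0| ≤ K := fun t ht =>
    abs_sub_zero_le_of_hasDerivAt h₂ (fun t _ => hK t) ht
  have e₁ : ∀ t ∈ Set.Icc (0 : ℝ) 1, |f₁ t - f₁ 0 - t * f₂ 0| ≤ K := fun t ht => by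
    have := abs_sub_zero_le_of_hasDerivAt (f := fun t => f₁ t - t * f₂ 0)
      (f' := fun t => f₂ t - f₂ 0)
      (fun t => ((h₁ t).fun_sub ((hasDerivAt_id' t).mul_const (f₂ 0))).congr_deriv (by ring)) e₂ ht
    simp only [zero_mul, sub_zero] at this
    convert this using 2
    ring
  have := abs_sub_zero_le_of_hasDerivAt (f := fun t => f t - t * f₁ 0 - t ^ 2 / 2 * f₂ 0)
      (f' := fun t => f₁ t - f₁ 0 - t * f₂ 0)
      (fun t => (((h₀ t).fun_sub ((hasDerivAt_id' t).mul_const (f₁ 0))).fun_sub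
          ((((hasDerivAt_id' t).fun_pow 2).div_const 2).mul_const (f₂ 0))).congr_deriv
          (by push_cast; ring)) e₁ (t := 1) (by simp)
  convert this using 2
  ring

/-- A smooth step function equal to `1` on `(-∞, 1]` and to `0` on `[2, ∞)`, together with its
first three derivatives, which are bounded. -/
lemma exists_smooth_step : ∃ (g g₁ g₂ g₃ : ℝ → ℝ) (K : ℝ), 0 < K ∧
    (∀ x, HasDerivAt g (g₁ x) x) ∧ (∀ x, HasDerivAt g₁ (g₂ x) x) ∧
    (∀ x, HasDerivAt g₂ (g₃ x) x) ∧ (∀ x, |g₁ x| ≤ K) ∧ (∀ x, |g₂ x| ≤ K) ∧ (∀ x, |g₃ x| ≤ K) ∧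
    (∀ x, 0 ≤ g x) ∧ (∀ x, g x ≤ 1) ∧ (∀ x ≤ 1, g x = 1) ∧ (∀ x, 2 ≤ x → g x = 0) := by
  set g : ℝ → ℝ := fun x => Real.smoothTransition (2 - x) with hg
  have hgs : ContDiff ℝ (⊤ : ℕ∞) g := Real.smoothTransition.contDiff.comp (by fun_prop)
  have hder : ∀ (k : ℕ) x, HasDerivAt (iteratedDeriv k g) (iteratedDeriv (k + 1) g x) x := by
    intro k x
    rw [iteratedDeriv_succ]
    exact ((hgs.differentiable_iteratedDeriv k (by exact_mod_cast ENat.natCast_lt_top k))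
      x).hasDerivAt
  have hcont : ∀ k : ℕ, Continuous (iteratedDeriv k g) := fun k =>
    hgs.continuous_iteratedDeriv k (by exact_mod_cast le_top)
  have hlo : ∀ x ≤ 1, g x = 1 := fun x hx =>
    Real.smoothTransition.one_of_one_le (by linarith)
  have hhi : ∀ x, 2 ≤ x → g x = 0 := fun x hx =>
    Real.smoothTransition.zero_of_nonpos (by linarith)
  -- Off `[1, 2]` the step is locally constant, so the derivatives need to be bounded only on this
  -- compact interval.
  have hz : ∀ k : ℕ, ∀ x, x < 1 ∨ 2 < x → iteratedDeriv (k + 1) g x = 0 := by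
    intro k x hx
    have : ∃ c : ℝ, g =ᶠ[nhds x] fun _ => c := by
      rcases hx with hx | hx
      · exact ⟨1, Filter.eventually_of_mem (Iio_mem_nhds hx) fun y hy => hlo y (le_of_lt hy)⟩
      · exact ⟨0, Filter.eventually_of_mem (Ioi_mem_nhds hx) fun y hy => hhi y (le_of_lt hy)⟩
    obtain ⟨c, hc⟩ := this
    rw [hc.iteratedDeriv_eq, iteratedDeriv_const]
    simp
  have hbd : ∀ k : ℕ, ∃ K : ℝ, ∀ x, |iteratedDeriv (k + 1) g x| ≤ K := by
    intro k
    obtain ⟨K, hK⟩ := (isCompact_Icc (a := (1 : ℝ)) (b := 2)).exists_bound_of_continuousOn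
      (hcont (k + 1)).continuousOn
    refine ⟨K, fun x => ?_⟩
    by_cases hx : x ∈ Set.Icc (1 : ℝ) 2
    · exact hK x hx
    · rw [hz k x (by
        rw [Set.mem_Icc, not_and_or, not_le, not_le] at hx; exact hx), abs_zero]
      exact (norm_nonneg _).trans (hK 1 (by simp))
  obtain ⟨K₁, h₁⟩ := hbd 0
  obtain ⟨K₂, h₂⟩ := hbd 1
  obtain ⟨K₃, h₃⟩ := hbd 2
  refine ⟨g, iteratedDeriv 1 g, iteratedDeriv 2 g, iteratedDeriv 3 g,
    max (max K₁ K₂) (max K₃ 1), by positivity, fun x => by simpa using hder 0 x, hder 1, hder 2,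
    fun x => (h₁ x).trans (by simp), fun x => (h₂ x).trans (by simp),
    fun x => (h₃ x).trans (by simp),
    fun x => Real.smoothTransition.nonneg _, fun x => Real.smoothTransition.le_one _, hlo, hhi⟩

variable {ι : Type*} [Fintype ι]

/-- The exponential sum `∑ⱼ aⱼ xⱼᵏ exp (t xⱼ)`. -/
def expSum (a x : ι → ℝ) (k : ℕ) (t : ℝ) : ℝ := ∑ j, a j * x j ^ k * Real.exp (t * x j)

lemma hasDerivAt_expSum (a x : ι → ℝ) (k : ℕ) (t : ℝ) :
    HasDerivAt (expSum a x k) (expSum a x (k + 1) t) t := by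
  unfold expSum
  refine HasDerivAt.fun_sum fun j _ => ?_
  exact ((((hasDerivAt_id' t).mul_const (x j)).exp).const_mul (a j * x j ^ k)).congr_deriv
    (by ring)

lemma expSum_zero_pos [Nonempty ι] {a : ι → ℝ} (ha : ∀ j, 0 < a j) (x : ι → ℝ) (t : ℝ) :
    0 < expSum a x 0 t :=
  Finset.sum_pos (fun j _ => by have := ha j; positivity) Finset.univ_nonempty

lemma abs_expSum_le {a x : ι → ℝ} {M : ℝ} (ha : ∀ j, 0 < a j) (hx : ∀ j, |x j| ≤ M)
    (k : ℕ) (t : ℝ) : |expSum a x k t| ≤ M ^ k * expSum a x 0 t := by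
  unfold expSum
  rw [Finset.mul_sum]
  refine (Finset.abs_sum_le_sum_abs _ _).trans (Finset.sum_le_sum fun j _ => ?_)
  have := ha j
  rw [abs_mul, abs_mul, abs_of_pos this, Real.abs_exp, abs_pow, pow_zero, mul_one, ← mul_assoc,
    mul_comm (M ^ k)]
  gcongr
  exact hx j

/-- The normalised exponential sums. -/
def expRatio (a x : ι → ℝ) (k : ℕ) (t : ℝ) : ℝ := expSum a x k t / expSum a x 0 t

/-- `expRatio a x k t` is the mean of `x j ^ k` under the probability weights proportional to `a j *
exp (t * x j)`. -/
lemma abs_expRatio_le [Nonempty ι] {a x : ι → ℝ} {M : ℝ} (ha : ∀ j, 0 < a j)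
    (hx : ∀ j, |x j| ≤ M) (k : ℕ) (t : ℝ) : |expRatio a x k t| ≤ M ^ k := by
  have h0 := expSum_zero_pos ha x t
  rw [expRatio, abs_div, abs_of_pos h0, div_le_iff₀ h0]
  exact abs_expSum_le ha hx k t

/-- Differentiating a tilted mean produces the covariance with `x` under the tilted weights. -/
lemma hasDerivAt_expRatio [Nonempty ι] {a : ι → ℝ} (ha : ∀ j, 0 < a j) (x : ι → ℝ) (k : ℕ)
    (t : ℝ) : HasDerivAt (expRatio a x k)
      (expRatio a x (k + 1) t - expRatio a x k t * expRatio a x 1 t) t := by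
  have h0 := (expSum_zero_pos ha x t).ne'
  refine ((hasDerivAt_expSum a x k t).fun_div (hasDerivAt_expSum a x 0 t) h0).congr_deriv ?_
  simp only [expRatio]
  field_simp

lemma hasDerivAt_log_expSum [Nonempty ι] {a : ι → ℝ} (ha : ∀ j, 0 < a j) (x : ι → ℝ)
    (t : ℝ) : HasDerivAt (fun t => Real.log (expSum a x 0 t)) (expRatio a x 1 t) t := by
  have h0 := (expSum_zero_pos ha x t).ne'
  exact (hasDerivAt_expSum a x 0 t).log h0

/-- Taylor expansion of a smooth function of a log-sum-exp along a line. -/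
lemma taylor_smooth_logSumExp [Nonempty ι] {g g₁ g₂ g₃ : ℝ → ℝ} {K : ℝ}
    (h₀ : ∀ x, HasDerivAt g (g₁ x) x) (h₁ : ∀ x, HasDerivAt g₁ (g₂ x) x)
    (h₂ : ∀ x, HasDerivAt g₂ (g₃ x) x) (k₁ : ∀ x, |g₁ x| ≤ K) (k₂ : ∀ x, |g₂ x| ≤ K)
    (k₃ : ∀ x, |g₃ x| ≤ K) {L : ℝ} (hL : 1 ≤ L) {a x : ι → ℝ} {M : ℝ} (ha : ∀ j, 0 < a j)
    (hx : ∀ j, |x j| ≤ M) :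
    |g (Real.log (expSum a x 0 1) / L) - g (Real.log (expSum a x 0 0) / L)
      - g₁ (Real.log (expSum a x 0 0) / L) * (expRatio a x 1 0 / L)
      - (g₂ (Real.log (expSum a x 0 0) / L) * (expRatio a x 1 0 / L) ^ 2
          + g₁ (Real.log (expSum a x 0 0) / L)
            * ((expRatio a x 2 0 - expRatio a x 1 0 ^ 2) / L)) / 2| ≤ 13 * K * M ^ 3 := by
  have hL0 : (0 : ℝ) < L := by linarith
  have hK : 0 ≤ K := (abs_nonneg _).trans (k₁ 0)
  have hM : 0 ≤ M := (abs_nonneg _).trans (hx (Classical.arbitrary ι))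
  set f : ℝ → ℝ := fun t => Real.log (expSum a x 0 t) / L with hf
  set r := expRatio a x with hr
  have hdf : ∀ t, HasDerivAt f (r 1 t / L) t := fun t =>
    (hasDerivAt_log_expSum ha x t).div_const L
  have hdr : ∀ k t, HasDerivAt (r k) (r (k + 1) t - r k t * r 1 t) t :=
    fun k t => hasDerivAt_expRatio ha x k t
  have hb : ∀ k t, |r k t| ≤ M ^ k := fun k t => abs_expRatio_le ha hx k t
  refine taylor_two_le (f := fun t => g (f t)) (f₁ := fun t => g₁ (f t) * (r 1 t / L))
    (f₂ := fun t => g₂ (f t) * (r 1 t / L) ^ 2 + g₁ (f t) * ((r 2 t - r 1 t ^ 2) / L))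
    (f₃ := fun t => g₃ (f t) * (r 1 t / L) ^ 3
      + 3 * (g₂ (f t) * (r 1 t / L) * ((r 2 t - r 1 t ^ 2) / L))
      + g₁ (f t) * ((r 3 t - 3 * (r 1 t * r 2 t) + 2 * r 1 t ^ 3) / L))
    (fun t => (h₀ _).comp t (hdf t)) (fun t => ?_) (fun t => ?_) (fun t => ?_)
  · refine (((h₁ (f t)).comp t (hdf t)).fun_mul ((hdr 1 t).div_const L)).congr_deriv ?_
    simp only [Function.comp]
    ring
  · refine ((((h₂ (f t)).comp t (hdf t)).fun_mul (((hdr 1 t).div_const L).fun_pow 2)).fun_add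
      (((h₁ (f t)).comp t (hdf t)).fun_mul
        (((hdr 2 t).fun_sub ((hdr 1 t).fun_pow 2)).div_const L))).congr_deriv ?_
    simp only [Function.comp]
    push_cast
    ring
  · have q : ∀ y : ℝ, |y / L| ≤ |y| := fun y => by
      rw [abs_div, abs_of_pos hL0]
      exact div_le_self (abs_nonneg _) hL
    have b1 := hb 1 t
    have b2 := hb 2 t
    have b3 := hb 3 t
    rw [pow_one] at b1
    have c1 : |r 1 t / L| ≤ M := (q _).trans b1
    have c1' : |r 1 t ^ 2| ≤ M ^ 2 := by rw [abs_pow]; gcongr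
    have c1'' : |r 1 t ^ 3| ≤ M ^ 3 := by rw [abs_pow]; gcongr
    have c2 : |(r 2 t - r 1 t ^ 2) / L| ≤ 2 * M ^ 2 :=
      (q _).trans ((abs_sub _ _).trans (by linarith))
    have c12 : |r 1 t * r 2 t| ≤ M ^ 3 := by
      rw [abs_mul]
      calc _ ≤ M * M ^ 2 := by gcongr
        _ = M ^ 3 := by ring
    have c3 : |(r 3 t - 3 * (r 1 t * r 2 t) + 2 * r 1 t ^ 3) / L| ≤ 6 * M ^ 3 := by
      refine (q _).trans ((abs_add_le _ _).trans ?_)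
      have := abs_sub (r 3 t) (3 * (r 1 t * r 2 t))
      rw [abs_mul, abs_of_pos (by norm_num : (0 : ℝ) < 3)] at this
      rw [abs_mul, abs_of_pos (by norm_num : (0 : ℝ) < 2)]
      linarith
    -- The three terms of the third derivative contribute 1, 6 and 6, whence the constant 13; `1 ≤
    -- L` lets every division by `L` be dropped.
    have d1 : |g₃ (f t) * (r 1 t / L) ^ 3| ≤ K * M ^ 3 := by
      rw [abs_mul, abs_pow]; gcongr; exact k₃ _
    have d2 : |3 * (g₂ (f t) * (r 1 t / L) * ((r 2 t - r 1 t ^ 2) / L))| ≤ 6 * (K * M ^ 3) := by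
      rw [abs_mul, abs_mul, abs_mul, abs_of_pos (by norm_num : (0 : ℝ) < 3)]
      calc _ ≤ 3 * (K * M * (2 * M ^ 2)) := by gcongr; exact k₂ _
        _ = _ := by ring
    have d3 : |g₁ (f t) * ((r 3 t - 3 * (r 1 t * r 2 t) + 2 * r 1 t ^ 3) / L)|
        ≤ 6 * (K * M ^ 3) := by
      rw [abs_mul]
      calc _ ≤ K * (6 * M ^ 3) := by gcongr; exact k₁ _
        _ = _ := by ring
    refine (abs_add_three _ _ _).trans ?_
    linarith

/-- A bounded continuous function has uniform second order Taylor expansions whose Hessians have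
`ℓ¹` norm at most `M`. -/
structure HasHessianBound (m : (ι → ℝ) → ℝ) (M : ℝ) : Prop where
  continuous : Continuous m
  nonneg : ∀ w, 0 ≤ m w
  le_one : ∀ w, m w ≤ 1
  -- Only `M` enters the rates. The cubic constant `K` may be arbitrary, because its contribution
  -- vanishes as the interpolation steps get finer.
  taylor : ∃ K : ℝ, 0 ≤ K ∧ ∀ w, ∃ (l : ι → ℝ) (H : ι → ι → ℝ), ∑ j, ∑ k, |H j k| ≤ M ∧
    ∀ v, |m (w + v) - m w - ∑ j, l j * v j - (∑ j, ∑ k, H j k * (v j * v k)) / 2|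
      ≤ K * ‖v‖ ^ 3

/-- Smooth approximation of the indicator of `{w : w ≤ c}`. -/
lemma exists_smooth_orthant : ∃ K : ℝ, 0 < K ∧ ∀ (ι : Type) [Fintype ι] [Nonempty ι]
    (L δ : ℝ) (c : ι → ℝ), 1 ≤ L → Real.log (Fintype.card ι) ≤ L → 0 < δ →
    ∃ m : (ι → ℝ) → ℝ, HasHessianBound m (K * L / δ ^ 2) ∧
      (∀ w, (∀ j, w j ≤ c j) → m w = 1) ∧ (∀ w j, c j + 2 * δ < w j → m w = 0) := by
  classical
  obtain ⟨g, g₁, g₂, g₃, K, hK, h₀, h₁, h₂, k₁, k₂, k₃, gn, gl, glo, ghi⟩ := exists_smooth_step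
  refine ⟨3 * K, by positivity, fun ι _ _ L δ c hL hcard hδ => ?_⟩
  have hL0 : 0 < L := by linarith
  -- At this inverse temperature the smooth maximum of `w - c` exceeds the true maximum by at most
  -- `log (card ι) / κ ≤ δ`. The argument of `g` is the smooth maximum divided by `δ`: at most 1
  -- inside the orthant, at least 2 once some coordinate is beyond `2δ`.
  set κ := L / δ with hκ
  have hκ0 : 0 < κ := by positivity
  set A : (ι → ℝ) → ι → ℝ := fun w j => Real.exp (κ * (w j - c j)) with hA
  have hApos : ∀ w j, 0 < A w j := fun w j => Real.exp_pos _
  have hSpos : ∀ w, 0 < ∑ j, A w j := fun w =>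
    Finset.sum_pos (fun j _ => hApos w j) Finset.univ_nonempty
  refine ⟨fun w => g (Real.log (∑ j, A w j) / L), ⟨?_, fun w => gn _, fun w => gl _, ?_⟩, ?_, ?_⟩
  · have hg : Continuous g := continuous_iff_continuousAt.2 fun x => (h₀ x).continuousAt
    refine hg.comp (Continuous.div_const (Continuous.log ?_ fun w => (hSpos w).ne') L)
    exact continuous_finsetSum _ fun j _ => by fun_prop
  · refine ⟨13 * K * κ ^ 3, by positivity, fun w => ?_⟩
    set S := ∑ j, A w j with hS
    set q : ι → ℝ := fun j => A w j / S with hq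
    have hq0 : ∀ j, 0 ≤ q j := fun j => (div_pos (hApos w j) (hSpos w)).le
    have hq1 : ∑ j, q j = 1 := by
      rw [← Finset.sum_div]; exact div_self (hSpos w).ne'
    set G₁ := g₁ (Real.log S / L)
    set G₂ := g₂ (Real.log S / L)
    refine ⟨fun j => G₁ * (κ * q j / L), fun j k => κ ^ 2 * (G₂ / L ^ 2 * (q j * q k)
      + G₁ / L * ((if j = k then q j else 0) - q j * q k)), ?_, fun v => ?_⟩
    -- The softmax weights `q` sum to one, so `q j * q k` and the diagonal matrix of `q` both have
    -- `ℓ¹` norm one in any dimension. The total is `3 K κ² / L = 3 K L / δ²`.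
    · have hb : ∀ j k, |κ ^ 2 * (G₂ / L ^ 2 * (q j * q k)
          + G₁ / L * ((if j = k then q j else 0) - q j * q k))|
          ≤ κ ^ 2 * (K / L) * (2 * (q j * q k) + if j = k then q j else 0) := by
        intro j k
        have hjk := mul_nonneg (hq0 j) (hq0 k)
        have hite : 0 ≤ (if j = k then q j else 0) := by split_ifs; exacts [hq0 j, le_rfl]
        have e1 : |G₂ / L ^ 2| ≤ K / L := by
          rw [abs_div, abs_of_pos (by positivity : 0 < L ^ 2)]
          calc _ ≤ K / L ^ 2 := by gcongr; exact k₂ _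
            _ ≤ K / L := by gcongr; nlinarith
        have e2 : |G₁ / L| ≤ K / L := by
          rw [abs_div, abs_of_pos hL0]
          gcongr; exact k₁ _
        rw [abs_mul, abs_of_pos (by positivity : 0 < κ ^ 2), mul_assoc]
        gcongr
        refine (abs_add_le _ _).trans ?_
        rw [abs_mul, abs_mul (G₁ / L), abs_of_nonneg hjk]
        have e3 : |(if j = k then q j else 0) - q j * q k|
            ≤ (if j = k then q j else 0) + q j * q k := by
          refine (abs_sub _ _).trans ?_
          rw [abs_of_nonneg hite, abs_of_nonneg hjk]
        calc _ ≤ K / L * (q j * q k) + K / L * ((if j = k then q j else 0) + q j * q k) := by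
              gcongr
          _ = _ := by ring
      refine (Finset.sum_le_sum fun j _ => Finset.sum_le_sum fun k _ => hb j k).trans (le_of_eq ?_)
      simp_rw [← Finset.mul_sum, Finset.sum_add_distrib, Finset.sum_ite_eq, ← Finset.mul_sum,
        hq1]
      simp [hq1, hκ]
      field_simp
      norm_num
    · have key := taylor_smooth_logSumExp h₀ h₁ h₂ k₁ k₂ k₃ hL (a := A w)
        (x := fun j => κ * v j) (M := κ * ‖v‖) (hApos w) (fun j => by
          rw [abs_mul, abs_of_pos hκ0]
          gcongr
          exact norm_le_pi_norm v j)
      have s1 : expSum (A w) (fun j => κ * v j) 0 1 = ∑ j, A (w + v) j := by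
        unfold expSum
        refine Finset.sum_congr rfl fun j _ => ?_
        simp only [hA, pow_zero, mul_one, one_mul, ← Real.exp_add, Pi.add_apply]
        ring_nf
      have s0 : expSum (A w) (fun j => κ * v j) 0 0 = S := by
        simp [expSum, hS]
      have r1 : expRatio (A w) (fun j => κ * v j) 1 0 = κ * ∑ j, q j * v j := by
        rw [expRatio, s0, expSum, Finset.sum_div, Finset.mul_sum]
        refine Finset.sum_congr rfl fun j _ => ?_
        simp [hq]; ring
      have r2 : expRatio (A w) (fun j => κ * v j) 2 0 = κ ^ 2 * ∑ j, q j * v j ^ 2 := by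
        rw [expRatio, s0, expSum, Finset.sum_div, Finset.mul_sum]
        refine Finset.sum_congr rfl fun j _ => ?_
        simp [hq]; ring
      rw [s1, s0, r1, r2] at key
      have hlin : ∑ j, G₁ * (κ * q j / L) * v j = G₁ * (κ * (∑ j, q j * v j) / L) := by
        rw [Finset.mul_sum, Finset.sum_div, Finset.mul_sum]
        exact Finset.sum_congr rfl fun j _ => by ring
      have hqq : ∑ j, ∑ k, q j * q k * (v j * v k) = (∑ j, q j * v j) ^ 2 := by
        rw [sq, Finset.sum_mul_sum]
        exact Finset.sum_congr rfl fun j _ => Finset.sum_congr rfl fun k _ => by ring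
      have hd : ∑ j, ∑ k, (if j = k then q j else 0) * (v j * v k) = ∑ j, q j * v j ^ 2 := by
        refine Finset.sum_congr rfl fun j _ => ?_
        simp_rw [ite_mul, zero_mul, Finset.sum_ite_eq, Finset.mem_univ, if_true]
        ring
      have hquad : ∑ j, ∑ k, κ ^ 2 * (G₂ / L ^ 2 * (q j * q k)
          + G₁ / L * ((if j = k then q j else 0) - q j * q k)) * (v j * v k)
          = G₂ * (κ * (∑ j, q j * v j) / L) ^ 2
            + G₁ * ((κ ^ 2 * ∑ j, q j * v j ^ 2 - (κ * ∑ j, q j * v j) ^ 2) / L) := by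
        have : ∀ j k, κ ^ 2 * (G₂ / L ^ 2 * (q j * q k)
          + G₁ / L * ((if j = k then q j else 0) - q j * q k)) * (v j * v k)
          = κ ^ 2 * (G₂ / L ^ 2 - G₁ / L) * (q j * q k * (v j * v k))
            + κ ^ 2 * (G₁ / L) * ((if j = k then q j else 0) * (v j * v k)) := fun j k => by ring
        simp_rw [this, Finset.sum_add_distrib, ← Finset.mul_sum, hqq, hd]
        field_simp
        ring
      simp only [hlin, hquad]
      convert key using 1
      ring
  · intro w hw
    refine glo _ ?_
    rw [div_le_one hL0]
    refine le_trans (Real.log_le_log (hSpos w) ?_) hcard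
    calc ∑ j, A w j ≤ ∑ j : ι, (1 : ℝ) := Finset.sum_le_sum fun j _ => by
          rw [hA]
          refine Real.exp_le_one_iff.2 (mul_nonpos_of_nonneg_of_nonpos hκ0.le ?_)
          linarith [hw j]
      _ = Fintype.card ι := by simp
  · intro w j hj
    refine ghi _ ?_
    rw [le_div_iff₀ hL0, Real.le_log_iff_exp_le (hSpos w)]
    refine le_trans ?_ (Finset.single_le_sum (fun k _ => (hApos w k).le) (Finset.mem_univ j))
    refine Real.exp_le_exp.2 ?_
    have : κ * (2 * δ) = 2 * L := by rw [hκ]; field_simp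
    nlinarith

end SmoothMax

/-! ### Gaussian comparison for smooth functions by Lindeberg replacement. -/

section GaussianInterpolation

open scoped Measure

variable {ι : Type*} [Fintype ι]

/-- A centered Gaussian measure on `ι → ℝ`. -/
structure IsCenteredGaussian (μ : Measure (ι → ℝ)) : Prop where
  isGaussian : IsGaussian μ
  mean_zero : ∀ j, ∫ w, w j ∂μ = 0

namespace IsCenteredGaussian

variable {μ ν : Measure (ι → ℝ)}

lemma memLp (hμ : IsCenteredGaussian μ) (j : ι) (q : ENNReal) (hq : q ≠ ⊤) :
    MemLp (fun w : ι → ℝ => w j) q μ :=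
  have := hμ.isGaussian
  IsGaussian.memLp_dual μ (ContinuousLinearMap.proj (R := ℝ) (φ := fun _ : ι => ℝ) j) q hq

lemma integrable (hμ : IsCenteredGaussian μ) (j : ι) : Integrable (fun w : ι → ℝ => w j) μ :=
  memLp_one_iff_integrable.1 (hμ.memLp j 1 (by simp))

lemma integrable_mul (hμ : IsCenteredGaussian μ) (j k : ι) :
    Integrable (fun w : ι → ℝ => w j * w k) μ :=
  (hμ.memLp j 2 (by simp)).integrable_mul (hμ.memLp k 2 (by simp))

lemma integrable_norm_pow_three (hμ : IsCenteredGaussian μ) :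
    Integrable (fun w : ι → ℝ => ‖w‖ ^ 3) μ := by
  have := hμ.isGaussian
  exact (IsGaussian.memLp_id μ 3 (by simp)).integrable_norm_pow (by simp)

lemma integral_dual (hμ : IsCenteredGaussian μ) (l : StrongDual ℝ (ι → ℝ)) :
    ∫ w, l w ∂μ = 0 := by
  classical
  have : ∀ w : ι → ℝ, l w = ∑ j, w j * l (fun k => if j = k then 1 else 0) := fun w =>
    l.toLinearMap.pi_apply_eq_sum_univ w
  rw [integral_congr_ae (Filter.Eventually.of_forall this),
    integral_finsetSum _ fun j _ => (hμ.integrable j).mul_const _]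
  simp [integral_mul_const, hμ.mean_zero]

lemma charFunDual_eq (hμ : IsCenteredGaussian μ) (l : StrongDual ℝ (ι → ℝ)) :
    charFunDual μ l = Complex.exp (-Var[l; μ] / 2) :=
  have := hμ.isGaussian
  IsGaussian.charFunDual_eq_of_forall_strongDual_eq_zero hμ.integral_dual l

lemma map (hμ : IsCenteredGaussian μ) {κ : Type*} [Fintype κ] (T : (ι → ℝ) →L[ℝ] (κ → ℝ)) :
    IsCenteredGaussian (μ.map T) where
  isGaussian := have := hμ.isGaussian; inferInstance
  mean_zero j := by
    rw [integral_map (by fun_prop) (f := fun w : κ → ℝ => w j)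
      (measurable_pi_apply j).aestronglyMeasurable]
    exact hμ.integral_dual ((ContinuousLinearMap.proj (R := ℝ) (φ := fun _ : κ => ℝ) j).comp T)

end IsCenteredGaussian

/-- The law of `√a • w` under `μ`. -/
def scaleSqrt (a : ℝ) (μ : Measure (ι → ℝ)) : Measure (ι → ℝ) :=
  μ.map (fun w => Real.sqrt a • w)

instance (a : ℝ) (μ : Measure (ι → ℝ)) [IsProbabilityMeasure μ] :
    IsProbabilityMeasure (scaleSqrt a μ) :=
  Measure.isProbabilityMeasure_map (by fun_prop)

lemma IsCenteredGaussian.scaleSqrt {μ : Measure (ι → ℝ)} (hμ : IsCenteredGaussian μ) (a : ℝ) :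
    IsCenteredGaussian (scaleSqrt a μ) :=
  hμ.map (Real.sqrt a • ContinuousLinearMap.id ℝ (ι → ℝ))

lemma charFunDual_scaleSqrt {μ : Measure (ι → ℝ)} (hμ : IsCenteredGaussian μ) {a : ℝ}
    (ha : 0 ≤ a) (l : StrongDual ℝ (ι → ℝ)) :
    charFunDual (scaleSqrt a μ) l = Complex.exp (-(a * Var[l; μ]) / 2) := by
  rw [(hμ.scaleSqrt a).charFunDual_eq l, scaleSqrt, variance_map (by fun_prop) (by fun_prop)]
  have : l ∘ (fun w : ι → ℝ => Real.sqrt a • w) = fun w => Real.sqrt a * l w := by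
    ext w; simp
  rw [this, variance_const_mul, Real.sq_sqrt ha]
  push_cast
  rfl

/-- Variances of independent summands add in every direction, and they determine a centred Gaussian
law. This allows such a law to be cut into independent increments of small variance. -/
lemma scaleSqrt_conv_scaleSqrt {μ : Measure (ι → ℝ)} (hμ : IsCenteredGaussian μ) {a b : ℝ}
    (ha : 0 ≤ a) (hb : 0 ≤ b) :
    scaleSqrt a μ ∗ scaleSqrt b μ = scaleSqrt (a + b) μ := by
  have := hμ.isGaussian
  refine Measure.ext_of_charFunDual ?_
  ext l
  rw [charFunDual_conv, charFunDual_scaleSqrt hμ ha, charFunDual_scaleSqrt hμ hb,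
    charFunDual_scaleSqrt hμ (by positivity), ← Complex.exp_add]
  congr 1
  push_cast
  ring

lemma scaleSqrt_zero_conv {μ ν : Measure (ι → ℝ)} [IsProbabilityMeasure μ]
    [IsProbabilityMeasure ν] : scaleSqrt 0 μ ∗ ν = ν := by
  have : scaleSqrt 0 μ = Measure.dirac 0 := by
    simp [scaleSqrt, Measure.map_const]
  rw [this, Measure.dirac_zero_conv]

omit [Fintype ι] in
lemma scaleSqrt_one {μ : Measure (ι → ℝ)} : scaleSqrt 1 μ = μ := by
  simp [scaleSqrt]

variable {m : (ι → ℝ) → ℝ} {M : ℝ}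

lemma HasHessianBound.integrable (hm : HasHessianBound m M) (μ : Measure (ι → ℝ))
    [IsFiniteMeasure μ] : Integrable m μ :=
  Integrable.of_bound (C := 1) hm.continuous.measurable.aestronglyMeasurable
    (Filter.Eventually.of_forall fun w => by
      rw [Real.norm_eq_abs, abs_of_nonneg (hm.nonneg w)]; exact hm.le_one w)

/-- One step of the Lindeberg replacement: two centered Gaussian increments of small variance. -/
lemma HasHessianBound.abs_integral_increment_le [Nonempty ι] (hm : HasHessianBound m M)
    {μ ν : Measure (ι → ℝ)} (hμ : IsCenteredGaussian μ) (hν : IsCenteredGaussian ν) {Δ : ℝ}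
    (hΔ : ∀ j k, |∫ w, w j * w k ∂μ - ∫ w, w j * w k ∂ν| ≤ Δ) :
    ∃ K : ℝ, ∀ h : ℝ, 0 ≤ h → ∀ ρ : Measure (ι → ℝ), IsProbabilityMeasure ρ →
      |∫ w, m w ∂(ρ ∗ scaleSqrt h μ) - ∫ w, m w ∂(ρ ∗ scaleSqrt h ν)|
        ≤ h * (M * Δ / 2) + K * (h * Real.sqrt h) := by
  have := hμ.isGaussian
  have := hν.isGaussian
  obtain ⟨K, hK, htay⟩ := hm.taylor
  -- Averaging the expansion over one increment removes the linear term, turns the quadratic one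
  -- into `h` times the covariance, and leaves a remainder of order `h ^ (3/2)`.
  have hone : ∀ (μ : Measure (ι → ℝ)), IsCenteredGaussian μ → ∀ h : ℝ, 0 ≤ h → ∀ (w : ι → ℝ)
      (l : ι → ℝ) (H : ι → ι → ℝ),
      (∀ v, |m (w + v) - m w - ∑ j, l j * v j - (∑ j, ∑ k, H j k * (v j * v k)) / 2|
        ≤ K * ‖v‖ ^ 3) →
      |∫ v, m (w + v) ∂(scaleSqrt h μ) - m w - h * ((∑ j, ∑ k, H j k * ∫ v, v j * v k ∂μ) / 2)|
        ≤ K * (∫ v, ‖v‖ ^ 3 ∂μ) * (h * Real.sqrt h) := by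
    intro μ hμ h hh w l H htay
    have := hμ.isGaussian
    have hmi : Integrable (fun v => m (w + Real.sqrt h • v)) μ :=
      Integrable.of_bound (C := 1)
        (hm.continuous.comp (by fun_prop)).measurable.aestronglyMeasurable
        (Filter.Eventually.of_forall fun v => by
          rw [Real.norm_eq_abs, abs_of_nonneg (hm.nonneg _)]; exact hm.le_one _)
    have hl : Integrable (fun v : ι → ℝ => ∑ j, l j * (Real.sqrt h • v) j) μ :=
      integrable_finsetSum _ fun j _ => by
        simpa using ((hμ.integrable j).const_mul (Real.sqrt h)).const_mul (l j)
    have hl0 : ∫ v : ι → ℝ, ∑ j, l j * (Real.sqrt h • v) j ∂μ = 0 := by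
      rw [integral_finsetSum _ fun j _ => by
        simpa using ((hμ.integrable j).const_mul (Real.sqrt h)).const_mul (l j)]
      simp [integral_const_mul, hμ.mean_zero]
    have hij : ∀ j k, Integrable
        (fun v : ι → ℝ => H j k * ((Real.sqrt h • v) j * (Real.sqrt h • v) k)) μ := fun j k => by
      have := ((hμ.integrable_mul j k).const_mul h).const_mul (H j k)
      refine this.congr (Filter.Eventually.of_forall fun v => ?_)
      simp only [Pi.smul_apply, smul_eq_mul]
      rw [mul_mul_mul_comm, Real.mul_self_sqrt hh]
    have hq : Integrable (fun v : ι → ℝ =>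
        (∑ j, ∑ k, H j k * ((Real.sqrt h • v) j * (Real.sqrt h • v) k)) / 2) μ :=
      (integrable_finsetSum _ fun j _ => integrable_finsetSum _ fun k _ => hij j k).div_const 2
    have hq0 : ∫ v : ι → ℝ,
        (∑ j, ∑ k, H j k * ((Real.sqrt h • v) j * (Real.sqrt h • v) k)) / 2 ∂μ
        = h * ((∑ j, ∑ k, H j k * ∫ v, v j * v k ∂μ) / 2) := by
      rw [integral_div, integral_finsetSum _ fun j _ => integrable_finsetSum _ fun k _ => hij j k,
        ← mul_div_assoc, Finset.mul_sum]
      congr 1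
      refine Finset.sum_congr rfl fun j _ => ?_
      rw [integral_finsetSum _ fun k _ => hij j k, Finset.mul_sum]
      refine Finset.sum_congr rfl fun k _ => ?_
      rw [integral_const_mul, mul_left_comm, ← integral_const_mul h]
      congr 2
      ext v
      simp only [Pi.smul_apply, smul_eq_mul]
      rw [mul_mul_mul_comm, Real.mul_self_sqrt hh]
    have hsc : ∫ v, m (w + v) ∂(scaleSqrt h μ) = ∫ v, m (w + Real.sqrt h • v) ∂μ := by
      have hc : Continuous fun v => m (w + v) := hm.continuous.comp (by fun_prop)
      rw [scaleSqrt, integral_map (by fun_prop) hc.measurable.aestronglyMeasurable]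
    have hrw : ∫ v, m (w + v) ∂(scaleSqrt h μ) - m w
          - h * ((∑ j, ∑ k, H j k * ∫ v, v j * v k ∂μ) / 2)
        = ∫ v, (m (w + Real.sqrt h • v) - m w - ∑ j, l j * (Real.sqrt h • v) j
            - (∑ j, ∑ k, H j k * ((Real.sqrt h • v) j * (Real.sqrt h • v) k)) / 2) ∂μ := by
      have i1 : Integrable (fun v => m (w + Real.sqrt h • v) - m w) μ :=
        hmi.sub (integrable_const _)
      have i2 : Integrable (fun v => m (w + Real.sqrt h • v) - m w
          - ∑ j, l j * (Real.sqrt h • v) j) μ := i1.sub hl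
      rw [integral_sub i2 hq, integral_sub i1 hl, integral_sub hmi (integrable_const _), hl0, hq0,
        hsc]
      simp
    rw [hrw, ← Real.norm_eq_abs]
    calc _ ≤ ∫ v, (K * (h * Real.sqrt h)) * ‖v‖ ^ 3 ∂μ := by
          refine norm_integral_le_of_norm_le (hμ.integrable_norm_pow_three.const_mul _)
            (Filter.Eventually.of_forall fun v => ?_)
          refine (htay (Real.sqrt h • v)).trans (le_of_eq ?_)
          rw [norm_smul, Real.norm_eq_abs, abs_of_nonneg (Real.sqrt_nonneg h), mul_pow,
            show Real.sqrt h ^ 3 = h * Real.sqrt h by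
              rw [pow_succ, Real.sq_sqrt hh]]
          ring
      _ = _ := by rw [integral_const_mul]; ring
  -- The constant depends on neither `h` nor `ρ`, so it serves for all steps of the interpolation.
  refine ⟨K * (∫ v, ‖v‖ ^ 3 ∂μ) + K * (∫ v, ‖v‖ ^ 3 ∂ν), fun h hh ρ _ => ?_⟩
  rw [integral_conv (hm.integrable _), integral_conv (hm.integrable _)]
  have hint : ∀ (μ : Measure (ι → ℝ)) [IsProbabilityMeasure μ],
      Integrable (fun w => ∫ v, m (w + v) ∂μ) ρ := fun μ _ =>
    ((integrable_map_measure (f := fun x : (ι → ℝ) × (ι → ℝ) => x.1 + x.2)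
      hm.continuous.measurable.aestronglyMeasurable (by fun_prop)).1
      (hm.integrable _ : Integrable m ((ρ.prod μ).map fun x => x.1 + x.2))).integral_prod_left
  rw [← integral_sub (hint _) (hint _), ← Real.norm_eq_abs]
  refine (norm_integral_le_of_norm_le_const (C := h * (M * Δ / 2)
    + (K * (∫ v, ‖v‖ ^ 3 ∂μ) + K * (∫ v, ‖v‖ ^ 3 ∂ν)) * (h * Real.sqrt h))
    (Filter.Eventually.of_forall fun w => ?_)).trans (by simp)
  obtain ⟨l, H, hH, ht⟩ := htay w
  have a1 := hone μ hμ h hh w l H ht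
  have a2 := hone ν hν h hh w l H ht
  -- Duality of the `ℓ¹` norm of the Hessian with the entrywise maximum of the covariance
  -- difference.
  have a3 : |(∑ j, ∑ k, H j k * ∫ v, v j * v k ∂μ) / 2 - (∑ j, ∑ k, H j k * ∫ v, v j * v k ∂ν) / 2|
      ≤ M * Δ / 2 := by
    rw [← sub_div, abs_div, abs_of_pos (by norm_num : (0 : ℝ) < 2)]
    gcongr
    simp_rw [← Finset.sum_sub_distrib, ← mul_sub]
    refine (Finset.abs_sum_le_sum_abs _ _).trans ?_
    have hΔ0 : ∀ j k : ι, 0 ≤ Δ := fun j k => (abs_nonneg _).trans (hΔ j k)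
    calc _ ≤ ∑ j, ∑ k, |H j k| * Δ := by
          refine Finset.sum_le_sum fun j _ => (Finset.abs_sum_le_sum_abs _ _).trans
            (Finset.sum_le_sum fun k _ => ?_)
          rw [abs_mul]
          gcongr
          exact hΔ j k
      _ = (∑ j, ∑ k, |H j k|) * Δ := by simp_rw [Finset.sum_mul]
      _ ≤ M * Δ := by
          have j := Classical.arbitrary ι
          exact mul_le_mul_of_nonneg_right hH (hΔ0 j j)
  rw [Real.norm_eq_abs]
  rw [abs_le] at *
  constructor <;> nlinarith

/-- Gaussian comparison for smooth functions. -/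
lemma HasHessianBound.abs_integral_sub_le [Nonempty ι] (hm : HasHessianBound m M)
    {μ ν : Measure (ι → ℝ)} (hμ : IsCenteredGaussian μ) (hν : IsCenteredGaussian ν) {Δ : ℝ}
    (hΔ : ∀ j k, |∫ w, w j * w k ∂μ - ∫ w, w j * w k ∂ν| ≤ Δ) :
    |∫ w, m w ∂μ - ∫ w, m w ∂ν| ≤ M * Δ / 2 := by
  have := hμ.isGaussian
  have := hν.isGaussian
  obtain ⟨K, hK⟩ := hm.abs_integral_increment_le hμ hν hΔ
  have hbound : ∀ N : ℕ, |∫ w, m w ∂μ - ∫ w, m w ∂ν|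
      ≤ M * Δ / 2 + K * Real.sqrt (1 / ((N : ℝ) + 1)) := by
    intro N
    set h : ℝ := 1 / ((N : ℝ) + 1) with hh
    have hh0 : 0 ≤ h := by positivity
    have hNh : ((N : ℝ) + 1) * h = 1 := by rw [hh]; field_simp
    -- In `F k` a share `k / (N + 1)` of the variance comes from `μ` and the rest from `ν`.
    -- Consecutive values differ in a single increment, and the sum telescopes from `ν` to `μ`.
    set F : ℕ → ℝ := fun k => ∫ w, m w ∂(scaleSqrt (k * h) μ ∗ scaleSqrt (((N : ℝ) + 1 - k) * h) ν)
      with hF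
    have hstep : ∀ k ∈ Finset.range (N + 1), |F (k + 1) - F k|
        ≤ h * (M * Δ / 2) + K * (h * Real.sqrt h) := by
      intro k hk
      have hkN : (k : ℝ) ≤ N := by exact_mod_cast Nat.lt_succ_iff.1 (Finset.mem_range.1 hk)
      have hr : 0 ≤ ((N : ℝ) - k) * h := mul_nonneg (by linarith) hh0
      have e1 : scaleSqrt (((k + 1 : ℕ) : ℝ) * h) μ ∗ scaleSqrt (((N : ℝ) + 1 - (k + 1 : ℕ)) * h) ν
          = (scaleSqrt (k * h) μ ∗ scaleSqrt (((N : ℝ) - k) * h) ν) ∗ scaleSqrt h μ := by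
        rw [Measure.conv_assoc, Measure.conv_comm (scaleSqrt (((N : ℝ) - k) * h) ν),
          ← Measure.conv_assoc, scaleSqrt_conv_scaleSqrt hμ (by positivity) hh0]
        congr 2 <;> push_cast <;> ring
      have e2 : scaleSqrt (k * h) μ ∗ scaleSqrt (((N : ℝ) + 1 - k) * h) ν
          = (scaleSqrt (k * h) μ ∗ scaleSqrt (((N : ℝ) - k) * h) ν) ∗ scaleSqrt h ν := by
        rw [Measure.conv_assoc, scaleSqrt_conv_scaleSqrt hν hr hh0]
        congr 2; ring
      simp only [hF]
      rw [e1, e2]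
      exact hK h hh0 _ inferInstance
    have h0 : F 0 = ∫ w, m w ∂ν := by
      simp only [hF, Nat.cast_zero, zero_mul, sub_zero, hNh, scaleSqrt_zero_conv, scaleSqrt_one]
    have h1 : F (N + 1) = ∫ w, m w ∂μ := by
      simp only [hF, Nat.cast_add, Nat.cast_one, sub_self, zero_mul, hNh]
      rw [Measure.conv_comm, scaleSqrt_zero_conv, scaleSqrt_one]
    rw [← h0, ← h1, ← Finset.sum_range_sub]
    refine (Finset.abs_sum_le_sum_abs _ _).trans ((Finset.sum_le_sum hstep).trans (le_of_eq ?_))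
    rw [Finset.sum_const, Finset.card_range, nsmul_eq_mul]
    push_cast
    calc _ = (((N : ℝ) + 1) * h) * (M * Δ / 2 + K * Real.sqrt h) := by ring
      _ = _ := by rw [hNh, one_mul]
  -- The `N + 1` remainders add up to `K √h`, which tends to zero.
  have hlim : Filter.Tendsto (fun N : ℕ => M * Δ / 2 + K * Real.sqrt (1 / ((N : ℝ) + 1)))
      Filter.atTop (nhds (M * Δ / 2 + K * Real.sqrt 0)) :=
    ((Real.continuous_sqrt.tendsto 0).comp tendsto_one_div_add_atTop_nhds_zero_nat).const_mul K
      |>.const_add _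
  simpa using ge_of_tendsto' hlim hbound

end GaussianInterpolation

/-! ### Nazarov's anti-concentration inequality. -/

section AntiConcentration

lemma gaussianPDFReal_le_exp (x : ℝ) : gaussianPDFReal 0 1 x ≤ Real.exp (-x ^ 2 / 2) := by
  rw [gaussianPDFReal]
  have h1 : (1 : ℝ) ≤ Real.sqrt (2 * Real.pi * (1 : NNReal)) := by
    rw [Real.one_le_sqrt]
    simp only [NNReal.coe_one, mul_one]
    nlinarith [Real.pi_gt_three]
  have h2 := inv_le_one_of_one_le₀ h1
  simp only [sub_zero, NNReal.coe_one, mul_one] at h2 ⊢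
  exact mul_le_of_le_one_left (Real.exp_pos _).le h2

/-- A Mills ratio bound for the standard normal distribution. -/
lemma gaussianPDFReal_le_mul_tail {s u : ℝ} (hs : 0 ≤ s) (hu : u ≤ s) :
    ENNReal.ofReal (gaussianPDFReal 0 1 u)
      ≤ ENNReal.ofReal (Real.exp 1 * (s + 1)) * gaussianReal 0 1 (Set.Ioi u) := by
  -- Over `(u, u + h]` the exponent `x² / 2` grows by at most `h (2s + h) / 2 ≤ 1`, so the density
  -- loses at most a factor `e` there.
  set h : ℝ := 1 / (s + 1) with hh
  have hs1 : 0 < s + 1 := by linarith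
  have hh0 : 0 < h := by positivity
  have hh1 : h ≤ 1 := by rw [hh, div_le_one hs1]; linarith
  have hhs : h * (s + 1) = 1 := by rw [hh]; field_simp
  have hpt : ∀ x ∈ Set.Ioc u (u + h),
      ENNReal.ofReal (Real.exp (-1) * gaussianPDFReal 0 1 u) ≤ gaussianPDF 0 1 x := by
    intro x hx
    refine ENNReal.ofReal_le_ofReal ?_
    simp only [gaussianPDFReal, NNReal.coe_one, mul_one, sub_zero]
    rw [mul_left_comm, ← Real.exp_add]
    gcongr
    have h1 := hx.1
    have h2 := hx.2
    by_cases hxu : x + u ≤ 0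
    · nlinarith
    · push Not at hxu
      have h3 : (x - u) * (x + u) ≤ h * (2 * s + h) :=
        mul_le_mul (by linarith) (by linarith) hxu.le hh0.le
      nlinarith
  have key : ENNReal.ofReal (Real.exp (-1) * gaussianPDFReal 0 1 u) * ENNReal.ofReal h
      ≤ gaussianReal 0 1 (Set.Ioi u) := by
    rw [gaussianReal_apply 0 one_ne_zero]
    calc _ = ∫⁻ _ in Set.Ioc u (u + h), ENNReal.ofReal (Real.exp (-1) * gaussianPDFReal 0 1 u) := by
          rw [setLIntegral_const, Real.volume_Ioc]; simp
      _ ≤ ∫⁻ x in Set.Ioc u (u + h), gaussianPDF 0 1 x :=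
          setLIntegral_mono (measurable_gaussianPDF 0 1) hpt
      _ ≤ _ := lintegral_mono_set Set.Ioc_subset_Ioi_self
  refine le_trans (le_of_eq ?_) (mul_le_mul_right key _)
  have hp := gaussianPDFReal_nonneg 0 1 u
  rw [← ENNReal.ofReal_mul (by positivity), ← ENNReal.ofReal_mul (by positivity)]
  congr 1
  rw [Real.exp_neg]
  field_simp
  linear_combination -(gaussianPDFReal 0 1 u) * hhs

variable {ι : Type*} [Fintype ι]

/-- The region of the values `v` of the residuals for which coordinate `j` has the first maximal
excess over `c` when that excess is `a`; ties are broken by `f`. -/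
def argmaxRegion (f : ι → ℕ) (r : ι → ι → ℝ) (c : ι → ℝ) (j : ι) : Set (ℝ × (ι → ℝ)) :=
  {q | ∀ k, if f k < f j then q.2 k + r j k * (c j + q.1) < c k + q.1
    else q.2 k + r j k * (c j + q.1) ≤ c k + q.1}

lemma measurableSet_argmaxRegion (f : ι → ℕ) (r : ι → ι → ℝ) (c : ι → ℝ) (j : ι) :
    MeasurableSet (argmaxRegion f r c j) := by
  rw [argmaxRegion, Set.ofPred_forall]
  refine MeasurableSet.iInter fun k => ?_
  split_ifs
  · exact measurableSet_lt (by fun_prop) (by fun_prop)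
  · exact measurableSet_le (by fun_prop) (by fun_prop)

/-- The residuals of the coordinates after regression on coordinate `j`. -/
def residual (r : ι → ι → ℝ) (j : ι) (w : ι → ℝ) : ι → ℝ := fun k => w k - r j k * w j

omit [Fintype ι] in
@[fun_prop]
lemma measurable_residual (r : ι → ι → ℝ) (j : ι) : Measurable (residual r j) := by
  unfold residual
  fun_prop

variable {ν : Measure (ι → ℝ)}

lemma IsCenteredGaussian.variance_eval (hν : IsCenteredGaussian ν) (j : ι) :
    Var[fun w : ι → ℝ => w j; ν] = ∫ w, w j * w j ∂ν := by
  have := hν.isGaussian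
  rw [variance_eq_sub (hν.memLp j 2 (by simp)), hν.mean_zero j]
  simp [sq]

lemma IsCenteredGaussian.map_eval (hν : IsCenteredGaussian ν) {j : ι}
    (h1 : ∫ w, w j * w j ∂ν = 1) : ν.map (fun w => w j) = gaussianReal 0 1 := by
  have := hν.isGaussian
  have h := IsGaussian.map_eq_gaussianReal (μ := ν)
    (ContinuousLinearMap.proj (R := ℝ) (φ := fun _ : ι => ℝ) j)
  have e : ⇑(ContinuousLinearMap.proj (R := ℝ) (φ := fun _ : ι => ℝ) j) = fun w : ι → ℝ => w j :=
    rfl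
  rw [e, hν.variance_eval j, h1, hν.mean_zero j] at h
  simpa using h

/-- By joint Gaussianity independence reduces to zero covariance, and the regression coefficient on
a coordinate of unit variance is the covariance itself. -/
lemma IsCenteredGaussian.indepFun_residual (hν : IsCenteredGaussian ν) {j : ι}
    (h1 : ∫ w, w j * w j ∂ν = 1) :
    IndepFun (fun w : ι → ℝ => w j) (residual (fun j k => ∫ w, w j * w k ∂ν) j) ν := by
  have := hν.isGaussian
  set r : ι → ι → ℝ := fun j k => ∫ w, w j * w k ∂ν with hr
  have hg : HasGaussianLaw (fun w : ι → ℝ => ((fun _ : Unit => w j), (fun k => residual r j w k)))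
      ν := by
    let T : (ι → ℝ) →L[ℝ] (Unit → ℝ) × (ι → ℝ) :=
      (ContinuousLinearMap.pi fun _ => ContinuousLinearMap.proj j).prod
        (ContinuousLinearMap.pi fun k => ContinuousLinearMap.proj k
          - r j k • ContinuousLinearMap.proj j)
    exact (IsGaussian.hasGaussianLaw_id (μ := ν)).map_fun T
  have hi := HasGaussianLaw.indepFun_of_covariance_eval
    (X := fun (_ : Unit) (w : ι → ℝ) => w j) (Y := fun k (w : ι → ℝ) => residual r j w k) hg
    (fun _ k => by
      have hk : MemLp (fun w : ι → ℝ => residual r j w k) 2 ν :=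
        (hν.memLp k 2 (by simp)).sub ((hν.memLp j 2 (by simp)).const_mul (r j k))
      rw [covariance_eq_sub (hν.memLp j 2 (by simp)) hk, hν.mean_zero j, zero_mul, sub_zero]
      have : (fun w : ι → ℝ => w j) * (fun w => residual r j w k)
          = fun w => w j * w k - r j k * (w j * w j) := by
        ext w
        simp only [Pi.mul_apply, residual]
        ring
      rw [this, integral_sub (hν.integrable_mul j k) ((hν.integrable_mul j j).const_mul _),
        integral_const_mul, h1]
      simp [hr])
  exact hi.comp (φ := fun g : Unit → ℝ => g ()) (ψ := id) (measurable_pi_apply ()) measurable_id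

lemma IsCenteredGaussian.abs_integral_mul_le_one (hν : IsCenteredGaussian ν)
    (h1 : ∀ j, ∫ w, w j * w j ∂ν = 1) (j k : ι) : |∫ w, w j * w k ∂ν| ≤ 1 := by
  rw [← Real.norm_eq_abs]
  calc _ ≤ ∫ w, (w j * w j + w k * w k) / 2 ∂ν := by
        refine norm_integral_le_of_norm_le
          (((hν.integrable_mul j j).add (hν.integrable_mul k k)).div_const 2)
          (Filter.Eventually.of_forall fun w => ?_)
        rw [Real.norm_eq_abs, abs_le]
        constructor <;> nlinarith [sq_nonneg (w j - w k), sq_nonneg (w j + w k)]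
    _ = 1 := by
        rw [integral_div, integral_add (hν.integrable_mul j j) (hν.integrable_mul k k), h1, h1]
        norm_num

/-- The outward cones over the facets of an orthant are disjoint, hence the sum of their Gaussian
measures is at most one. -/
lemma sum_tail_mul_le_one (hν : IsCenteredGaussian ν) (h1 : ∀ j, ∫ w, w j * w j ∂ν = 1)
    {f : ι → ℕ} (hf : Function.Injective f) (c : ι → ℝ) (a : ℝ) :
    ∑ j, gaussianReal 0 1 (Set.Ioi (c j + a)) *
      ν {w | (a, residual (fun j k => ∫ w, w j * w k ∂ν) j w) ∈
        argmaxRegion f (fun j k => ∫ w, w j * w k ∂ν) c j} ≤ 1 := by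
  have := hν.isGaussian
  set r : ι → ι → ℝ := fun j k => ∫ w, w j * w k ∂ν with hr
  set G : ι → Set (ι → ℝ) := fun j => (fun w : ι → ℝ => w j) ⁻¹' (Set.Ioi (c j + a)) ∩
    residual r j ⁻¹' {v | (a, v) ∈ argmaxRegion f r c j} with hG
  have hmE : ∀ j, MeasurableSet {v | (a, v) ∈ argmaxRegion f r c j} := fun j =>
    (measurableSet_argmaxRegion f r c j).preimage (by fun_prop)
  have hmG : ∀ j, MeasurableSet (G j) := fun j =>
    (measurableSet_Ioi.preimage (measurable_pi_apply j)).inter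
      ((hmE j).preimage (measurable_residual r j))
  have hmul : ∀ j, gaussianReal 0 1 (Set.Ioi (c j + a)) *
      ν {w | (a, residual r j w) ∈ argmaxRegion f r c j} = ν (G j) := by
    intro j
    rw [hG, (hν.indepFun_residual (h1 j)).measure_inter_preimage_eq_mul _ _ measurableSet_Ioi
      (hmE j), ← hν.map_eval (h1 j), Measure.map_apply (measurable_pi_apply j) measurableSet_Ioi]
    rfl
  -- A common point would have positive excesses `x`, `y` over `c + a` at `j` and `l`, with `y ≤ r
  -- x` and `x < r y` for their correlation `r`. This contradicts `|r| ≤ 1`; the strict inequality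
  -- comes from the tie-breaking.
  have hlt : ∀ j l w, f j < f l → w ∈ G j → w ∈ G l → False := by
    intro j l w hjl hj hl
    obtain ⟨hj1, hj2⟩ := hj
    obtain ⟨hl1, hl2⟩ := hl
    simp only [Set.mem_preimage, Set.mem_Ioi, Set.mem_ofPred_eq, argmaxRegion, residual]
      at hj1 hj2 hl1 hl2
    have e1 := hj2 l
    have e2 := hl2 j
    rw [if_neg (by omega)] at e1
    rw [if_pos hjl] at e2
    have hrs : r l j = r j l := by simp only [hr, mul_comm]
    rw [hrs] at e2
    have hb := abs_le.1 (hν.abs_integral_mul_le_one h1 j l)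
    change -1 ≤ r j l ∧ r j l ≤ 1 at hb
    set x := w j - (c j + a) with hx
    set y := w l - (c l + a) with hy
    have e1' : y ≤ r j l * x := by rw [hx, hy]; linarith
    have e2' : x < r j l * y := by rw [hx, hy]; linarith
    have hx0 : 0 < x := by linarith
    have hy0 : 0 < y := by linarith
    nlinarith
  have hdisj : Pairwise (Function.onFun Disjoint G) := by
    intro j l hjl
    refine Set.disjoint_left.2 fun w hj hl => ?_
    rcases lt_trichotomy (f j) (f l) with h | h | h
    · exact hlt j l w h hj hl
    · exact hjl (hf h)
    · exact hlt l j w h hl hj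
  calc _ = ∑ j, ν (G j) := Finset.sum_congr rfl fun j _ => hmul j
    _ = ν (⋃ j, G j) := by
        rw [measure_iUnion hdisj hmG, tsum_fintype]
    _ ≤ 1 := prob_le_one

/-- The probability that coordinate `j` has the first maximal excess and that this excess lies
in `(0, t]`, as an integral over the value of the excess. -/
lemma measure_argmax_eq (hν : IsCenteredGaussian ν) (h1 : ∀ j, ∫ w, w j * w j ∂ν = 1)
    (f : ι → ℕ) (c : ι → ℝ) (t : ℝ) (j : ι) :
    ν {w | w j - c j ∈ Set.Ioc 0 t ∧
        (w j - c j, residual (fun j k => ∫ w, w j * w k ∂ν) j w) ∈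
          argmaxRegion f (fun j k => ∫ w, w j * w k ∂ν) c j}
      = ∫⁻ a in Set.Ioc 0 t, ENNReal.ofReal (gaussianPDFReal 0 1 (c j + a)) *
          ν {w | (a, residual (fun j k => ∫ w, w j * w k ∂ν) j w) ∈
            argmaxRegion f (fun j k => ∫ w, w j * w k ∂ν) c j} := by
  have := hν.isGaussian
  set r : ι → ι → ℝ := fun j k => ∫ w, w j * w k ∂ν with hr
  set S : Set (ℝ × (ι → ℝ)) := {q | q.1 - c j ∈ Set.Ioc 0 t ∧
    (q.1 - c j, q.2) ∈ argmaxRegion f r c j} with hS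
  have hmS : MeasurableSet S := by
    refine MeasurableSet.inter ?_ ?_
    · exact measurableSet_Ioc.preimage (by fun_prop : Measurable fun q : ℝ × (ι → ℝ) => q.1 - c j)
    · exact (measurableSet_argmaxRegion f r c j).preimage
        (by fun_prop : Measurable fun q : ℝ × (ι → ℝ) => (q.1 - c j, q.2))
  have hmr := measurable_residual r j
  have hind := (indepFun_iff_map_prod_eq_prod_map_map
    (measurable_pi_apply j).aemeasurable hmr.aemeasurable).1
    (hν.indepFun_residual (h1 j))
  rw [hν.map_eval (h1 j)] at hind
  have : ν {w | w j - c j ∈ Set.Ioc 0 t ∧ (w j - c j, residual r j w) ∈ argmaxRegion f r c j}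
      = (ν.map fun w => (w j, residual r j w)) S := by
    rw [Measure.map_apply (by fun_prop) hmS]
    rfl
  -- Fubini for coordinate `j` and its independent residuals, followed by a translation by `c j`
  -- that makes the excess the integration variable.
  rw [this, hind, Measure.prod_apply hmS, gaussianReal_of_var_ne_zero 0 one_ne_zero,
    lintegral_withDensity_eq_lintegral_mul _ (measurable_gaussianPDF 0 1)
      (measurable_measure_prodMk_left hmS), ← lintegral_add_left_eq_self _ (c j),
    ← lintegral_indicator measurableSet_Ioc]
  refine lintegral_congr fun a => ?_
  simp only [Pi.mul_apply, Set.indicator]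
  rw [Measure.map_apply hmr (measurable_prodMk_left hmS)]
  split_ifs with ha
  · congr 2
    ext w
    simp only [hS, Set.mem_preimage, Set.mem_ofPred_eq, add_sub_cancel_left]
    exact and_iff_right ha
  · rw [show residual r j ⁻¹' (Prod.mk (c j + a) ⁻¹' S) = ∅ from ?_]
    · simp
    · ext w
      simp only [hS, Set.mem_preimage, Set.mem_ofPred_eq, add_sub_cancel_left]
      simp [ha]

/-- **Nazarov's inequality** for Gaussian vectors with unit variances. -/
lemma IsCenteredGaussian.anti_concentration_unit [Nonempty ι] (hν : IsCenteredGaussian ν)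
    (h1 : ∀ j, ∫ w, w j * w j ∂ν = 1) {L : ℝ} (hL : 0 ≤ L) (hcard : Real.log (Fintype.card ι) ≤ L)
    (c : ι → ℝ) {t : ℝ} (ht : 0 ≤ t) :
    ν ({w | ∀ j, w j ≤ c j + t} \ {w | ∀ j, w j ≤ c j})
      ≤ ENNReal.ofReal (t * (Real.exp 1 * (Real.sqrt (2 * L) + 1) + 1)) := by
  have := hν.isGaussian
  set r : ι → ι → ℝ := fun j k => ∫ w, w j * w k ∂ν with hr
  set f : ι → ℕ := fun j => (Fintype.equivFin ι j : ℕ) with hf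
  have hfi : Function.Injective f := fun j k h => by
    simpa [hf, Fin.val_inj] using h
  -- Beyond `s` the Gaussian density is at most `exp (-L) ≤ 1 / card ι`, so these coordinates
  -- contribute at most one in total; below `s` the Mills ratio bound applies.
  set s := Real.sqrt (2 * L) with hs
  have hs0 : 0 ≤ s := Real.sqrt_nonneg _
  have hs2 : s ^ 2 = 2 * L := Real.sq_sqrt (by positivity)
  set D : ι → Set (ι → ℝ) := fun j => {w | w j - c j ∈ Set.Ioc 0 t ∧
    (w j - c j, residual r j w) ∈ argmaxRegion f r c j} with hD
  -- In the boundary layer the largest excess lies in `(0, t]`; the region is indexed by the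
  -- maximising coordinate of least `f`.
  have hcover : {w : ι → ℝ | ∀ j, w j ≤ c j + t} \ {w | ∀ j, w j ≤ c j} ⊆ ⋃ j, D j := by
    rintro w ⟨hw1, hw2⟩
    obtain ⟨i, -, hi⟩ := Finset.exists_max_image Finset.univ (fun j => w j - c j)
      Finset.univ_nonempty
    obtain ⟨j, hj, hjmin⟩ := Finset.exists_min_image
      (Finset.univ.filter fun j => w j - c j = w i - c i) f ⟨i, by simp⟩
    have hj' : w j - c j = w i - c i := by simpa using hj
    refine Set.mem_iUnion.2 ⟨j, ⟨?_, by linarith [hw1 j]⟩, fun k => ?_⟩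
    · simp only [Set.mem_ofPred_eq, not_forall, not_le] at hw2
      obtain ⟨k, hk⟩ := hw2
      have := hi k (Finset.mem_univ k)
      linarith
    · have hk := hi k (Finset.mem_univ k)
      simp only [residual]
      split_ifs with hlt
      · rcases hk.lt_or_eq with h | h
        · linarith
        · have := hjmin k (by simpa using h)
          omega
      · linarith
  have hmeas : ∀ j, Measurable fun a : ℝ => ENNReal.ofReal (gaussianPDFReal 0 1 (c j + a)) *
      ν {w | (a, residual r j w) ∈ argmaxRegion f r c j} := by
    intro j
    have h := measurable_measure_prodMk_left (ν := ν) ((measurableSet_argmaxRegion f r c j).preimage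
      (by fun_prop : Measurable fun q : ℝ × (ι → ℝ) => (q.1, residual r j q.2)))
    refine Measurable.mul ?_ h
    exact ((measurable_gaussianPDFReal 0 1).comp (by fun_prop)).ennreal_ofReal
  have hpt : ∀ a : ℝ, ∑ j, ENNReal.ofReal (gaussianPDFReal 0 1 (c j + a)) *
      ν {w | (a, residual r j w) ∈ argmaxRegion f r c j}
      ≤ ENNReal.ofReal (Real.exp 1 * (s + 1) + 1) := by
    intro a
    have hone : ∀ j, ENNReal.ofReal (gaussianPDFReal 0 1 (c j + a)) *
        ν {w | (a, residual r j w) ∈ argmaxRegion f r c j}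
        ≤ ENNReal.ofReal (Real.exp 1 * (s + 1)) * (gaussianReal 0 1 (Set.Ioi (c j + a)) *
            ν {w | (a, residual r j w) ∈ argmaxRegion f r c j})
          + ENNReal.ofReal (Fintype.card ι : ℝ)⁻¹ := by
      intro j
      rcases le_or_gt (c j + a) s with h | h
      · rw [← mul_assoc]
        exact (mul_le_mul_left (gaussianPDFReal_le_mul_tail hs0 h) _).trans le_self_add
      · refine le_trans (mul_le_of_le_one_right' prob_le_one) (le_trans ?_ le_add_self)
        refine ENNReal.ofReal_le_ofReal ((gaussianPDFReal_le_exp _).trans ?_)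
        have hc : (0 : ℝ) < Fintype.card ι := by exact_mod_cast Fintype.card_pos
        rw [← Real.log_le_log_iff (Real.exp_pos _) (by positivity), Real.log_exp, Real.log_inv]
        nlinarith
    calc _ ≤ ∑ j, (ENNReal.ofReal (Real.exp 1 * (s + 1)) *
            (gaussianReal 0 1 (Set.Ioi (c j + a)) *
            ν {w | (a, residual r j w) ∈ argmaxRegion f r c j})
          + ENNReal.ofReal (Fintype.card ι : ℝ)⁻¹) := Finset.sum_le_sum fun j _ => hone j
      _ ≤ ENNReal.ofReal (Real.exp 1 * (s + 1)) * 1 + ENNReal.ofReal 1 := by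
          rw [Finset.sum_add_distrib, ← Finset.mul_sum]
          gcongr
          · exact sum_tail_mul_le_one hν h1 hfi c a
          · rw [Finset.sum_const, Finset.card_univ, nsmul_eq_mul, ← ENNReal.ofReal_natCast,
              ← ENNReal.ofReal_mul (by positivity), mul_inv_cancel₀ (by
                exact_mod_cast Fintype.card_ne_zero)]
      _ = _ := by rw [mul_one, ← ENNReal.ofReal_add (by positivity) zero_le_one]
  calc _ ≤ ∑ j, ν (D j) := (measure_mono hcover).trans (measure_iUnion_fintype_le _ _)
    _ = ∫⁻ a in Set.Ioc 0 t, ∑ j, ENNReal.ofReal (gaussianPDFReal 0 1 (c j + a)) *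
          ν {w | (a, residual r j w) ∈ argmaxRegion f r c j} := by
        rw [lintegral_finsetSum _ fun j _ => hmeas j]
        exact Finset.sum_congr rfl fun j _ => measure_argmax_eq hν h1 f c t j
    _ ≤ ∫⁻ _ in Set.Ioc 0 t, ENNReal.ofReal (Real.exp 1 * (s + 1) + 1) :=
        lintegral_mono fun a => hpt a
    _ = _ := by
        rw [setLIntegral_const, Real.volume_Ioc, sub_zero, mul_comm,
          ENNReal.ofReal_mul ht]

/-- **Nazarov's inequality**: anti-concentration of Gaussian vectors on orthants. -/
lemma IsCenteredGaussian.anti_concentration [Nonempty ι] (hν : IsCenteredGaussian ν) {b : ℝ}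
    (hb : 0 < b) (hvar : ∀ j, b ≤ ∫ w, w j * w j ∂ν) {L : ℝ} (hL : 1 ≤ L)
    (hcard : Real.log (Fintype.card ι) ≤ L) (c : ι → ℝ) {t : ℝ} (ht : 0 ≤ t) :
    ν.real {w | ∀ j, w j ≤ c j + t} ≤
      ν.real {w | ∀ j, w j ≤ c j} + 12 * t / Real.sqrt b * Real.sqrt L := by
  have := hν.isGaussian
  set σ : ι → ℝ := fun j => Real.sqrt (∫ w, w j * w j ∂ν) with hσ
  have hv0 : ∀ j, 0 < ∫ w, w j * w j ∂ν := fun j => hb.trans_le (hvar j)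
  have hσ0 : ∀ j, 0 < σ j := fun j => Real.sqrt_pos.2 (hv0 j)
  have hσb : ∀ j, Real.sqrt b ≤ σ j := fun j => Real.sqrt_le_sqrt (hvar j)
  have hb0 : 0 < Real.sqrt b := Real.sqrt_pos.2 hb
  -- Normalisation to unit variances; the layer width `t / σ j` in coordinate `j` is at most `t /
  -- √b`.
  let T : (ι → ℝ) →L[ℝ] (ι → ℝ) :=
    ContinuousLinearMap.pi fun j => (σ j)⁻¹ • ContinuousLinearMap.proj j
  have hT : ∀ w j, T w j = (σ j)⁻¹ * w j := fun w j => rfl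
  have hTν := hν.map T
  have h1 : ∀ j, ∫ w, w j * w j ∂(ν.map T) = 1 := by
    intro j
    rw [integral_map (by fun_prop) (by fun_prop)]
    have e : ∀ w, T w j * T w j = ((σ j)⁻¹ * (σ j)⁻¹) * (w j * w j) := fun w => by
      rw [hT]; ring
    rw [integral_congr_ae (Filter.Eventually.of_forall e), integral_const_mul,
      ← mul_inv, hσ, Real.mul_self_sqrt (hv0 j).le, inv_mul_cancel₀ (hv0 j).ne']
  have key := hTν.anti_concentration_unit h1 (by linarith : 0 ≤ L) hcard
    (fun j => (σ j)⁻¹ * c j) (t := t / Real.sqrt b) (by positivity)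
  have hmeas : ∀ d : ι → ℝ, MeasurableSet {w : ι → ℝ | ∀ j, w j ≤ d j} := fun d => by
    rw [Set.ofPred_forall]
    exact MeasurableSet.iInter fun j => measurableSet_le (by fun_prop) (by fun_prop)
  rw [Measure.map_apply (by fun_prop) ((hmeas _).diff (hmeas _))] at key
  have hsub : {w : ι → ℝ | ∀ j, w j ≤ c j + t} ⊆ {w | ∀ j, w j ≤ c j} ∪
      T ⁻¹' ({w | ∀ j, w j ≤ (σ j)⁻¹ * c j + t / Real.sqrt b} \
        {w | ∀ j, w j ≤ (σ j)⁻¹ * c j}) := by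
    intro w hw
    by_cases hc : ∀ j, w j ≤ c j
    · exact Or.inl hc
    · refine Or.inr ⟨fun j => ?_, fun h => hc fun j => ?_⟩
      · rw [hT]
        have h2 : (σ j)⁻¹ * t ≤ t / Real.sqrt b := by
          rw [inv_mul_eq_div]
          exact div_le_div_of_nonneg_left ht hb0 (hσb j)
        have h3 := mul_le_mul_of_nonneg_left (hw j) (inv_pos.2 (hσ0 j)).le
        rw [mul_add] at h3
        linarith
      · have := h j
        rw [hT] at this
        exact le_of_mul_le_mul_left this (inv_pos.2 (hσ0 j))
  refine (measureReal_mono hsub).trans ((measureReal_union_le _ _).trans ?_)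
  gcongr
  refine (ENNReal.toReal_mono ENNReal.ofReal_ne_top key).trans ?_
  rw [ENNReal.toReal_ofReal (by positivity)]
  have hsL : 1 ≤ Real.sqrt L := Real.one_le_sqrt.2 hL
  have h2L : Real.sqrt (2 * L) ≤ 1.5 * Real.sqrt L := by
    rw [Real.sqrt_mul (by norm_num)]
    gcongr
    rw [Real.sqrt_le_left (by norm_num)]
    norm_num
  have he := Real.exp_one_lt_d9
  have : Real.exp 1 * (Real.sqrt (2 * L) + 1) + 1 ≤ 12 * Real.sqrt L := by
    have : Real.exp 1 * (Real.sqrt (2 * L) + 1) ≤ 2.72 * (1.5 * Real.sqrt L + 1) := by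
      gcongr
      linarith
    linarith
  calc _ ≤ t / Real.sqrt b * (12 * Real.sqrt L) := by gcongr
    _ = _ := by ring

end AntiConcentration

/-! ### Gaussian comparison on orthants and on hyperrectangles. -/

section Comparison

lemma measurableSet_orthant {ι : Type*} [Finite ι] (c : ι → ℝ) :
    MeasurableSet {w : ι → ℝ | ∀ j, w j ≤ c j} := by
  rw [Set.ofPred_forall]
  exact MeasurableSet.iInter fun j => measurableSet_le (measurable_pi_apply j) measurable_const

/-- Gaussian comparison on orthants. -/
lemma exists_orthant_comparison {b : ℝ} (hb : 0 < b) : ∃ C : ℝ, 0 < C ∧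
    ∀ (ι : Type) [Fintype ι] [Nonempty ι] (L Δ : ℝ) (μ ν : Measure (ι → ℝ)),
      1 ≤ L → Real.log (Fintype.card ι) ≤ L → 0 < Δ →
      IsCenteredGaussian μ → IsCenteredGaussian ν → (∀ j, b ≤ ∫ w, w j * w j ∂ν) →
      (∀ j k, |∫ w, w j * w k ∂μ - ∫ w, w j * w k ∂ν| ≤ Δ) → ∀ c : ι → ℝ,
      |μ.real {w | ∀ j, w j ≤ c j} - ν.real {w | ∀ j, w j ≤ c j}|
        ≤ C * (Δ * L ^ 2) ^ (1 / 3 : ℝ) := by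
  obtain ⟨K, hK, hsm⟩ := exists_smooth_orthant
  have hb0 : 0 < Real.sqrt b := Real.sqrt_pos.2 hb
  refine ⟨K / 2 + 24 / Real.sqrt b, by positivity,
    fun ι _ _ L Δ μ ν hL hcard hΔ hμ hν hvar hcov c => ?_⟩
  have := hμ.isGaussian
  have := hν.isGaussian
  have hL0 : 0 < L := by linarith
  have hsL : 0 < Real.sqrt L := Real.sqrt_pos.2 hL0
  set u : ℝ := (Δ * L ^ 2) ^ (1 / 3 : ℝ) with hu
  have hu0 : 0 < u := Real.rpow_pos_of_pos (by positivity) _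
  have hu3 : u ^ 3 = Δ * L ^ 2 := by
    rw [hu, ← Real.rpow_natCast, ← Real.rpow_mul (by positivity)]
    norm_num
  -- This scale balances the errors: the interpolation error `K L Δ / (2 δ²)` becomes `K u / 2`
  -- since `u³ = Δ L²`, and the anti-concentration error over width `2δ` becomes `24 u / √b`.
  set δ : ℝ := u / Real.sqrt L with hδ
  have hδ0 : 0 < δ := by positivity
  have hδ2 : δ ^ 2 = u ^ 2 / L := by rw [hδ, div_pow, Real.sq_sqrt hL0.le]
  have hKe : K * L / δ ^ 2 * Δ / 2 = K / 2 * u := by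
    rw [hδ2]
    field_simp
    linear_combination -hu3
  have hsandwich : ∀ (ρ : Measure (ι → ℝ)) [IsProbabilityMeasure ρ] (d : ι → ℝ)
      (m : (ι → ℝ) → ℝ), HasHessianBound m (K * L / δ ^ 2) →
      (∀ w, (∀ j, w j ≤ d j) → m w = 1) → (∀ w j, d j + 2 * δ < w j → m w = 0) →
      ρ.real {w | ∀ j, w j ≤ d j} ≤ ∫ w, m w ∂ρ ∧
        ∫ w, m w ∂ρ ≤ ρ.real {w | ∀ j, w j ≤ d j + 2 * δ} := by
    intro ρ _ d m hm m1 m0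
    rw [← integral_indicator_one (measurableSet_orthant d),
      ← integral_indicator_one (measurableSet_orthant fun j => d j + 2 * δ)]
    constructor
    · refine integral_mono ((integrable_const _).indicator (measurableSet_orthant d))
        (hm.integrable ρ) fun w => ?_
      simp only [Set.indicator, Pi.one_apply]
      split_ifs with h
      · exact (m1 w h).ge
      · exact hm.nonneg w
    · refine integral_mono (hm.integrable ρ) ((integrable_const _).indicator
        (measurableSet_orthant _)) fun w => ?_
      simp only [Set.indicator, Pi.one_apply]
      split_ifs with h
      · exact hm.le_one w
      · simp only [Set.mem_ofPred_eq, not_forall, not_le] at h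
        obtain ⟨j, hj⟩ := h
        exact (m0 w j hj).le
  have hac : ∀ d : ι → ℝ, ν.real {w | ∀ j, w j ≤ d j + 2 * δ}
      ≤ ν.real {w | ∀ j, w j ≤ d j} + 24 / Real.sqrt b * u := fun d => by
    refine (hν.anti_concentration hb hvar hL hcard d (by positivity)).trans (le_of_eq ?_)
    rw [hδ]
    field_simp
    ring
  obtain ⟨m, hm, m1, m0⟩ := hsm ι L δ c hL hcard hδ0
  -- The function for the orthant shrunk by `2δ` lies below the indicator of the orthant at `c`,
  -- which gives the opposite inequality.
  obtain ⟨m', hm', m1', m0'⟩ := hsm ι L δ (fun j => c j - 2 * δ) hL hcard hδ0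
  have k1 := hm.abs_integral_sub_le hμ hν hcov
  have k2 := hm'.abs_integral_sub_le hμ hν hcov
  rw [hKe] at k1 k2
  have s1 := hsandwich μ c m hm m1 m0
  have s2 := hsandwich ν c m hm m1 m0
  have s3 := hsandwich μ _ m' hm' m1' m0'
  have s4 := hsandwich ν _ m' hm' m1' m0'
  have a1 := hac c
  have a2 := hac fun j => c j - 2 * δ
  simp only [sub_add_cancel] at s3 s4 a2
  rw [abs_le] at *
  constructor <;> linarith [k1.1, k1.2, k2.1, k2.2, s1.1, s1.2, s2.1, s2.2, s3.1, s3.2, s4.1, s4.2]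

/-- Gaussian comparison on hyperrectangles. -/
lemma exists_hyperrectangle_comparison {b : ℝ} (hb : 0 < b) : ∃ C : ℝ, 0 < C ∧
    ∀ (p : ℕ) (L Δ : ℝ) (μ ν : Measure (Fin p → ℝ)),
      1 ≤ L → Real.log (2 * p) ≤ L → 0 < Δ →
      IsCenteredGaussian μ → IsCenteredGaussian ν → (∀ j, b ≤ ∫ w, w j * w j ∂ν) →
      (∀ j k, |∫ w, w j * w k ∂μ - ∫ w, w j * w k ∂ν| ≤ Δ) → ∀ A ∈ hyperrectangles p,
      |μ.real A - ν.real A| ≤ C * (Δ * L ^ 2) ^ (1 / 3 : ℝ) := by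
  classical
  obtain ⟨C, hC, hcomp⟩ := exists_orthant_comparison hb
  refine ⟨C, hC, fun p L Δ μ ν hL hp hΔ hμ hν hvar hcov A hA => ?_⟩
  have := hμ.isGaussian
  have := hν.isGaussian
  have hrhs : 0 ≤ C * (Δ * L ^ 2) ^ (1 / 3 : ℝ) := by positivity
  obtain ⟨l, u, -, rfl⟩ := hA
  -- With a lower end `⊤` or an upper end `⊥` the box contains no real point, and both probabilities
  -- vanish.
  by_cases hemp : (∃ j, l j = ⊤) ∨ ∃ j, u j = ⊥
  · have : {w : Fin p → ℝ | ∀ j, l j ≤ (w j : EReal) ∧ (w j : EReal) ≤ u j} = ∅ := by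
      ext w
      simp only [Set.mem_ofPred_eq, Set.mem_empty_iff_false, iff_false, not_forall]
      rcases hemp with ⟨j, hj⟩ | ⟨j, hj⟩
      · exact ⟨j, fun h => by simp [hj] at h⟩
      · exact ⟨j, fun h => by simp [hj] at h⟩
    rw [this]
    simpa using hrhs
  push Not at hemp
  obtain ⟨hlt, hub⟩ := hemp
  -- One index for each finite end of a side; infinite ends impose no constraint. At most `2p`
  -- half-spaces remain.
  let ι : Type := {s : Fin p × Bool // if s.2 then u s.1 ≠ ⊤ else l s.1 ≠ ⊥}
  let sgn : ι → ℝ := fun s => if s.1.2 then 1 else -1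
  have hsgn : ∀ s, |sgn s| = 1 := fun s => by
    simp only [sgn]; split_ifs <;> simp
  have hsgn2 : ∀ s, sgn s * sgn s = 1 := fun s => by
    simp only [sgn]; split_ifs <;> norm_num
  let c : ι → ℝ := fun s => if s.1.2 then (u s.1.1).toReal else -(l s.1.1).toReal
  -- The image law is degenerate as soon as one side has two finite ends. The orthant comparison
  -- allows this, since it needs only lower bounds on the variances.
  let T : (Fin p → ℝ) →L[ℝ] (ι → ℝ) :=
    ContinuousLinearMap.pi fun s => sgn s • ContinuousLinearMap.proj s.1.1
  have hT : ∀ w s, T w s = sgn s * w s.1.1 := fun w s => rfl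
  have hset : {w : Fin p → ℝ | ∀ j, l j ≤ (w j : EReal) ∧ (w j : EReal) ≤ u j}
      = T ⁻¹' {v | ∀ s, v s ≤ c s} := by
    ext w
    simp only [Set.mem_ofPred_eq, Set.mem_preimage]
    constructor
    · rintro h ⟨⟨j, s⟩, hs⟩
      rw [hT]
      cases s
      · have hj : l j ≠ ⊥ := by simpa using hs
        have h1 := (h j).1
        rw [← EReal.coe_toReal (hlt j) hj, EReal.coe_le_coe_iff] at h1
        simpa [sgn, c] using h1
      · have hj : u j ≠ ⊤ := by simpa using hs
        have h1 := (h j).2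
        rw [← EReal.coe_toReal hj (hub j), EReal.coe_le_coe_iff] at h1
        simpa [sgn, c] using h1
    · intro h j
      constructor
      · by_cases hj : l j = ⊥
        · simp [hj]
        · have h1 := h ⟨(j, false), by simpa using hj⟩
          rw [hT] at h1
          rw [← EReal.coe_toReal (hlt j) hj, EReal.coe_le_coe_iff]
          simpa [sgn, c] using h1
      · by_cases hj : u j = ⊤
        · simp [hj]
        · have h1 := h ⟨(j, true), by simpa using hj⟩
          rw [hT] at h1
          rw [← EReal.coe_toReal hj (hub j), EReal.coe_le_coe_iff]
          simpa [sgn, c] using h1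
  rw [hset]
  rcases isEmpty_or_nonempty ι with he | hne
  · have : T ⁻¹' {v | ∀ s, v s ≤ c s} = Set.univ := by
      ext w; simp
    rw [this]
    simpa using hrhs
  have hint : ∀ (ρ : Measure (Fin p → ℝ)) (s t : ι),
      ∫ v, v s * v t ∂(ρ.map T) = (sgn s * sgn t) * ∫ w, w s.1.1 * w t.1.1 ∂ρ := fun ρ s t => by
    rw [integral_map (by fun_prop) (by fun_prop), ← integral_const_mul]
    congr 1
    ext w
    rw [hT, hT]
    ring
  have hcard : Real.log (Fintype.card ι) ≤ L := by
    refine le_trans (Real.log_le_log (by exact_mod_cast Fintype.card_pos) ?_) hp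
    have : Fintype.card ι ≤ Fintype.card (Fin p × Bool) := Fintype.card_subtype_le _
    rw [Fintype.card_prod, Fintype.card_fin, Fintype.card_bool] at this
    rw [mul_comm]
    exact_mod_cast this
  have key := hcomp ι L Δ (μ.map T) (ν.map T) hL hcard hΔ (hμ.map T) (hν.map T)
    (fun s => by rw [hint, hsgn2, one_mul]; exact hvar _)
    (fun s t => by
      rw [hint, hint, ← mul_sub, abs_mul, abs_mul, hsgn, hsgn, one_mul, one_mul]
      exact hcov _ _) c
  rwa [map_measureReal_apply (by fun_prop) (measurableSet_orthant c),
    map_measureReal_apply (by fun_prop) (measurableSet_orthant c)] at key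

end Comparison

/-! ### Truncated Bernstein bounds for empirical second moments. -/

section Concentration

/-- The factor `exp |x|` is kept on the quadratic term so that large values can be treated
separately, through `excess`. -/
lemma exp_le_one_add_add_sq_mul_exp_abs (x : ℝ) :
    Real.exp x ≤ 1 + x + x ^ 2 * Real.exp |x| := by
  have he : 1 ≤ Real.exp |x| := Real.one_le_exp (abs_nonneg x)
  have hsq : x ^ 2 ≤ x ^ 2 * Real.exp |x| := le_mul_of_one_le_right (sq_nonneg x) he
  by_cases hx : |x| ≤ 1
  · have := (abs_le.1 (Real.abs_exp_sub_one_sub_id_le hx)).2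
    linarith
  · push Not at hx
    rcases lt_abs.1 hx with h | h
    · have h1 : |x| = x := abs_of_pos (by linarith)
      rw [h1]
      have h2 : 1 ≤ x ^ 2 := by nlinarith
      have h3 := le_mul_of_one_le_left (Real.exp_pos x).le h2
      linarith
    · have h1 : Real.exp x ≤ 1 := Real.exp_le_one_iff.2 (by linarith)
      nlinarith

variable {Ω : Type*} [MeasurableSpace Ω] {P : Measure Ω} [IsProbabilityMeasure P]

lemma integrable_of_abs_le {Z : Ω → ℝ} (hZ : Measurable Z) {R : ℝ} (hR : ∀ ω, |Z ω| ≤ R) :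
    Integrable Z P :=
  Integrable.of_bound hZ.aestronglyMeasurable R (Filter.Eventually.of_forall hR)

lemma integrable_sq_mul_exp_abs {Z : Ω → ℝ} (hZ : Measurable Z) {R : ℝ} (hR : ∀ ω, |Z ω| ≤ R)
    {c : ℝ} (hc : 0 ≤ c) : Integrable (fun ω => c ^ 2 * Z ω ^ 2 * Real.exp (c * |Z ω|)) P := by
  refine integrable_of_abs_le (by fun_prop) (R := c ^ 2 * R ^ 2 * Real.exp (c * R)) fun ω => ?_
  have h0 : 0 ≤ |Z ω| := abs_nonneg _
  rw [abs_of_nonneg (by positivity), ← sq_abs (Z ω)]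
  gcongr <;> exact hR ω

lemma mgf_le_exp_of_abs_le {Z : Ω → ℝ} (hZ : Measurable Z) {R : ℝ} (hR : ∀ ω, |Z ω| ≤ R)
    {c : ℝ} (hc : 0 ≤ c) : mgf Z P c
      ≤ Real.exp (c * ∫ ω, Z ω ∂P + ∫ ω, c ^ 2 * Z ω ^ 2 * Real.exp (c * |Z ω|) ∂P) := by
  have i1 : Integrable (fun ω => 1 + c * Z ω) P :=
    (integrable_const _).add ((integrable_of_abs_le hZ hR).const_mul c)
  have i2 := integrable_sq_mul_exp_abs (P := P) hZ hR hc
  have i3 : Integrable (fun ω => Real.exp (c * Z ω)) P := by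
    refine integrable_of_abs_le (by fun_prop) (R := Real.exp (c * R)) fun ω => ?_
    rw [Real.abs_exp]
    have := (le_abs_self _).trans (hR ω)
    gcongr
  calc mgf Z P c ≤ ∫ ω, (1 + c * Z ω + c ^ 2 * Z ω ^ 2 * Real.exp (c * |Z ω|)) ∂P := by
        refine integral_mono i3 (i1.add i2) fun ω => ?_
        have := exp_le_one_add_add_sq_mul_exp_abs (c * Z ω)
        rwa [abs_mul, abs_of_nonneg hc, mul_pow] at this
    _ = (c * ∫ ω, Z ω ∂P + ∫ ω, c ^ 2 * Z ω ^ 2 * Real.exp (c * |Z ω|) ∂P) + 1 := by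
        rw [integral_add i1 i2, integral_add (integrable_const _)
          ((integrable_of_abs_le hZ hR).const_mul c), integral_const_mul]
        simp
        ring
    _ ≤ _ := Real.add_one_le_exp _

variable {n : ℕ}

/-- A Bernstein type inequality for sums of independent bounded random variables. -/
lemma measure_sum_ge_le_exp {Z : Fin n → Ω → ℝ} (hZ : ∀ i, Measurable (Z i))
    (hind : iIndepFun Z P) {R : ℝ} (hR : ∀ i ω, |Z i ω| ≤ R) {c W : ℝ} (hc : 0 ≤ c)
    (hW : ∑ i, ∫ ω, c ^ 2 * Z i ω ^ 2 * Real.exp (c * |Z i ω|) ∂P ≤ W) (t : ℝ) :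
    P.real {ω | ∑ i, ∫ ω, Z i ω ∂P + t ≤ ∑ i, Z i ω} ≤ Real.exp (W - c * t) := by
  have hint : Integrable (fun ω => Real.exp (c * (∑ i, Z i) ω)) P := by
    refine integrable_of_abs_le (by fun_prop) (R := Real.exp (c * (n * R))) fun ω => ?_
    rw [Real.abs_exp]
    gcongr
    rw [Finset.sum_apply]
    calc ∑ i, Z i ω ≤ ∑ _i : Fin n, R :=
          Finset.sum_le_sum fun i _ => (le_abs_self _).trans (hR i ω)
      _ = n * R := by simp
  have h := measure_ge_le_exp_mul_mgf (μ := P) (X := ∑ i, Z i) (∑ i, ∫ ω, Z i ω ∂P + t) hc hint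
  simp only [Finset.sum_apply] at h
  refine h.trans ?_
  rw [hind.mgf_sum hZ]
  calc _ ≤ Real.exp (-c * (∑ i, ∫ ω, Z i ω ∂P + t)) * ∏ i, Real.exp (c * ∫ ω, Z i ω ∂P
            + ∫ ω, c ^ 2 * Z i ω ^ 2 * Real.exp (c * |Z i ω|) ∂P) := by
        gcongr with i _
        · intro i _; exact mgf_nonneg
        · exact mgf_le_exp_of_abs_le (hZ i) (hR i) hc
    _ = Real.exp (∑ i, ∫ ω, c ^ 2 * Z i ω ^ 2 * Real.exp (c * |Z i ω|) ∂P - c * t) := by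
        rw [← Real.exp_sum, ← Real.exp_add, Finset.sum_add_distrib, ← Finset.mul_sum]
        ring_nf
    _ ≤ _ := by gcongr

lemma measure_abs_sum_sub_ge_le_exp {Z : Fin n → Ω → ℝ} (hZ : ∀ i, Measurable (Z i))
    (hind : iIndepFun Z P) {R : ℝ} (hR : ∀ i ω, |Z i ω| ≤ R) {c W : ℝ} (hc : 0 ≤ c)
    (hW : ∑ i, ∫ ω, c ^ 2 * Z i ω ^ 2 * Real.exp (c * |Z i ω|) ∂P ≤ W) (t : ℝ) :
    P.real {ω | t ≤ |∑ i, Z i ω - ∑ i, ∫ ω, Z i ω ∂P|} ≤ 2 * Real.exp (W - c * t) := by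
  have h1 := measure_sum_ge_le_exp hZ hind hR hc hW t
  have h2 := measure_sum_ge_le_exp (Z := fun i ω => -Z i ω) (fun i => (hZ i).neg)
    (hind.comp (fun _ x => -x) fun _ => measurable_neg) (fun i ω => by simpa using hR i ω) hc
    (by simpa using hW) t
  have hsub : {ω | t ≤ |∑ i, Z i ω - ∑ i, ∫ ω, Z i ω ∂P|} ⊆
      {ω | ∑ i, ∫ ω, Z i ω ∂P + t ≤ ∑ i, Z i ω} ∪
      {ω | ∑ i, ∫ ω, -Z i ω ∂P + t ≤ ∑ i, -Z i ω} := by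
    intro ω hω
    rcases le_abs.1 (show t ≤ |∑ i, Z i ω - ∑ i, ∫ ω, Z i ω ∂P| from hω) with h | h
    · left
      simp only [Set.mem_ofPred_eq]
      linarith
    · right
      simp only [Set.mem_ofPred_eq, integral_neg, Finset.sum_neg_distrib]
      linarith
  refine (measureReal_mono hsub).trans ((measureReal_union_le _ _).trans ?_)
  linarith

/-- Truncation at level `T`. -/
def cutoff (T y : ℝ) : ℝ := if |y| ≤ T then y else 0

/-- The contribution of the moderately large values to the moment generating function of a
product of truncated variables. -/
def excess (c T y : ℝ) : ℝ :=
  if 1 < c * y ^ 2 ∧ |y| ≤ T then c ^ 2 * y ^ 4 * Real.exp (c * y ^ 2) else 0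

/-- The square of `y` beyond the truncation level. -/
def tailSq (T y : ℝ) : ℝ := if T < |y| then y ^ 2 else 0

@[fun_prop]
lemma measurable_cutoff (T : ℝ) : Measurable (cutoff T) :=
  Measurable.ite (measurableSet_le (by fun_prop) (by fun_prop)) measurable_id measurable_const

@[fun_prop]
lemma measurable_excess (c T : ℝ) : Measurable (excess c T) :=
  Measurable.ite (p := fun y => 1 < c * y ^ 2 ∧ |y| ≤ T)
    ((measurableSet_lt (f := fun _ : ℝ => (1 : ℝ)) (g := fun y => c * y ^ 2) (by fun_prop)
      (by fun_prop)).inter (measurableSet_le (f := fun y : ℝ => |y|) (g := fun _ => T)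
      (by fun_prop) (by fun_prop))) (by fun_prop) measurable_const

@[fun_prop]
lemma measurable_tailSq (T : ℝ) : Measurable (tailSq T) :=
  Measurable.ite (measurableSet_lt (by fun_prop) (by fun_prop)) (by fun_prop) measurable_const

lemma abs_cutoff_le {T : ℝ} (hT : 0 ≤ T) (y : ℝ) : |cutoff T y| ≤ T := by
  unfold cutoff; split_ifs with h
  · exact h
  · simpa using hT

lemma sq_cutoff_le (T y : ℝ) : cutoff T y ^ 2 ≤ y ^ 2 := by
  unfold cutoff; split_ifs
  · exact le_rfl
  · simpa using sq_nonneg y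

lemma excess_nonneg (c T y : ℝ) : 0 ≤ excess c T y := by
  unfold excess; split_ifs <;> positivity

lemma tailSq_nonneg (T y : ℝ) : 0 ≤ tailSq T y := by
  unfold tailSq; split_ifs <;> positivity

lemma tailSq_le (T y : ℝ) : tailSq T y ≤ y ^ 2 := by
  unfold tailSq; split_ifs
  · exact le_rfl
  · positivity

lemma abs_excess_le {c T : ℝ} (hc : 0 ≤ c) (y : ℝ) :
    |excess c T y| ≤ c ^ 2 * T ^ 4 * Real.exp (c * T ^ 2) := by
  rw [abs_of_nonneg (excess_nonneg c T y)]
  unfold excess; split_ifs with h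
  · have h2 : y ^ 2 ≤ T ^ 2 := by rw [← sq_abs]; gcongr; exact h.2
    have h4 : y ^ 4 ≤ T ^ 4 := by nlinarith [sq_nonneg y]
    gcongr
  · have : 0 ≤ T ^ 4 := by positivity
    positivity

lemma excess_of_one_lt {c T y : ℝ} (h : 1 < c * cutoff T y ^ 2) :
    c ^ 2 * cutoff T y ^ 4 * Real.exp (c * cutoff T y ^ 2) = excess c T y := by
  unfold cutoff excess at *
  by_cases hy : |y| ≤ T
  · simp only [hy, if_true] at h ⊢
    simp [h]
  · simp only [hy, if_false] at h
    norm_num at h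

/-- If `c` times the truncated product is at most 1 in absolute value, the exponential is at most
`e` and the arithmetic-geometric mean inequality gives fourth powers. Otherwise the larger factor
`v` alone satisfies `1 < c v²`, and its `excess` dominates. -/
lemma sq_mul_exp_cutoff_mul_le {c : ℝ} (hc : 0 ≤ c) (T x y : ℝ) :
    c ^ 2 * (cutoff T x * cutoff T y) ^ 2 * Real.exp (c * |cutoff T x * cutoff T y|)
      ≤ Real.exp 1 * c ^ 2 * ((x ^ 4 + y ^ 4) / 2) + (excess c T x + excess c T y) := by
  have hx := excess_nonneg c T x
  have hy := excess_nonneg c T y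
  have hx2 := sq_cutoff_le T x
  have hy2 := sq_cutoff_le T y
  set u := cutoff T x with hu
  set v := cutoff T y with hv
  by_cases h : c * |u * v| ≤ 1
  · have h1 : Real.exp (c * |u * v|) ≤ Real.exp 1 := Real.exp_le_exp.2 h
    have h2 : (u * v) ^ 2 ≤ (x ^ 4 + y ^ 4) / 2 := by
      have : (u * v) ^ 2 ≤ x ^ 2 * y ^ 2 := by rw [mul_pow]; gcongr
      nlinarith [sq_nonneg (x ^ 2 - y ^ 2)]
    calc _ ≤ c ^ 2 * ((x ^ 4 + y ^ 4) / 2) * Real.exp 1 := by gcongr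
      _ ≤ _ := by linarith
  · push Not at h
    have h0 : 0 ≤ Real.exp 1 * c ^ 2 * ((x ^ 4 + y ^ 4) / 2) := by positivity
    rw [← sq_abs (u * v)]
    rcases le_total |u| |v| with huv | huv
    · have h1 : |u * v| ≤ v ^ 2 := by
        rw [abs_mul, ← sq_abs v, sq]; gcongr
      have h2 : 1 < c * v ^ 2 := h.trans_le (by gcongr)
      have := excess_of_one_lt h2
      calc _ ≤ c ^ 2 * (v ^ 2) ^ 2 * Real.exp (c * v ^ 2) := by gcongr
        _ = excess c T y := by rw [← this]; ring
        _ ≤ _ := by linarith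
    · have h1 : |u * v| ≤ u ^ 2 := by
        rw [abs_mul, ← sq_abs u, sq]; gcongr
      have h2 : 1 < c * u ^ 2 := h.trans_le (by gcongr)
      have := excess_of_one_lt h2
      calc _ ≤ c ^ 2 * (u ^ 2) ^ 2 * Real.exp (c * u ^ 2) := by gcongr
        _ = excess c T x := by rw [← this]; ring
        _ ≤ _ := by linarith

/-- As soon as one factor is cut off, the larger one is beyond `T`, and its square dominates the
product. -/
lemma abs_mul_sub_cutoff_mul_le (T x y : ℝ) :
    |x * y - cutoff T x * cutoff T y| ≤ tailSq T x + tailSq T y := by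
  have hx := tailSq_nonneg T x
  have hy := tailSq_nonneg T y
  have key : |x * y| ≤ x ^ 2 ∨ |x * y| ≤ y ^ 2 := by
    rw [abs_mul, ← sq_abs x, ← sq_abs y]
    rcases le_total |x| |y| with h | h
    · right; rw [sq]; gcongr
    · left; rw [sq]; gcongr
  by_cases h1 : |x| ≤ T <;> by_cases h2 : |y| ≤ T
  · simp only [cutoff, h1, h2, if_true, sub_self, abs_zero]
    linarith
  · push Not at h2
    simp only [cutoff, tailSq, h1, h2, h2.not_ge, h1.not_gt, if_true, if_false, mul_zero, sub_zero]
    rw [abs_mul, ← sq_abs y, sq, zero_add]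
    have := h1.trans h2.le
    gcongr
  · push Not at h1
    simp only [cutoff, tailSq, h1, h2, h1.not_ge, h2.not_gt, if_true, if_false, zero_mul, sub_zero]
    rw [abs_mul, ← sq_abs x, sq, add_zero]
    have := h2.trans h1.le
    gcongr
  · push Not at h1 h2
    simp only [cutoff, tailSq, h1, h2, h1.not_ge, h2.not_ge, if_true, if_false, zero_mul, sub_zero]
    rcases key with h | h
    · linarith [sq_nonneg y]
    · linarith [sq_nonneg x]

/-- Uniform concentration of the empirical second moments of independent random vectors around
their expectations, by truncation. -/
lemma empirical_second_moment_concentration {κ : Type*} [Fintype κ] {x : Fin n → Ω → κ → ℝ}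
    (hx : ∀ i, Measurable (x i)) (hind : iIndepFun x P)
    (hint : ∀ i l, Integrable (fun ω => x i ω l ^ 4) P) {T c₀ V W β α Λ : ℝ} (hT : 0 ≤ T)
    (hc₀ : 0 < c₀) (hV : 0 < V) (hΛ : 0 < Λ) (hα : 0 < α)
    (hfour : ∀ l, ∑ i, ∫ ω, x i ω l ^ 4 ∂P ≤ V)
    (hexc : ∀ c, 0 < c → c ≤ c₀ → ∀ l, ∑ i, ∫ ω, excess c T (x i ω l) ∂P ≤ W)
    (hbias : ∀ l, ∑ i, ∫ ω, tailSq T (x i ω l) ∂P ≤ β)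
    (htrunc : ∑ i, P.real {ω | ∃ l, T < |x i ω l|} ≤ α / 2)
    (hLam : Real.log (4 * (Fintype.card κ : ℝ) ^ 2 / α) + 2 * W ≤ Λ) :
    1 - α ≤ P.real {ω | ∀ j k, |∑ i, x i ω j * x i ω k - ∑ i, ∫ ω, x i ω j * x i ω k ∂P|
      ≤ 2 * Real.sqrt (Real.exp 1 * V * Λ) + Λ / c₀ + 2 * β} := by
  set V' := Real.exp 1 * V with hV'
  have hV'0 : 0 < V' := by positivity
  -- `√(Λ / V')` is the choice for the Gaussian regime; the cap `c₀` is the range in which the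
  -- excess is under control. The two terms of `t` serve these two cases, so that `c² V' - c t ≤ -Λ`
  -- in both.
  set c := min c₀ (Real.sqrt (Λ / V')) with hc
  have hc0 : 0 < c := lt_min hc₀ (Real.sqrt_pos.2 (by positivity))
  set t := 2 * Real.sqrt (V' * Λ) + Λ / c₀ with ht
  have hct : c ^ 2 * V' + Λ ≤ c * t := by
    have h1 : c * V' ≤ Real.sqrt (V' * Λ) := by
      calc c * V' ≤ Real.sqrt (Λ / V') * V' := by gcongr; exact min_le_right _ _
        _ = Real.sqrt (V' * Λ) := by
          rw [mul_comm, ← Real.sqrt_sq hV'0.le, ← Real.sqrt_mul (by positivity),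
            Real.sqrt_sq hV'0.le]
          congr 1
          field_simp
    have h2 : Λ ≤ c * (Real.sqrt (V' * Λ) + Λ / c₀) := by
      rw [hc]
      rcases min_cases c₀ (Real.sqrt (Λ / V')) with ⟨h, -⟩ | ⟨h, -⟩ <;> rw [h, mul_add]
      · have h3 : c₀ * (Λ / c₀) = Λ := by field_simp
        have : 0 ≤ c₀ * Real.sqrt (V' * Λ) := by positivity
        linarith
      · have h3 : Real.sqrt (Λ / V') * Real.sqrt (V' * Λ) = Λ := by
          rw [← Real.sqrt_mul (by positivity), show Λ / V' * (V' * Λ) = Λ ^ 2 by field_simp,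
            Real.sqrt_sq hΛ.le]
        have : 0 ≤ Real.sqrt (Λ / V') * (Λ / c₀) := by positivity
        linarith
    rw [ht]
    nlinarith
  have hxl : ∀ i l, Measurable fun ω => x i ω l := fun i l => (measurable_pi_apply l).comp (hx i)
  set Z : κ → κ → Fin n → Ω → ℝ := fun j k i ω => cutoff T (x i ω j) * cutoff T (x i ω k) with hZ
  have hZm : ∀ j k i, Measurable (Z j k i) := fun j k i =>
    ((measurable_cutoff T).comp (hxl i j)).mul ((measurable_cutoff T).comp (hxl i k))
  have hZi : ∀ j k, iIndepFun (Z j k) P := fun j k =>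
    hind.comp (fun _ y => cutoff T (y j) * cutoff T (y k)) fun _ => by fun_prop
  have hZb : ∀ j k i ω, |Z j k i ω| ≤ T * T := fun j k i ω => by
    rw [hZ, abs_mul]
    exact mul_le_mul (abs_cutoff_le hT _) (abs_cutoff_le hT _) (abs_nonneg _) hT
  have hsq : ∀ i l, Integrable (fun ω => x i ω l ^ 2) P := fun i l => by
    refine ((integrable_const 1).add (hint i l)).mono' ((hxl i l).pow_const 2).aestronglyMeasurable
      (Filter.Eventually.of_forall fun ω => ?_)
    rw [Real.norm_eq_abs, abs_of_nonneg (by positivity)]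
    simp only [Pi.add_apply]
    nlinarith [sq_nonneg (x i ω l ^ 2 - 1)]
  have hmulint : ∀ i j k, Integrable (fun ω => x i ω j * x i ω k) P := fun i j k => by
    refine ((hsq i j).add (hsq i k)).mono' ((hxl i j).mul (hxl i k)).aestronglyMeasurable
      (Filter.Eventually.of_forall fun ω => ?_)
    rw [Real.norm_eq_abs, abs_le]
    simp only [Pi.add_apply]
    constructor <;> nlinarith [sq_nonneg (x i ω j + x i ω k), sq_nonneg (x i ω j - x i ω k)]
  have hexcint : ∀ i l, Integrable (fun ω => excess c T (x i ω l)) P := fun i l =>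
    integrable_of_abs_le (by fun_prop) fun ω => abs_excess_le hc0.le _
  have htailint : ∀ i l, Integrable (fun ω => tailSq T (x i ω l)) P := fun i l =>
    (hsq i l).mono' ((measurable_tailSq T).comp (hxl i l)).aestronglyMeasurable
      (Filter.Eventually.of_forall fun ω => by
      rw [Real.norm_eq_abs, abs_of_nonneg (tailSq_nonneg _ _)]; exact tailSq_le _ _)
  have hWjk : ∀ j k, ∑ i, ∫ ω, c ^ 2 * Z j k i ω ^ 2 * Real.exp (c * |Z j k i ω|) ∂P
      ≤ c ^ 2 * V' + 2 * W := by
    intro j k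
    have i4 : ∀ i, Integrable (fun ω => Real.exp 1 * c ^ 2 * ((x i ω j ^ 4 + x i ω k ^ 4) / 2)) P :=
      fun i => (((hint i j).add (hint i k)).div_const 2).const_mul _
    have ie : ∀ i, Integrable (fun ω => excess c T (x i ω j) + excess c T (x i ω k)) P :=
      fun i => (hexcint i j).add (hexcint i k)
    calc _ ≤ ∑ i, ∫ ω, (Real.exp 1 * c ^ 2 * ((x i ω j ^ 4 + x i ω k ^ 4) / 2)
            + (excess c T (x i ω j) + excess c T (x i ω k))) ∂P :=
          Finset.sum_le_sum fun i _ => integral_mono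
            (integrable_sq_mul_exp_abs (hZm j k i) (hZb j k i) hc0.le) ((i4 i).add (ie i))
            fun ω => sq_mul_exp_cutoff_mul_le hc0.le T _ _
      _ = Real.exp 1 * c ^ 2 * ((∑ i, ∫ ω, x i ω j ^ 4 ∂P + ∑ i, ∫ ω, x i ω k ^ 4 ∂P) / 2)
            + (∑ i, ∫ ω, excess c T (x i ω j) ∂P + ∑ i, ∫ ω, excess c T (x i ω k) ∂P) := by
          rw [← Finset.sum_add_distrib, ← Finset.sum_add_distrib, Finset.sum_div, Finset.mul_sum,
            ← Finset.sum_add_distrib]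
          refine Finset.sum_congr rfl fun i _ => ?_
          rw [integral_add (i4 i) (ie i), integral_add (hexcint i j) (hexcint i k),
            integral_const_mul, integral_div, integral_add (hint i j) (hint i k)]
      _ ≤ Real.exp 1 * c ^ 2 * ((V + V) / 2) + (W + W) := by
          gcongr
          · exact hfour j
          · exact hfour k
          · exact hexc c hc0 (min_le_left _ _) j
          · exact hexc c hc0 (min_le_left _ _) k
      _ = _ := by rw [hV']; ring
  have hbiasjk : ∀ j k, |∑ i, ∫ ω, Z j k i ω ∂P - ∑ i, ∫ ω, x i ω j * x i ω k ∂P| ≤ 2 * β := by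
    intro j k
    rw [← Finset.sum_sub_distrib]
    calc _ ≤ ∑ i, (∫ ω, tailSq T (x i ω j) ∂P + ∫ ω, tailSq T (x i ω k) ∂P) := by
          refine (Finset.abs_sum_le_sum_abs _ _).trans (Finset.sum_le_sum fun i _ => ?_)
          rw [← integral_sub (integrable_of_abs_le (hZm j k i) (hZb j k i)) (hmulint i j k),
            ← integral_add (htailint i j) (htailint i k), ← Real.norm_eq_abs]
          refine norm_integral_le_of_norm_le ((htailint i j).add (htailint i k))
            (Filter.Eventually.of_forall fun ω => ?_)
          rw [Real.norm_eq_abs, abs_sub_comm]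
          exact abs_mul_sub_cutoff_mul_le T _ _
      _ ≤ 2 * β := by
          rw [Finset.sum_add_distrib]
          linarith [hbias j, hbias k]
  -- Either some coordinate exceeds the truncation level, or one of the truncated sums deviates from
  -- its mean; each event has probability at most `α / 2`.
  set bad : Set Ω := (⋃ i, {ω | ∃ l, T < |x i ω l|}) ∪
    ⋃ q : κ × κ, {ω | t ≤ |∑ i, Z q.1 q.2 i ω - ∑ i, ∫ ω, Z q.1 q.2 i ω ∂P|} with hbad
  have hbadle : P.real bad ≤ α := by
    have e1 : P.real (⋃ i, {ω | ∃ l, T < |x i ω l|}) ≤ α / 2 :=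
      (measureReal_iUnion_fintype_le _).trans htrunc
    have e2 : P.real (⋃ q : κ × κ, {ω | t ≤ |∑ i, Z q.1 q.2 i ω - ∑ i, ∫ ω, Z q.1 q.2 i ω ∂P|})
        ≤ α / 2 := by
      refine (measureReal_iUnion_fintype_le _).trans ?_
      rcases isEmpty_or_nonempty κ with he | hne
      · simp; positivity
      have hcard : (0 : ℝ) < Fintype.card κ := by exact_mod_cast Fintype.card_pos
      -- The Chernoff exponent is at most `2 W - Λ`, and `Λ` was required to exceed the logarithm of
      -- the union bound by `2 W`.
      calc _ ≤ ∑ _q : κ × κ, 2 * Real.exp (-Real.log (4 * (Fintype.card κ : ℝ) ^ 2 / α)) := by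
            refine Finset.sum_le_sum fun q _ => (measure_abs_sum_sub_ge_le_exp (hZm q.1 q.2)
              (hZi q.1 q.2) (hZb q.1 q.2) hc0.le (hWjk q.1 q.2) t).trans ?_
            gcongr
            linarith
        _ = α / 2 := by
            rw [Finset.sum_const, Finset.card_univ, Fintype.card_prod, Real.exp_neg,
              Real.exp_log (by positivity), nsmul_eq_mul]
            push_cast
            field_simp
            norm_num
    exact (measureReal_union_le _ _).trans (by linarith)
  have hcov : Set.univ ⊆ bad ∪ {ω | ∀ j k, |∑ i, x i ω j * x i ω k
      - ∑ i, ∫ ω, x i ω j * x i ω k ∂P| ≤ t + 2 * β} := by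
    intro ω _
    by_cases hω : ω ∈ bad
    · exact Or.inl hω
    right
    simp only [hbad, Set.mem_union, Set.mem_iUnion, Set.mem_ofPred_eq, not_or, not_exists,
      not_lt, not_le] at hω
    intro j k
    have e : ∑ i, x i ω j * x i ω k = ∑ i, Z j k i ω := by
      refine Finset.sum_congr rfl fun i _ => ?_
      simp only [hZ, cutoff, hω.1 i j, hω.1 i k, if_true]
    rw [e]
    have e1 := hω.2 (j, k)
    have e2 := hbiasjk j k
    have e3 := abs_sub_le (∑ i, Z j k i ω) (∑ i, ∫ ω, Z j k i ω ∂P)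
      (∑ i, ∫ ω, x i ω j * x i ω k ∂P)
    linarith
  have h1 := (measureReal_mono (μ := P) hcov).trans (measureReal_union_le _ _)
  rw [probReal_univ] at h1
  linarith

end Concentration

/-! ### The conditional law of the bootstrap sum and the law of the Gaussian analogue. -/

section Laws

variable {n p : ℕ} {Ω Ω' : Type*} [MeasurableSpace Ω] [MeasurableSpace Ω']

lemma multiplierSum_apply (e : Fin n → ℝ) (x : Fin n → Fin p → ℝ) (j : Fin p) :
    multiplierSum e x j = ∑ i, ((Real.sqrt n)⁻¹ * (x i j - sampleMean x j)) * e i := by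
  simp only [multiplierSum, normalizedSum, Pi.smul_apply, Finset.sum_apply, smul_eq_mul,
    Finset.mul_sum, Pi.sub_apply]
  exact Finset.sum_congr rfl fun i _ => by ring

@[fun_prop]
lemma measurable_sampleMean : Measurable (sampleMean : (Fin n → Fin p → ℝ) → Fin p → ℝ) := by
  unfold sampleMean
  fun_prop

lemma measurable_multiplierSum :
    Measurable fun q : (Fin n → Fin p → ℝ) × (Fin n → ℝ) => multiplierSum q.2 q.1 := by
  refine measurable_pi_iff.2 fun j => ?_
  simp_rw [multiplierSum_apply]
  have : Measurable fun q : (Fin n → Fin p → ℝ) × (Fin n → ℝ) => sampleMean q.1 j :=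
    (measurable_pi_apply j).comp (measurable_sampleMean.comp measurable_fst)
  fun_prop

/-- The multiplier sum as a linear function of the multipliers. -/
def multiplierMap (x : Fin n → Fin p → ℝ) : (Fin n → ℝ) →L[ℝ] (Fin p → ℝ) :=
  ContinuousLinearMap.pi fun j =>
    ∑ i, ((Real.sqrt n)⁻¹ * (x i j - sampleMean x j)) • ContinuousLinearMap.proj i

lemma multiplierMap_apply (x : Fin n → Fin p → ℝ) (e : Fin n → ℝ) :
    multiplierMap x e = multiplierSum e x := by
  ext j
  rw [multiplierSum_apply]
  simp [multiplierMap]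

lemma integral_sum_mul_sum_of_orthogonal {Ω : Type*} [MeasurableSpace Ω] {P : Measure Ω}
    {u v : Fin n → Ω → ℝ} (hi : ∀ i l, Integrable (fun ω => u i ω * v l ω) P)
    (ho : ∀ i l, i ≠ l → ∫ ω, u i ω * v l ω ∂P = 0) :
    ∫ ω, (∑ i, u i ω) * (∑ i, v i ω) ∂P = ∑ i, ∫ ω, u i ω * v i ω ∂P := by
  simp_rw [Finset.sum_mul_sum]
  rw [integral_finsetSum _ fun i _ => integrable_finsetSum _ fun l _ => hi i l]
  refine Finset.sum_congr rfl fun i _ => ?_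
  rw [integral_finsetSum _ fun l _ => hi i l]
  exact Finset.sum_eq_single i (fun l _ hl => ho i l hl.symm) (by simp)

variable {P : Measure Ω} {X : Fin n → Ω → Fin p → ℝ} {e : Fin n → Ω → ℝ}

lemma IsGaussianMultiplier.isCenteredGaussian (he : IsGaussianMultiplier P X e) :
    IsCenteredGaussian (P.map fun ω i => e i ω) where
  isGaussian := by
    have h : ∀ i, HasGaussianLaw (e i) P := fun i => ⟨by rw [he.law i]; infer_instance⟩
    exact (he.indep.hasGaussianLaw h).isGaussian_map
  mean_zero i := by
    have hm : Measurable fun ω i => e i ω := measurable_pi_iff.2 he.measurable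
    rw [integral_map (f := fun w : Fin n → ℝ => w i) hm.aemeasurable
      (measurable_pi_apply i).aestronglyMeasurable]
    have := integral_map (μ := P) (f := fun y : ℝ => y) (he.measurable i).aemeasurable
      measurable_id.aestronglyMeasurable
    rw [← this, he.law i]
    exact integral_id_gaussianReal

lemma IsGaussianMultiplier.integral_mul (he : IsGaussianMultiplier P X e) (i l : Fin n) :
    ∫ w, w i * w l ∂(P.map fun ω i => e i ω) = if i = l then 1 else 0 := by
  have hg := he.isCenteredGaussian
  have hm : Measurable fun ω i => e i ω := measurable_pi_iff.2 he.measurable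
  split_ifs with h
  · subst h
    rw [← hg.variance_eval i, variance_map (measurable_pi_apply i).aemeasurable hm.aemeasurable]
    have h1 := variance_map (μ := P) (X := id) (Y := e i) measurable_id.aemeasurable
      (he.measurable i).aemeasurable
    rw [he.law i, variance_id_gaussianReal] at h1
    exact h1.symm
  · rw [integral_map hm.aemeasurable (by fun_prop)]
    have := (he.indep.indepFun h).integral_mul_eq_mul_integral
      (he.measurable i).aestronglyMeasurable (he.measurable l).aestronglyMeasurable
    have h0 := hg.mean_zero i
    rw [integral_map (f := fun w : Fin n → ℝ => w i) hm.aemeasurable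
      (measurable_pi_apply i).aestronglyMeasurable] at h0
    rw [h0, zero_mul] at this
    exact this

/-- Given the data, the multiplier bootstrap sum is centered Gaussian with the sample covariance
matrix. -/
lemma IsGaussianMultiplier.integral_mul_multiplierMap (he : IsGaussianMultiplier P X e)
    (x : Fin n → Fin p → ℝ) (j k : Fin p) :
    ∫ w, w j * w k ∂((P.map fun ω i => e i ω).map (multiplierMap x))
      = (n : ℝ)⁻¹ * ∑ i, (x i j - sampleMean x j) * (x i k - sampleMean x k) := by
  have hg := he.isCenteredGaussian
  have hmul : ∀ (a d : ℝ) (i l : Fin n), ∫ w, a * w i * (d * w l) ∂(P.map fun ω i => e i ω)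
      = a * d * if i = l then 1 else 0 := fun a d i l => by
    rw [← he.integral_mul, ← integral_const_mul]
    exact integral_congr_ae (Filter.Eventually.of_forall fun w => by ring)
  rw [integral_map (by fun_prop) (by fun_prop)]
  simp_rw [multiplierMap_apply, multiplierSum_apply]
  rw [integral_sum_mul_sum_of_orthogonal]
  · rw [Finset.mul_sum]
    refine Finset.sum_congr rfl fun i _ => ?_
    rw [hmul, if_pos rfl, mul_one, mul_mul_mul_comm, ← mul_inv,
      Real.mul_self_sqrt (Nat.cast_nonneg n)]
  · intro i l
    refine ((hg.integrable_mul i l).const_mul (((Real.sqrt n)⁻¹ * (x i j - sampleMean x j)) *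
      ((Real.sqrt n)⁻¹ * (x l k - sampleMean x k)))).congr
      (Filter.Eventually.of_forall fun w => ?_)
    ring
  · intro i l hil
    rw [hmul, if_neg hil, mul_zero]

/-- The regular conditional distribution of the multiplier sum given the data. -/
lemma IsGaussianMultiplier.condDistrib_ae_eq [IsProbabilityMeasure P] (hX : ∀ i, Measurable (X i))
    (he : IsGaussianMultiplier P X e) :
    ∀ᵐ ω ∂P, condDistrib (fun ω' => multiplierSum (fun i => e i ω') (fun i => X i ω'))
      (fun ω' i => X i ω') P (fun i => X i ω)
      = (P.map fun ω i => e i ω).map (multiplierMap fun i => X i ω) := by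
  have hXm : Measurable fun ω i => X i ω := measurable_pi_iff.2 hX
  have hem : Measurable fun ω i => e i ω := measurable_pi_iff.2 he.measurable
  set γ := P.map fun ω i => e i ω with hγ
  have hγp : IsProbabilityMeasure γ := Measure.isProbabilityMeasure_map hem.aemeasurable
  have hSm : Measurable fun ω => multiplierSum (fun i => e i ω) (fun i => X i ω) :=
    measurable_multiplierSum.comp (hXm.prodMk hem)
  -- The candidate conditional law freezes the data and averages over the multipliers.
  let κ : Kernel (Fin n → Fin p → ℝ) (Fin p → ℝ) :=
    (Kernel.id ×ₖ Kernel.const _ γ).map fun q => multiplierSum q.2 q.1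
  have hκ : ∀ x, κ x = γ.map (multiplierMap x) := fun x => by
    rw [Kernel.map_apply _ measurable_multiplierSum, Kernel.prod_apply, Kernel.id_apply,
      Kernel.const_apply, Measure.dirac_prod, Measure.map_map measurable_multiplierSum
        measurable_prodMk_left]
    congr 1
    ext q : 1
    exact (multiplierMap_apply x q).symm
  have hκm : IsMarkovKernel κ := Kernel.IsMarkovKernel.map _ measurable_multiplierSum
  have hind := (indepFun_iff_map_prod_eq_prod_map_map hXm.aemeasurable hem.aemeasurable).1
    he.indep_sample.symm
  -- Independence of data and multipliers gives the disintegration of the joint law along `κ`;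
  -- conditional distributions are almost surely unique.
  have hjoint : P.map (fun ω => ((fun i => X i ω),
      multiplierSum (fun i => e i ω) (fun i => X i ω))) = (P.map fun ω i => X i ω) ⊗ₘ κ := by
    ext s hs
    have hg : Measurable fun q : (Fin n → Fin p → ℝ) × (Fin n → ℝ) =>
        (q.1, multiplierSum q.2 q.1) := measurable_fst.prodMk measurable_multiplierSum
    have e1 : P.map (fun ω => ((fun i => X i ω),
        multiplierSum (fun i => e i ω) (fun i => X i ω)))
        = (P.map fun ω => ((fun i => X i ω), (fun i => e i ω))).map
          fun q => (q.1, multiplierSum q.2 q.1) := by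
      rw [Measure.map_map hg (hXm.prodMk hem)]
      rfl
    have : IsProbabilityMeasure (P.map fun ω i => X i ω) :=
      Measure.isProbabilityMeasure_map hXm.aemeasurable
    rw [e1, hind, Measure.map_apply hg hs, Measure.prod_apply (hg hs),
      Measure.compProd_apply hs]
    refine lintegral_congr fun x => ?_
    rw [hκ, Measure.map_apply (by fun_prop) (measurable_prodMk_left hs)]
    congr 1
    ext q
    simp only [Set.mem_preimage, multiplierMap_apply]
  have := condDistrib_ae_eq_of_measure_eq_compProd_of_measurable hXm hSm hjoint
  filter_upwards [ae_of_ae_map hXm.aemeasurable this] with ω hω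
  rw [hω, hκ]

lemma normalizedSum_apply (y : Fin n → Fin p → ℝ) (j : Fin p) :
    normalizedSum y j = (Real.sqrt n)⁻¹ * ∑ i, y i j := by
  simp [normalizedSum]

variable {Q : Measure Ω'} {Y : Fin n → Ω' → Fin p → ℝ}

lemma IsGaussianAnalogue.isCenteredGaussian_eval (hY : IsGaussianAnalogue P X Q Y) (i : Fin n) :
    IsCenteredGaussian (Q.map (Y i)) where
  isGaussian := hY.gaussian i
  mean_zero j := by
    rw [integral_map (f := fun w : Fin p → ℝ => w j) (hY.measurable i).aemeasurable
      (measurable_pi_apply j).aestronglyMeasurable]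
    exact hY.mean_zero i j

lemma IsGaussianAnalogue.measurable_normalizedSum (hY : IsGaussianAnalogue P X Q Y) :
    Measurable fun ω => normalizedSum fun i => Y i ω := by
  have := hY.measurable
  unfold normalizedSum
  fun_prop

lemma IsGaussianAnalogue.memLp_two (hY : IsGaussianAnalogue P X Q Y) (i : Fin n) (j : Fin p) :
    MemLp (fun ω => Y i ω j) 2 Q :=
  ((hY.isCenteredGaussian_eval i).memLp j 2 (by simp)).comp_of_map (hY.measurable i).aemeasurable

lemma IsGaussianAnalogue.isCenteredGaussian (hY : IsGaussianAnalogue P X Q Y) :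
    IsCenteredGaussian (Q.map fun ω => normalizedSum fun i => Y i ω) where
  isGaussian := by
    have h := iIndepFun.hasGaussianLaw_fun_sum (fun i => ⟨hY.gaussian i⟩) hY.indep
    exact (h.fun_smul (Real.sqrt n)⁻¹).isGaussian_map
  mean_zero j := by
    have := hY.indep.isProbabilityMeasure
    rw [integral_map (f := fun w : Fin p → ℝ => w j) hY.measurable_normalizedSum.aemeasurable
      (measurable_pi_apply j).aestronglyMeasurable]
    simp_rw [normalizedSum_apply]
    rw [integral_const_mul, integral_finsetSum _ fun i _ =>
      (hY.memLp_two i j).integrable (by norm_num)]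
    simp [hY.mean_zero]

lemma IsGaussianAnalogue.integral_mul (hY : IsGaussianAnalogue P X Q Y) (j k : Fin p) :
    ∫ w, w j * w k ∂(Q.map fun ω => normalizedSum fun i => Y i ω)
      = (n : ℝ)⁻¹ * ∑ i, ∫ ω, X i ω j * X i ω k ∂P := by
  rw [integral_map hY.measurable_normalizedSum.aemeasurable (by fun_prop)]
  simp_rw [normalizedSum_apply, mul_mul_mul_comm]
  rw [integral_const_mul, ← mul_inv, Real.mul_self_sqrt (Nat.cast_nonneg n),
    integral_sum_mul_sum_of_orthogonal]
  · simp_rw [hY.covariance]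
  · exact fun i l => (hY.memLp_two i j).integrable_mul (hY.memLp_two l k)
  · intro i l hil
    have hij : IndepFun (fun ω => Y i ω j) (fun ω => Y l ω k) Q :=
      (hY.indep.indepFun hil).comp (measurable_pi_apply j) (measurable_pi_apply k)
    have := hij.integral_mul_eq_mul_integral (hY.memLp_two i j).1 (hY.memLp_two l k).1
    rw [hY.mean_zero, zero_mul] at this
    exact this

lemma measurableSet_of_mem_hyperrectangles {A : Set (Fin p → ℝ)} (hA : A ∈ hyperrectangles p) :
    MeasurableSet A := by
  obtain ⟨a, b, -, rfl⟩ := hA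
  rw [Set.ofPred_forall]
  refine MeasurableSet.iInter fun j => ?_
  have : Measurable fun w : Fin p → ℝ => (w j : EReal) :=
    measurable_coe_real_ereal.comp (measurable_pi_apply j)
  exact (measurableSet_le measurable_const this).inter (measurableSet_le this measurable_const)

/-- The bootstrap error is controlled by the error of the sample covariance matrix. -/
lemma exists_rhoMB_le {b : ℝ} (hb : 0 < b) : ∃ C : ℝ, 0 < C ∧
    ∀ (n p : ℕ) {Ω : Type*} {Ω' : Type*} [MeasurableSpace Ω] [MeasurableSpace Ω']
      (P : Measure Ω) [IsProbabilityMeasure P] (Q : Measure Ω') [IsProbabilityMeasure Q]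
      (X : Fin n → Ω → Fin p → ℝ) (e : Fin n → Ω → ℝ) (Y : Fin n → Ω' → Fin p → ℝ) (L : ℝ),
      (∀ i, Measurable (X i)) → IsGaussianMultiplier P X e → IsGaussianAnalogue P X Q Y →
      CondM1 P X b → 1 ≤ L → Real.log (2 * p) ≤ L →
      ∀ᵐ ω ∂P, ∀ Δ : ℝ, 0 < Δ →
        (∀ j k, |(n : ℝ)⁻¹ * ∑ i, (X i ω j - sampleMean (fun i => X i ω) j) *
            (X i ω k - sampleMean (fun i => X i ω) k)
          - (n : ℝ)⁻¹ * ∑ i, ∫ ω, X i ω j * X i ω k ∂P| ≤ Δ) →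
        rhoMB P X e Q Y (hyperrectangles p) ω ≤ C * (Δ * L ^ 2) ^ (1 / 3 : ℝ) := by
  obtain ⟨C, hC, hcomp⟩ := exists_hyperrectangle_comparison hb
  refine ⟨C, hC, fun n p Ω Ω' _ _ P _ Q _ X e Y L hX he hY hM1 hL hp => ?_⟩
  -- The two laws agree as measures off one null set, which depends on neither `Δ` nor `A`; the
  -- uncountable supremum causes no difficulty.
  filter_upwards [he.condDistrib_ae_eq hX] with ω hω Δ hΔ hcov
  rw [rhoMB, hω]
  refine Real.iSup_le (fun A => ?_) (by positivity)
  have hA := measurableSet_of_mem_hyperrectangles A.2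
  have key := hcomp p L Δ _ _ hL hp hΔ
    (he.isCenteredGaussian.map (multiplierMap fun i => X i ω)) hY.isCenteredGaussian
    (fun j => by
      rw [hY.integral_mul]
      simpa only [sq] using hM1 j)
    (fun j k => by
      rw [hY.integral_mul, he.integral_mul_multiplierMap]
      exact hcov j k) A A.2
  rwa [map_measureReal_apply hY.measurable_normalizedSum hA] at key

end Laws

/-! ### From empirical moments to the bootstrap error. -/

section Reduction

variable {n p : ℕ} {Ω : Type*} [MeasurableSpace Ω]

/-- The vector `x` extended by a coordinate that is constantly one. -/
def augment (x : Fin p → ℝ) : Option (Fin p) → ℝ := fun l => l.elim 1 x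

@[simp] lemma augment_none (x : Fin p → ℝ) : augment x none = 1 := rfl

@[simp] lemma augment_some (x : Fin p → ℝ) (j : Fin p) : augment x (some j) = x j := rfl

@[fun_prop]
lemma measurable_augment : Measurable (augment : (Fin p → ℝ) → Option (Fin p) → ℝ) :=
  measurable_pi_iff.2 fun l => by
    cases l
    · exact measurable_const
    · exact measurable_pi_apply _

lemma sampleMean_apply (x : Fin n → Fin p → ℝ) (j : Fin p) :
    sampleMean x j = (n : ℝ)⁻¹ * ∑ i, x i j := by
  simp [sampleMean]

lemma sample_covariance_eq (hn : 0 < n) (x : Fin n → Fin p → ℝ) (j k : Fin p) :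
    (n : ℝ)⁻¹ * ∑ i, (x i j - sampleMean x j) * (x i k - sampleMean x k)
      = (n : ℝ)⁻¹ * ∑ i, x i j * x i k - sampleMean x j * sampleMean x k := by
  have hn0 : (n : ℝ) ≠ 0 := by exact_mod_cast hn.ne'
  have h : ∀ i, (x i j - sampleMean x j) * (x i k - sampleMean x k)
      = x i j * x i k - sampleMean x j * x i k - sampleMean x k * x i j
        + sampleMean x j * sampleMean x k := fun i => by ring
  simp_rw [h, Finset.sum_add_distrib, Finset.sum_sub_distrib, ← Finset.mul_sum]
  have e1 : ∑ i, x i j = n * sampleMean x j := by rw [sampleMean_apply]; field_simp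
  have e2 : ∑ i, x i k = n * sampleMean x k := by rw [sampleMean_apply]; field_simp
  rw [e1, e2, Finset.sum_const, Finset.card_univ, Fintype.card_fin, nsmul_eq_mul]
  field_simp
  ring

/-- Deviations of the first two empirical moments control the error of the sample covariance. -/
lemma abs_sample_covariance_sub_le (hn : 0 < n) {P : Measure Ω} {X : Fin n → Ω → Fin p → ℝ}
    (hmean : ∀ i j, ∫ ω, X i ω j ∂P = 0) {τ : ℝ} {ω : Ω}
    (h : ∀ j k, |∑ i, augment (X i ω) j * augment (X i ω) k
      - ∑ i, ∫ ω, augment (X i ω) j * augment (X i ω) k ∂P| ≤ n * τ) (j k : Fin p) :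
    |(n : ℝ)⁻¹ * ∑ i, (X i ω j - sampleMean (fun i => X i ω) j) *
        (X i ω k - sampleMean (fun i => X i ω) k)
      - (n : ℝ)⁻¹ * ∑ i, ∫ ω, X i ω j * X i ω k ∂P| ≤ τ + τ ^ 2 := by
  have hn0 : (0 : ℝ) < n := by exact_mod_cast hn
  have hsm : ∀ j, |sampleMean (fun i => X i ω) j| ≤ τ := fun j => by
    -- Pairing with the constant coordinate turns a second moment into a first one, so a single
    -- concentration statement also controls the sample mean.
    have := h none (some j)
    simp only [augment_none, augment_some, one_mul, hmean, Finset.sum_const_zero, sub_zero] at this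
    rw [sampleMean_apply, abs_mul, abs_of_pos (by positivity), inv_mul_le_iff₀ hn0]
    exact this
  have hτ : 0 ≤ τ := (abs_nonneg _).trans (hsm j)
  have hjk : |(n : ℝ)⁻¹ * (∑ i, X i ω j * X i ω k - ∑ i, ∫ ω, X i ω j * X i ω k ∂P)| ≤ τ := by
    rw [abs_mul, abs_of_pos (by positivity), inv_mul_le_iff₀ hn0]
    exact h (some j) (some k)
  rw [sample_covariance_eq hn, sub_right_comm, ← mul_sub]
  refine (abs_sub _ _).trans (add_le_add hjk ?_)
  rw [abs_mul, sq]
  exact mul_le_mul (hsm j) (hsm k) (abs_nonneg _) hτ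

variable {Ω' : Type*} [MeasurableSpace Ω']

lemma rhoMB_le_one (P : Measure Ω) [IsProbabilityMeasure P] (X : Fin n → Ω → Fin p → ℝ)
    (e : Fin n → Ω → ℝ) (Q : Measure Ω') [IsProbabilityMeasure Q] (Y : Fin n → Ω' → Fin p → ℝ)
    (𝒜 : Set (Set (Fin p → ℝ))) (ω : Ω) : rhoMB P X e Q Y 𝒜 ω ≤ 1 := by
  refine Real.iSup_le (fun A => ?_) zero_le_one
  rw [abs_le]
  constructor
  · linarith [measureReal_nonneg (μ := condDistrib (fun ω' => multiplierSum (fun i => e i ω')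
      (fun i => X i ω')) (fun ω' i => X i ω') P (fun i => X i ω)) (s := (A : Set (Fin p → ℝ))),
      measureReal_le_one (μ := Q)
        (s := {ω' | normalizedSum (fun i => Y i ω') ∈ (A : Set (Fin p → ℝ))})]
  · linarith [measureReal_le_one (μ := condDistrib (fun ω' => multiplierSum (fun i => e i ω')
      (fun i => X i ω')) (fun ω' i => X i ω') P (fun i => X i ω)) (s := (A : Set (Fin p → ℝ))),
      measureReal_nonneg (μ := Q)
        (s := {ω' | normalizedSum (fun i => Y i ω') ∈ (A : Set (Fin p → ℝ))})]

/-- Concentration of the first two empirical moments implies the bootstrap approximation. -/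
lemma exists_bootstrap_of_concentration {b K : ℝ} (hb : 0 < b) (hK : 0 < K) :
    ∃ C : ℝ, 0 < C ∧
    ∀ (n p : ℕ) {Ω : Type*} {Ω' : Type*} [MeasurableSpace Ω] [MeasurableSpace Ω']
      (P : Measure Ω) [IsProbabilityMeasure P] (Q : Measure Ω') [IsProbabilityMeasure Q]
      (X : Fin n → Ω → Fin p → ℝ) (e : Fin n → Ω → ℝ) (Y : Fin n → Ω' → Fin p → ℝ)
      (L D τ α : ℝ),
      0 < n → IsCenteredSample P X → IsGaussianMultiplier P X e → IsGaussianAnalogue P X Q Y →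
      CondM1 P X b → 1 ≤ L → Real.log (2 * p) ≤ L → 0 < α → 0 < D → 0 < τ →
      τ * L ^ 2 ≤ K * D ^ 3 →
      (D ≤ 1 → 1 - α ≤ P.real {ω | ∀ j k, |∑ i, augment (X i ω) j * augment (X i ω) k
        - ∑ i, ∫ ω, augment (X i ω) j * augment (X i ω) k ∂P| ≤ n * τ}) →
      1 - α ≤ P.real {ω | rhoMB P X e Q Y (hyperrectangles p) ω ≤ C * D} := by
  obtain ⟨C, hC, hrho⟩ := exists_rhoMB_le hb
  refine ⟨max 1 (C * (K + K ^ 2) ^ (1 / 3 : ℝ)), by positivity,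
    fun n p Ω Ω' _ _ P _ Q _ X e Y L D τ α hn hX he hY hM1 hL hp hα hD hτ hτD hconc => ?_⟩
  -- If `D > 1` the bound is trivial, because the error is at most 1 and the constant at least 1. If
  -- `D ≤ 1` then `τ ≤ K`, and the `τ²` from centring is absorbed into the linear term.
  by_cases hD1 : D ≤ 1
  · refine (hconc hD1).trans ?_
    refine ENNReal.toReal_mono (measure_ne_top _ _) (measure_mono_ae ?_)
    filter_upwards [hrho n p P Q X e Y L hX.measurable he hY hM1 hL hp] with ω hω hmem
    have h1 := hω (τ + τ ^ 2) (by positivity)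
      (abs_sample_covariance_sub_le hn hX.mean_zero hmem)
    refine h1.trans ?_
    have hτK : τ ≤ K := by
      have e1 : τ ≤ τ * L ^ 2 := le_mul_of_one_le_right hτ.le (one_le_pow₀ hL)
      have e2 : K * D ^ 3 ≤ K := mul_le_of_le_one_right hK.le (pow_le_one₀ hD.le hD1)
      linarith
    have h2 : (τ + τ ^ 2) * L ^ 2 ≤ (K + K ^ 2) * D ^ 3 := by
      calc (τ + τ ^ 2) * L ^ 2 = τ * L ^ 2 + τ * (τ * L ^ 2) := by ring
        _ ≤ K * D ^ 3 + K * (K * D ^ 3) := by gcongr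
        _ = _ := by ring
    have hcube : (D ^ 3) ^ (1 / 3 : ℝ) = D := by
      rw [← Real.rpow_natCast, ← Real.rpow_mul hD.le]
      norm_num
    calc C * ((τ + τ ^ 2) * L ^ 2) ^ (1 / 3 : ℝ)
        ≤ C * ((K + K ^ 2) * D ^ 3) ^ (1 / 3 : ℝ) := by gcongr
      _ = C * (K + K ^ 2) ^ (1 / 3 : ℝ) * D := by
          rw [Real.mul_rpow (by positivity) (by positivity), hcube]
          ring
      _ ≤ _ := by gcongr; exact le_max_right _ _
  · push Not at hD1
    have : {ω | rhoMB P X e Q Y (hyperrectangles p) ω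
        ≤ max 1 (C * (K + K ^ 2) ^ (1 / 3 : ℝ)) * D} = Set.univ := by
      refine Set.eq_univ_of_forall fun ω => (rhoMB_le_one P X e Q Y _ ω).trans ?_
      have := le_max_left 1 (C * (K + K ^ 2) ^ (1 / 3 : ℝ))
      nlinarith
    rw [this, probReal_univ]
    linarith

end Reduction

/-! ### Markov's inequality and fourth moments of the augmented vectors. -/

section Moments

variable {n p : ℕ} {Ω : Type*} [MeasurableSpace Ω] {P : Measure Ω} [IsProbabilityMeasure P]
  {X : Fin n → Ω → Fin p → ℝ} {B : ℝ}

lemma mul_measureReal_le_integral {f : Ω → ℝ} (hf : Integrable f P) (hf0 : ∀ ω, 0 ≤ f ω) {c : ℝ}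
    {s : Set Ω} (hs : ∀ ω ∈ s, c ≤ f ω) (hc : 0 ≤ c) : c * P.real s ≤ ∫ ω, f ω ∂P :=
  le_trans (mul_le_mul_of_nonneg_left (measureReal_mono fun ω hω => hs ω hω) hc)
    (mul_meas_ge_le_integral_of_nonneg (Filter.Eventually.of_forall hf0) hf c)

lemma CondM2.integrable_augment_pow_four (h : CondM2 P X B) (i : Fin n) (l : Option (Fin p)) :
    Integrable (fun ω => augment (X i ω) l ^ 4) P := by
  cases l with
  | none => simp
  | some j =>
    have := (h j 2 (Or.inr rfl)).1 i
    refine this.congr (Filter.Eventually.of_forall fun ω => ?_)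
    exact Even.pow_abs ⟨2, rfl⟩ _

lemma CondM2.sum_integral_augment_pow_four_le (hn : 0 < n) (hB : 1 ≤ B) (h : CondM2 P X B)
    (l : Option (Fin p)) : ∑ i, ∫ ω, augment (X i ω) l ^ 4 ∂P ≤ n * B ^ 2 := by
  have hn0 : (0 : ℝ) < n := by exact_mod_cast hn
  cases l with
  | none =>
    simp only [augment_none, one_pow, integral_const, probReal_univ, smul_eq_mul, mul_one,
      Finset.sum_const, Finset.card_univ, Fintype.card_fin, nsmul_eq_mul]
    exact le_mul_of_one_le_right hn0.le (one_le_pow₀ hB)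
  | some j =>
    have := (h j 2 (Or.inr rfl)).2
    rw [inv_mul_le_iff₀ hn0] at this
    refine le_trans (le_of_eq (Finset.sum_congr rfl fun i _ => integral_congr_ae
      (Filter.Eventually.of_forall fun ω => ?_))) this
    exact (Even.pow_abs ⟨2, rfl⟩ (X i ω j)).symm

end Moments

/-! ### Logarithmic factors and the order of the Gaussian fluctuations. -/

section Logarithms

variable {n p : ℕ} {α : ℝ}

lemma one_lt_log_inv (hα : 0 < α) (hα1 : α < Real.exp (-1)) : 1 < Real.log (1 / α) := by
  rw [one_div, Real.log_inv]
  have := (Real.log_lt_iff_lt_exp hα).2 hα1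
  linarith

lemma exp_neg_log_inv (hα : 0 < α) : Real.exp (-Real.log (1 / α)) = α := by
  rw [one_div, Real.log_inv, neg_neg, Real.exp_log hα]

lemma twelve_le_mul (hn : 4 ≤ n) (hp : 3 ≤ p) : (12 : ℝ) ≤ (p : ℝ) * n := by
  have h1 : (4 : ℝ) ≤ n := by exact_mod_cast hn
  have h2 : (3 : ℝ) ≤ p := by exact_mod_cast hp
  nlinarith

lemma two_le_log_mul (hn : 4 ≤ n) (hp : 3 ≤ p) : 2 ≤ Real.log ((p : ℝ) * n) := by
  have h := twelve_le_mul hn hp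
  rw [Real.le_log_iff_exp_le (by linarith)]
  have h1 : Real.exp 2 = Real.exp 1 * Real.exp 1 := by rw [← Real.exp_add]; norm_num
  rw [h1]
  nlinarith [Real.exp_one_lt_d9, Real.exp_pos 1]

lemma exp_neg_log_mul (hn : 4 ≤ n) (hp : 3 ≤ p) :
    Real.exp (-Real.log ((p : ℝ) * n)) = ((p : ℝ) * n)⁻¹ := by
  have h := twelve_le_mul hn hp
  rw [Real.exp_neg, Real.exp_log (by linarith)]

lemma log_two_mul_le (hn : 4 ≤ n) (hp : 3 ≤ p) :
    Real.log (2 * (p : ℝ)) ≤ Real.log ((p : ℝ) * n) := by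
  have h1 : (4 : ℝ) ≤ n := by exact_mod_cast hn
  have h2 : (3 : ℝ) ≤ p := by exact_mod_cast hp
  exact Real.log_le_log (by positivity) (by nlinarith)

lemma log_card_sq_div_le (hn : 4 ≤ n) (hp : 3 ≤ p) (hα : 0 < α) :
    Real.log (4 * (Fintype.card (Option (Fin p)) : ℝ) ^ 2 / α)
      ≤ 2 + 2 * Real.log ((p : ℝ) * n) + Real.log (1 / α) := by
  have h1 : (4 : ℝ) ≤ n := by exact_mod_cast hn
  have h2 : (3 : ℝ) ≤ p := by exact_mod_cast hp
  have hcard : (Fintype.card (Option (Fin p)) : ℝ) = p + 1 := by simp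
  have hp1 : (0 : ℝ) < p + 1 := by positivity
  rw [hcard, div_eq_mul_one_div, Real.log_mul (by positivity) (by positivity),
    Real.log_mul (by norm_num) (by positivity), Real.log_pow]
  have h4 : Real.log 4 ≤ 2 := by
    rw [show (4 : ℝ) = 2 ^ 2 by norm_num, Real.log_pow]
    have := Real.log_two_lt_d9
    push_cast
    linarith
  have hl : Real.log ((p : ℝ) + 1) ≤ Real.log ((p : ℝ) * n) :=
    Real.log_le_log hp1 (by nlinarith)
  push_cast
  linarith

lemma D1_pow_three {B : ℝ} (hL : 0 ≤ Real.log ((p : ℝ) * n)) :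
    D1 n p B α ^ 3
      = Real.sqrt (B ^ 2 * Real.log (p * n) ^ 5 * Real.log (1 / α) ^ 2 / n) := by
  rw [D1, ← Real.rpow_natCast, ← Real.rpow_mul (by positivity), Real.sqrt_eq_rpow]
  norm_num

/-- The order `B √n √(log (pn)) log (1/α)` of the fluctuations of the empirical second moments. -/
def fluctuation (n p : ℕ) (B α : ℝ) : ℝ :=
  B * Real.sqrt n * Real.sqrt (Real.log ((p : ℝ) * n)) * Real.log (1 / α)

/-- With `τ` of order `fluctuation / n`, the comparison rate `(τ L²)^{1/3}` is of order `D1`. -/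
lemma fluctuation_mul_sq (hn : 4 ≤ n) (hp : 3 ≤ p) {B : ℝ} (hB : 1 ≤ B) (hα : 0 < α)
    (hα1 : α < Real.exp (-1)) :
    fluctuation n p B α / n * Real.log ((p : ℝ) * n) ^ 2 = D1 n p B α ^ 3 := by
  have hL := two_le_log_mul hn hp
  have ha := one_lt_log_inv hα hα1
  have hn0 : (0 : ℝ) < n := by exact_mod_cast (by omega : 0 < n)
  rw [D1_pow_three (by linarith), fluctuation]
  set L := Real.log ((p : ℝ) * n)
  set a := Real.log (1 / α)
  symm
  rw [Real.sqrt_eq_iff_mul_self_eq (by positivity) (by positivity)]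
  have h1 : Real.sqrt n ^ 2 = n := Real.sq_sqrt hn0.le
  have h2 : Real.sqrt L ^ 2 = L := Real.sq_sqrt (by linarith)
  field_simp
  rw [h1, h2]
  ring

/-- The contributions of the variance term to the deviation bound. -/
lemma sqrt_variance_le (hn : 4 ≤ n) (hp : 3 ≤ p) {B : ℝ} (hB : 1 ≤ B) (hα : 0 < α)
    (hα1 : α < Real.exp (-1)) {K : ℝ} (hK : 1 ≤ K) :
    2 * Real.sqrt (Real.exp 1 * (n * B ^ 2) *
        (K * (Real.log ((p : ℝ) * n) + Real.log (1 / α))))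
      ≤ 6 * K * fluctuation n p B α := by
  have hL := two_le_log_mul hn hp
  have ha := one_lt_log_inv hα hα1
  have hn0 : (0 : ℝ) < n := by exact_mod_cast (by omega : 0 < n)
  rw [fluctuation]
  set L := Real.log ((p : ℝ) * n)
  set a := Real.log (1 / α)
  -- Both logarithms are at least 1, so their sum is bounded by the product form appearing in `D1`;
  -- with `e ≤ 3` the square root is at most `3 K` times the fluctuation.
  have hsum : L + a ≤ 2 * (L * a ^ 2) := by
    nlinarith [mul_pos (by linarith : 0 < L) (by linarith : 0 < a)]
  have he := Real.exp_one_lt_d9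
  have h1 : Real.exp 1 * (n * B ^ 2) * (K * (L + a))
      ≤ (3 * K * (B * Real.sqrt n * Real.sqrt L * a)) ^ 2 := by
    calc Real.exp 1 * (n * B ^ 2) * (K * (L + a))
        ≤ 3 * (n * B ^ 2) * (K ^ 2 * (2 * (L * a ^ 2))) := by
          gcongr
          · linarith
          · nlinarith
      _ ≤ 9 * K ^ 2 * (n * B ^ 2 * L * a ^ 2) := by
          have : 0 ≤ K ^ 2 * (n * B ^ 2 * L * a ^ 2) := by positivity
          nlinarith
      _ = _ := by
          simp only [mul_pow]
          rw [Real.sq_sqrt hn0.le, Real.sq_sqrt (by linarith : 0 ≤ L)]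
          ring
  have h2 := Real.sqrt_le_sqrt h1
  rw [Real.sqrt_sq (by positivity)] at h2
  linarith

end Logarithms

/-! ### Concentration under (E.1). -/

section Exponential

variable {n p : ℕ} {Ω : Type*} [MeasurableSpace Ω] {P : Measure Ω} [IsProbabilityMeasure P]
  {X : Fin n → Ω → Fin p → ℝ} {B α : ℝ}

lemma CondE1.integrable_augment (h : CondE1 P X B) (i : Fin n) (l : Option (Fin p)) :
    Integrable (fun ω => Real.exp (|augment (X i ω) l| / B)) P := by
  cases l with
  | none => simp
  | some j => exact (h i j).1

/-- The bound is 3 rather than 2 because the constant coordinate contributes `exp (1 / B) ≤ e`. -/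
lemma CondE1.integral_augment_le (hB : 1 ≤ B) (h : CondE1 P X B) (i : Fin n)
    (l : Option (Fin p)) : ∫ ω, Real.exp (|augment (X i ω) l| / B) ∂P ≤ 3 := by
  cases l with
  | none =>
    simp only [augment_none, abs_one, integral_const, probReal_univ, smul_eq_mul, one_mul]
    have h1 : Real.exp (1 / B) ≤ Real.exp 1 := by
      gcongr
      rw [div_le_one (by linarith)]
      exact hB
    linarith [Real.exp_one_lt_d9]
  | some j => exact (h i j).2.trans (by norm_num)

lemma sq_le_mul_exp_half {z : ℝ} (hz : 0 ≤ z) : z ^ 2 ≤ 8 * Real.exp (z / 2) := by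
  have := Real.pow_div_factorial_le_exp (z / 2) (by positivity) 2
  norm_num [Nat.factorial] at this
  linarith

lemma pow_four_le_mul_exp_quarter {z : ℝ} (hz : 0 ≤ z) :
    z ^ 4 / 256 ≤ 24 * Real.exp (z / 4) := by
  have := Real.pow_div_factorial_le_exp (z / 4) (by positivity) 4
  norm_num [Nat.factorial] at this
  linarith

/-- Put `z = |y| / B`. The condition `1 < c y²` forces `z ≥ 4 L`, while the truncation `z ≤ 4 (L +
a)` gives `c y² ≤ z / 4`. The excess is then `O(exp (z / 2))`, and `exp (z / 2) ≤ exp (-2 L) * exp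
z`. -/
lemma excess_le_exp {L a c y : ℝ} (hB : 1 ≤ B) (hL : 1 ≤ L) (ha : 1 ≤ a) (hc : 0 < c)
    (hc' : c ≤ 1 / (16 * B ^ 2 * (L ^ 2 + a))) :
    excess c (4 * B * (L + a)) y ≤ 24 * Real.exp (-(2 * L)) * Real.exp (|y| / B) := by
  have hB0 : 0 < B := by linarith
  unfold excess
  split_ifs with h
  · obtain ⟨h1, h2⟩ := h
    set z := |y| / B with hz
    have hz0 : 0 ≤ z := by positivity
    have hy : |y| = z * B := by rw [hz]; field_simp
    have hy2 : y ^ 2 = (z * B) ^ 2 := by rw [← sq_abs, hy]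
    have hcB : c * (16 * B ^ 2 * (L ^ 2 + a)) ≤ 1 := by
      rwa [le_div_iff₀ (by positivity)] at hc'
    have hz4 : 4 * L ≤ z := by
      by_contra hlt
      push Not at hlt
      have e1 : z ^ 2 ≤ 16 * (L ^ 2 + a) := by nlinarith
      have e2 : c * y ^ 2 ≤ 1 := by
        rw [hy2, mul_pow]
        calc c * (z ^ 2 * B ^ 2) ≤ c * (16 * (L ^ 2 + a) * B ^ 2) := by gcongr
          _ ≤ 1 := by linarith
      linarith
    have hexp : c * y ^ 2 ≤ z / 4 := by
      have hzL : z ≤ 4 * (L + a) := by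
        rw [hz, div_le_iff₀ hB0]
        linarith
      have e1 : z * (16 * B ^ 2 * c) * (L ^ 2 + a) ≤ z * 1 := by
        rw [mul_assoc]
        gcongr
        linarith
      have e2 : L + a ≤ L ^ 2 + a := by nlinarith
      calc c * y ^ 2 = z * (B ^ 2 * c) * z := by rw [hy2]; ring
        _ ≤ z * (B ^ 2 * c) * (4 * (L ^ 2 + a)) := by gcongr; linarith
        _ ≤ z / 4 := by linarith
    have hpow : c ^ 2 * y ^ 4 ≤ z ^ 4 / 256 := by
      have e0 : 16 * (c * B ^ 2) ≤ 1 := by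
        have : 0 ≤ c * B ^ 2 := by positivity
        nlinarith
      have e1 : c ^ 2 * y ^ 4 = (c * B ^ 2) ^ 2 * z ^ 4 := by
        rw [show y ^ 4 = (y ^ 2) ^ 2 by ring, hy2]; ring
      rw [e1]
      have e2 : (c * B ^ 2) ^ 2 ≤ (1 / 16) ^ 2 := by gcongr; linarith
      calc _ ≤ (1 / 16) ^ 2 * z ^ 4 := by gcongr
        _ = _ := by ring
    have h3 := pow_four_le_mul_exp_quarter hz0
    calc c ^ 2 * y ^ 4 * Real.exp (c * y ^ 2)
        ≤ 24 * Real.exp (z / 4) * Real.exp (z / 4) :=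
          mul_le_mul (hpow.trans h3) (Real.exp_le_exp.2 hexp) (by positivity) (by positivity)
      _ = 24 * Real.exp (z / 2) := by rw [mul_assoc, ← Real.exp_add]; ring_nf
      _ ≤ 24 * (Real.exp (-(2 * L)) * Real.exp z) := by
          rw [← Real.exp_add]
          gcongr
          linarith
      _ = _ := by ring
  · positivity

/-- Half of the exponent dominates the square; the other half supplies the decay in `T`. -/
lemma tailSq_le_exp {T y : ℝ} (hB : 0 < B) :
    tailSq T y ≤ 8 * B ^ 2 * Real.exp (-(T / (2 * B))) * Real.exp (|y| / B) := by
  unfold tailSq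
  split_ifs with h
  · set z := |y| / B with hz
    have hz0 : 0 ≤ z := by positivity
    have hy : |y| = z * B := by rw [hz]; field_simp
    have hy2 : y ^ 2 = z ^ 2 * B ^ 2 := by rw [← sq_abs, hy]; ring
    have hT : T / (2 * B) ≤ z / 2 := by
      rw [hz, div_div, mul_comm B 2]
      gcongr
    have h1 := sq_le_mul_exp_half hz0
    rw [hy2]
    calc z ^ 2 * B ^ 2 ≤ 8 * Real.exp (z / 2) * B ^ 2 := by gcongr
      _ ≤ 8 * (Real.exp (-(T / (2 * B))) * Real.exp z) * B ^ 2 := by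
          rw [← Real.exp_add]
          gcongr
          linarith
      _ = _ := by ring
  · positivity

/-- `D1 ≤ 1` means `B L^{5/2} a ≤ √n`. Under it the linear term of Bernstein's bound, of order `B²
L³ a²`, is absorbed by the Gaussian one. -/
lemma sq_mul_le_fluctuation (hn : 4 ≤ n) (hp : 3 ≤ p) (hB : 1 ≤ B) (hα : 0 < α)
    (hα1 : α < Real.exp (-1)) (hD : D1 n p B α ≤ 1) :
    B ^ 2 * Real.log ((p : ℝ) * n) ^ 3 * Real.log (1 / α) ^ 2 ≤ fluctuation n p B α := by
  have hL := two_le_log_mul hn hp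
  have ha := one_lt_log_inv hα hα1
  have hn0 : (0 : ℝ) < n := by exact_mod_cast (by omega : 0 < n)
  have hD3 := D1_pow_three (n := n) (p := p) (B := B) (α := α) (by linarith)
  have hD0 : 0 ≤ D1 n p B α := Real.rpow_nonneg (by positivity) _
  rw [fluctuation]
  set L := Real.log ((p : ℝ) * n) with hLdef
  set a := Real.log (1 / α) with hadef
  have hBn : B * L ^ 2 * Real.sqrt L * a ≤ Real.sqrt n := by
    have h1 : Real.sqrt (B ^ 2 * L ^ 5 * a ^ 2 / n) ≤ 1 := by
      rw [← hD3]; exact pow_le_one₀ hD0 hD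
    rw [Real.sqrt_le_one, div_le_one hn0] at h1
    refine Real.le_sqrt_of_sq_le (le_trans (le_of_eq ?_) h1)
    simp only [mul_pow]
    rw [Real.sq_sqrt (by linarith : 0 ≤ L)]
    ring
  have e : B ^ 2 * L ^ 3 * a ^ 2 = (B * Real.sqrt L * a) * (B * L ^ 2 * Real.sqrt L * a) := by
    have : Real.sqrt L * Real.sqrt L = L := Real.mul_self_sqrt (by linarith)
    linear_combination -(B ^ 2 * L ^ 2 * a ^ 2) * this
  rw [e]
  calc _ ≤ (B * Real.sqrt L * a) * Real.sqrt n := by gcongr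
    _ = _ := by ring

lemma fluctuation_nonneg (hB : 1 ≤ B) (hL : 0 ≤ Real.log (1 / α)) : 0 ≤ fluctuation n p B α := by
  rw [fluctuation]
  positivity

/-- The deviation bound under the exponential moment condition is of the order of the
fluctuations. -/
lemma exponential_deviation_le (hn : 4 ≤ n) (hp : 3 ≤ p) (hB : 1 ≤ B) (hα : 0 < α)
    (hα1 : α < Real.exp (-1)) (hD : D1 n p B α ≤ 1) :
    2 * Real.sqrt (Real.exp 1 * (n * B ^ 2) *
        (150 * (Real.log ((p : ℝ) * n) + Real.log (1 / α))))
      + 150 * (Real.log ((p : ℝ) * n) + Real.log (1 / α)) /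
        (1 / (16 * B ^ 2 * (Real.log ((p : ℝ) * n) ^ 2 + Real.log (1 / α))))
      + 2 * (24 * B ^ 2) ≤ 12000 * fluctuation n p B α := by
  have hL := two_le_log_mul hn hp
  have ha := one_lt_log_inv hα hα1
  have hsv := sqrt_variance_le hn hp hB hα hα1 (K := 150) (by norm_num)
  have hbig := sq_mul_le_fluctuation hn hp hB hα hα1 hD
  have hS0 := fluctuation_nonneg (n := n) (p := p) (α := α) hB (by linarith)
  set L := Real.log ((p : ℝ) * n)
  set a := Real.log (1 / α)
  set S := fluctuation n p B α
  -- The three terms contribute `6 * 150 = 900`, `9600` and `48`, in total less than 12000.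
  have t2 : 150 * (L + a) / (1 / (16 * B ^ 2 * (L ^ 2 + a))) ≤ 9600 * S := by
    rw [div_div_eq_mul_div, div_one]
    have e1 : L + a ≤ 2 * (L * a) := by nlinarith
    have e2 : L ^ 2 + a ≤ 2 * (L ^ 2 * a) := by nlinarith
    calc 150 * (L + a) * (16 * B ^ 2 * (L ^ 2 + a))
        ≤ 150 * (2 * (L * a)) * (16 * B ^ 2 * (2 * (L ^ 2 * a))) := by gcongr
      _ = 9600 * (B ^ 2 * L ^ 3 * a ^ 2) := by ring
      _ ≤ 9600 * S := by gcongr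
  have t3 : B ^ 2 ≤ S := by
    refine le_trans ?_ hbig
    have e1 : 1 ≤ L ^ 3 := one_le_pow₀ (by linarith)
    have e2 : 1 ≤ a ^ 2 := one_le_pow₀ (by linarith)
    calc B ^ 2 = B ^ 2 * 1 * 1 := by ring
      _ ≤ _ := by gcongr
  linarith

/-- Concentration of the empirical second moments under the exponential moment condition. -/
lemma concentration_of_condE1 (hn : 4 ≤ n) (hp : 3 ≤ p) (hX : IsCenteredSample P X) (hB : 1 ≤ B)
    (hα : 0 < α) (hα1 : α < Real.exp (-1)) (hM2 : CondM2 P X B) (hE1 : CondE1 P X B)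
    (hD : D1 n p B α ≤ 1) :
    1 - α ≤ P.real {ω | ∀ j k, |∑ i, augment (X i ω) j * augment (X i ω) k
        - ∑ i, ∫ ω, augment (X i ω) j * augment (X i ω) k ∂P|
          ≤ 12000 * fluctuation n p B α} := by
  have hL := two_le_log_mul hn hp
  have ha := one_lt_log_inv hα hα1
  have hcard := log_card_sq_div_le hn hp hα
  have hexpL := exp_neg_log_mul hn hp
  have hexpa := exp_neg_log_inv hα
  have h12 := twelve_le_mul hn hp
  have hdev := exponential_deviation_le hn hp hB hα hα1 hD
  have hn4 : (4 : ℝ) ≤ n := by exact_mod_cast hn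
  have hp3 : (3 : ℝ) ≤ p := by exact_mod_cast hp
  have hn0 : (0 : ℝ) < n := by linarith
  have hB0 : 0 < B := by linarith
  set L := Real.log ((p : ℝ) * n) with hLdef
  set a := Real.log (1 / α) with hadef
  have hexp2 : n * Real.exp (-(2 * L)) ≤ 1 := by
    rw [show -(2 * L) = -L + -L by ring, Real.exp_add, hexpL]
    have : (n : ℝ) * ((p : ℝ) * n)⁻¹ ≤ 1 := by
      rw [mul_inv_le_iff₀ (by positivity)]
      nlinarith
    have h2 : ((p : ℝ) * n)⁻¹ ≤ 1 := inv_le_one_of_one_le₀ (by linarith)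
    rw [← mul_assoc]
    exact mul_le_one₀ this (by positivity) h2
  -- Here `exp (-T / B) = (pn)⁻⁴ α⁴`, more than enough for a union bound over `n (p + 1)`
  -- coordinates at total level `α / 2`.
  set T := 4 * B * (L + a) with hT
  set c₀ := 1 / (16 * B ^ 2 * (L ^ 2 + a)) with hc₀
  have hxm : ∀ i, Measurable fun ω => augment (X i ω) := fun i =>
    measurable_augment.comp (hX.measurable i)
  have hconst : ∀ (φ : ℝ → ℝ) (d : ℝ) (l : Option (Fin p)), (∀ y, 0 ≤ φ y) → 0 ≤ d →
      (∀ y, φ y ≤ d * Real.exp (|y| / B)) →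
      ∑ i, ∫ ω, φ (augment (X i ω) l) ∂P ≤ n * (d * 3) := by
    intro φ d l hφ hd hle
    calc _ ≤ ∑ _i : Fin n, d * 3 := by
          refine Finset.sum_le_sum fun i _ => ?_
          calc _ ≤ ∫ ω, d * Real.exp (|augment (X i ω) l| / B) ∂P :=
                integral_mono_of_nonneg (Filter.Eventually.of_forall fun ω => hφ _)
                  ((hE1.integrable_augment i l).const_mul d)
                  (Filter.Eventually.of_forall fun ω => hle _)
            _ ≤ d * 3 := by
                rw [integral_const_mul]
                gcongr
                exact hE1.integral_augment_le hB i l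
      _ = _ := by simp
  -- `W = 24 * 3` and `β = 8 B² * 3` are the constants of `excess_le_exp` and `tailSq_le_exp` times
  -- the moment bound 3. `Λ` dominates `2 + 2 L + a + 2 W` because `L ≥ 2` and `a > 1`.
  have key := empirical_second_moment_concentration (P := P) (x := fun i ω => augment (X i ω))
    (T := T) (c₀ := c₀) (V := n * B ^ 2) (W := 72) (β := 24 * B ^ 2) (α := α)
    (Λ := 150 * (L + a)) hxm (hX.indep.comp (fun _ => augment) fun _ => measurable_augment)
    (fun i l => hM2.integrable_augment_pow_four i l) (by positivity) (by positivity)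
    (by positivity) (by positivity) hα
    (fun l => hM2.sum_integral_augment_pow_four_le (by omega) hB l)
    (fun c hc hc' l => by
      refine (hconst (excess c T) (24 * Real.exp (-(2 * L))) l (excess_nonneg c T) (by positivity)
        (fun y => excess_le_exp hB (by linarith) ha.le hc hc')).trans ?_
      linarith)
    (fun l => by
      refine (hconst (tailSq T) (8 * B ^ 2 * Real.exp (-(T / (2 * B)))) l (tailSq_nonneg T)
        (by positivity) (fun y => tailSq_le_exp hB0)).trans ?_
      have e1 : Real.exp (-(T / (2 * B))) ≤ Real.exp (-(2 * L)) := by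
        gcongr
        rw [hT, le_div_iff₀ (by positivity)]
        nlinarith
      have e2 : n * Real.exp (-(T / (2 * B))) ≤ 1 := le_trans (by gcongr) hexp2
      calc _ = 24 * B ^ 2 * (n * Real.exp (-(T / (2 * B)))) := by ring
        _ ≤ 24 * B ^ 2 * 1 := by gcongr
        _ = _ := by ring)
    (by
      have e1 : ∀ i l, P.real {ω | T < |augment (X i ω) l|} ≤ 3 * Real.exp (-(T / B)) := by
        intro i l
        have := mul_measureReal_le_integral (hE1.integrable_augment i l)
          (fun ω => (Real.exp_pos _).le) (c := Real.exp (T / B))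
          (s := {ω | T < |augment (X i ω) l|})
          (fun ω hω => by
            have : T < |augment (X i ω) l| := hω
            gcongr) (Real.exp_pos _).le
        have h3 := this.trans (hE1.integral_augment_le hB i l)
        rw [Real.exp_neg, ← div_eq_mul_inv, le_div_iff₀ (Real.exp_pos _)]
        linarith
      have e2 : Real.exp (-(T / B)) ≤ ((p : ℝ) * n)⁻¹ * ((p : ℝ) * n)⁻¹ * α := by
        have : -(T / B) = (-L + -L) + (-a) + (-(2 * L) + -(3 * a)) := by
          rw [hT]; field_simp; ring
        rw [this, Real.exp_add, Real.exp_add, Real.exp_add, hexpL, hexpa]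
        refine mul_le_of_le_one_right (by positivity) (Real.exp_le_one_iff.2 (by linarith))
      calc _ ≤ ∑ _i : Fin n, ∑ _l : Option (Fin p), 3 * Real.exp (-(T / B)) := by
            refine Finset.sum_le_sum fun i _ => ?_
            rw [Set.ofPred_exists]
            exact (measureReal_iUnion_fintype_le _).trans (Finset.sum_le_sum fun l _ => e1 i l)
        _ = 3 * (n * (p + 1)) * Real.exp (-(T / B)) := by
            simp only [Finset.sum_const, Finset.card_univ, Fintype.card_option, Fintype.card_fin,
              nsmul_eq_mul]
            push_cast
            ring
        _ ≤ 3 * (2 * (p * n)) * (((p : ℝ) * n)⁻¹ * ((p : ℝ) * n)⁻¹ * α) := by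
            have e3 : (n : ℝ) * (p + 1) ≤ 2 * (p * n) := by nlinarith
            exact mul_le_mul (by linarith) e2 (Real.exp_pos _).le (by positivity)
        _ = 6 * ((p : ℝ) * n)⁻¹ * α := by field_simp; ring
        _ ≤ 6 * (12 : ℝ)⁻¹ * α := by gcongr
        _ = α / 2 := by ring)
    (by linarith)
  refine key.trans (measureReal_mono fun ω hω j k => (hω j k).trans hdev)

end Exponential

/-! ### Concentration under (E.2). -/

section Polynomial

variable {n p : ℕ} {Ω : Type*} [MeasurableSpace Ω] {P : Measure Ω} [IsProbabilityMeasure P]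
  {X : Fin n → Ω → Fin p → ℝ} {B q α : ℝ}

/-- The summand 1 covers the constant coordinate; it raises the moment bound from 2 to 3. -/
lemma abs_augment_div_rpow_le (hB : 1 ≤ B) (hq : 0 < q) (x : Fin p → ℝ) (l : Option (Fin p)) :
    (|augment x l| / B) ^ q ≤ 1 + (⨆ j, |x j| / B) ^ q := by
  have hB0 : 0 < B := by linarith
  have hM : 0 ≤ ⨆ j, |x j| / B := Real.iSup_nonneg fun j => by positivity
  cases l with
  | none =>
    have h1 : (|augment x none| / B) ^ q ≤ 1 :=
      Real.rpow_le_one (by positivity) (by rw [augment_none, abs_one, div_le_one hB0]; exact hB)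
        hq.le
    linarith [Real.rpow_nonneg hM q]
  | some j =>
    have h1 : |x j| / B ≤ ⨆ j, |x j| / B :=
      le_ciSup (f := fun j => |x j| / B) (Set.finite_range _).bddAbove j
    have := Real.rpow_le_rpow (by positivity) h1 hq.le
    rw [augment_some]
    linarith

lemma CondE2.integrable (h : CondE2 P X B q) (i : Fin n) :
    Integrable (fun ω => 1 + (⨆ j, |X i ω j| / B) ^ q) P :=
  (integrable_const 1).add (h i).1

lemma CondE2.integral_le (h : CondE2 P X B q) (i : Fin n) :
    ∫ ω, (1 + (⨆ j, |X i ω j| / B) ^ q) ∂P ≤ 3 := by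
  rw [integral_add (integrable_const 1) (h i).1]
  simp only [integral_const, probReal_univ, smul_eq_mul, mul_one]
  linarith [(h i).2]

/-- Where the excess is nonzero, `(c₀ y²)^{q/2}` is at least 1 and may be inserted as a factor, as
in Markov's inequality; the remaining factors increase with `c y² ≤ c₀ T²`. -/
lemma excess_le_rpow {c c₀ T y : ℝ} (hq : 0 < q) (hT : 0 < T) (hc : 0 < c) (hc' : c ≤ c₀) :
    excess c T y
      ≤ (c₀ * T ^ 2) ^ (2 + q / 2) * Real.exp (c₀ * T ^ 2) * (|y| / T) ^ q := by
  have hc0 : 0 < c₀ := hc.trans_le hc'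
  unfold excess
  split_ifs with h
  · obtain ⟨h1, h2⟩ := h
    have hy2 : y ^ 2 ≤ T ^ 2 := by rw [← sq_abs y]; gcongr
    have hle : c * y ^ 2 ≤ c₀ * T ^ 2 := by gcongr
    have hone : 1 ≤ (c₀ * T ^ 2) ^ (q / 2) * (|y| / T) ^ q := by
      have e1 : (|y| / T) ^ q = ((|y| / T) ^ 2) ^ (q / 2) := by
        rw [← Real.rpow_natCast, ← Real.rpow_mul (by positivity)]
        congr 1
        push_cast
        ring
      rw [e1, ← Real.mul_rpow (by positivity) (by positivity)]
      refine Real.one_le_rpow ?_ (by positivity)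
      rw [div_pow, sq_abs]
      have e2 : c₀ * T ^ 2 * (y ^ 2 / T ^ 2) = c₀ * y ^ 2 := by field_simp
      rw [e2]
      exact h1.le.trans (by gcongr)
    rw [Real.rpow_add (by positivity), Real.rpow_two]
    calc c ^ 2 * y ^ 4 * Real.exp (c * y ^ 2)
        = (c * y ^ 2) ^ 2 * Real.exp (c * y ^ 2) * 1 := by ring
      _ ≤ (c₀ * T ^ 2) ^ 2 * Real.exp (c₀ * T ^ 2)
          * ((c₀ * T ^ 2) ^ (q / 2) * (|y| / T) ^ q) := by gcongr
      _ = _ := by ring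
  · positivity

lemma rpow_le_mul_exp_half {x r : ℝ} (hx : 0 ≤ x) (hr : 0 < r) :
    x ^ r ≤ (2 * r) ^ r * Real.exp (x / 2) := by
  have h1 : x / (2 * r) ≤ Real.exp (x / (2 * r)) := by
    linarith [Real.add_one_le_exp (x / (2 * r))]
  have h2 := Real.rpow_le_rpow (by positivity) h1 hr.le
  rw [← Real.exp_mul, Real.div_rpow hx (by positivity), div_le_iff₀ (by positivity),
    show x / (2 * r) * r = x / 2 by field_simp] at h2
  linarith

/-- Half an exponential absorbs the power, and `3 x / 2 ≤ 3/4 + 3 a / 8` is below `1 + a`. With `exp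
(-a) = α` this pays for the growth of `exp (c₀ T²)`. -/
lemma exp_neg_mul_rpow_mul_exp_le {x a r : ℝ} (hx : 0 ≤ x) (ha : 0 ≤ a) (hxa : x ≤ 1 / 2 + a / 4)
    (hr : 0 < r) : Real.exp (-a) * (x ^ r * Real.exp x) ≤ (2 * r) ^ r * Real.exp 1 := by
  calc Real.exp (-a) * (x ^ r * Real.exp x)
      ≤ Real.exp (-a) * ((2 * r) ^ r * Real.exp (x / 2) * Real.exp x) := by
        gcongr
        exact rpow_le_mul_exp_half hx hr
    _ = (2 * r) ^ r * Real.exp (-a + x / 2 + x) := by rw [Real.exp_add, Real.exp_add]; ring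
    _ ≤ _ := by
        gcongr
        linarith

lemma sq_mul_tailSq_le {T y : ℝ} (hT : 0 ≤ T) : T ^ 2 * tailSq T y ≤ y ^ 4 := by
  unfold tailSq
  split_ifs with h
  · have : T ^ 2 ≤ y ^ 2 := by rw [← sq_abs y]; gcongr
    calc T ^ 2 * y ^ 2 ≤ y ^ 2 * y ^ 2 := by gcongr
      _ = y ^ 4 := by ring
  · rw [mul_zero]; positivity

/-- The order of the contribution of the largest coordinates under the polynomial moment
condition. -/
def tailFluctuation (n p : ℕ) (B q α : ℝ) : ℝ :=
  B ^ 2 * Real.log ((p : ℝ) * n) * ((n : ℝ) / α) ^ (2 / q)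

lemma D2_pow_three (hL : 0 ≤ Real.log ((p : ℝ) * n)) (hα : 0 < α) :
    D2 n p B q α ^ 3
      = B ^ 2 * Real.log (p * n) ^ 3 / (α ^ (2 / q) * (n : ℝ) ^ (1 - 2 / q)) := by
  rw [D2, ← Real.rpow_natCast, ← Real.rpow_mul (by positivity)]
  norm_num

lemma tailFluctuation_mul_sq (hn : 4 ≤ n) (hp : 3 ≤ p) (hα : 0 < α) :
    tailFluctuation n p B q α / n * Real.log ((p : ℝ) * n) ^ 2 = D2 n p B q α ^ 3 := by
  have hL := two_le_log_mul hn hp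
  have hn0 : (0 : ℝ) < n := by exact_mod_cast (by omega : 0 < n)
  rw [D2_pow_three (by linarith) hα, tailFluctuation, Real.div_rpow hn0.le hα.le,
    Real.rpow_sub hn0, Real.rpow_one]
  have h1 : 0 < (n : ℝ) ^ (2 / q) := by positivity
  have h2 : 0 < α ^ (2 / q) := by positivity
  field_simp

/-- The truncation level used under the polynomial moment condition. -/
def truncationLevel (n p : ℕ) (B q α : ℝ) : ℝ :=
  -- The first term makes the total probability of exceeding the level `O(α)`. The second keeps the
  -- truncation bias, at most `n B² / T²`, below `B √n √L`.
  Real.sqrt ((B * (8 * n / α) ^ (1 / q)) ^ 2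
    + B * Real.sqrt n / Real.sqrt (Real.log ((p : ℝ) * n)))

lemma truncationLevel_sq (hB : 0 ≤ B) :
    truncationLevel n p B q α ^ 2 = (B * (8 * n / α) ^ (1 / q)) ^ 2
      + B * Real.sqrt n / Real.sqrt (Real.log ((p : ℝ) * n)) :=
  Real.sq_sqrt (by positivity)

lemma truncationLevel_pos (hn : 4 ≤ n) (hB : 1 ≤ B) (hα : 0 < α) :
    0 < truncationLevel n p B q α := by
  have hn0 : (0 : ℝ) < n := by exact_mod_cast (by omega : 0 < n)
  rw [truncationLevel]
  positivity

lemma mul_div_truncationLevel_rpow_le (hn : 4 ≤ n) (hB : 1 ≤ B) (hq : 0 < q) (hα : 0 < α) :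
    n * (B / truncationLevel n p B q α) ^ q ≤ α / 8 := by
  have hn0 : (0 : ℝ) < n := by exact_mod_cast (by omega : 0 < n)
  have hB0 : 0 < B := by linarith
  have hle : B * (8 * n / α) ^ (1 / q) ≤ truncationLevel n p B q α :=
    Real.le_sqrt_of_sq_le (le_add_of_nonneg_right (by positivity))
  have hdiv : B / truncationLevel n p B q α ≤ ((8 * n / α) ^ (1 / q))⁻¹ := by
    rw [div_le_iff₀ (truncationLevel_pos hn hB hα), ← div_eq_inv_mul, le_div_iff₀ (by positivity)]
    exact hle
  have hT := truncationLevel_pos (p := p) (q := q) hn hB hα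
  have := Real.rpow_le_rpow (by positivity) hdiv hq.le
  rw [Real.inv_rpow (by positivity), ← Real.rpow_mul (by positivity), one_div_mul_cancel hq.ne',
    Real.rpow_one] at this
  calc _ ≤ n * (8 * n / α)⁻¹ := by gcongr
    _ = α / 8 := by field_simp

/-- `L T²` is the order of the linear Bernstein term; the two parts of the truncation level yield
the tail term and a term of Gaussian order. -/
lemma log_mul_truncationLevel_sq (hn : 4 ≤ n) (hp : 3 ≤ p) (hB : 1 ≤ B) (hα : 0 < α) :
    Real.log ((p : ℝ) * n) * truncationLevel n p B q α ^ 2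
      = 8 ^ (2 / q) * tailFluctuation n p B q α
        + B * Real.sqrt n * Real.sqrt (Real.log ((p : ℝ) * n)) := by
  have hL := two_le_log_mul hn hp
  have hn0 : (0 : ℝ) < n := by exact_mod_cast (by omega : 0 < n)
  rw [truncationLevel_sq (by linarith), tailFluctuation]
  set L := Real.log ((p : ℝ) * n)
  have e1 : ((8 * n / α) ^ (1 / q)) ^ 2 = 8 ^ (2 / q) * ((n : ℝ) / α) ^ (2 / q) := by
    rw [← Real.rpow_natCast, ← Real.rpow_mul (by positivity), mul_div_assoc,
      Real.mul_rpow (by norm_num) (by positivity), Nat.cast_ofNat,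
      show 1 / q * 2 = 2 / q by ring]
  have e2 : L / Real.sqrt L = Real.sqrt L := Real.div_sqrt
  calc _ = B ^ 2 * L * ((8 * n / α) ^ (1 / q)) ^ 2 + B * Real.sqrt n * (L / Real.sqrt L) := by ring
    _ = _ := by rw [e1, e2]; ring

/-- The deviation bound under the polynomial moment condition is of the order of the
fluctuations. -/
lemma polynomial_deviation_le (hn : 4 ≤ n) (hp : 3 ≤ p) (hB : 1 ≤ B) (hα : 0 < α)
    (hα1 : α < Real.exp (-1)) (hq : 0 < q) {K : ℝ} (hK : 1 ≤ K) :
    2 * Real.sqrt (Real.exp 1 * (n * B ^ 2) *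
        (K * (Real.log ((p : ℝ) * n) + Real.log (1 / α))))
      + K * (Real.log ((p : ℝ) * n) + Real.log (1 / α)) /
        ((Real.log ((p : ℝ) * n) + Real.log (1 / α)) /
          (2 * Real.log ((p : ℝ) * n) * truncationLevel n p B q α ^ 2))
      + 2 * (B * Real.sqrt n * Real.sqrt (Real.log ((p : ℝ) * n)))
      ≤ 10 * K * 8 ^ (2 / q) * (fluctuation n p B α + tailFluctuation n p B q α) := by
  have hL := two_le_log_mul hn hp
  have ha := one_lt_log_inv hα hα1
  have hsv := sqrt_variance_le hn hp hB hα hα1 hK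
  have hT := truncationLevel_pos (p := p) (q := q) hn hB hα
  have hLT := log_mul_truncationLevel_sq (q := q) hn hp hB hα
  have hn0 : (0 : ℝ) < n := by exact_mod_cast (by omega : 0 < n)
  have hR : 0 ≤ tailFluctuation n p B q α := by rw [tailFluctuation]; positivity
  have hS0 := fluctuation_nonneg (n := n) (p := p) (α := α) hB (by linarith)
  have hS : B * Real.sqrt n * Real.sqrt (Real.log ((p : ℝ) * n)) ≤ fluctuation n p B α :=
    le_mul_of_one_le_right (by positivity) ha.le
  set L := Real.log ((p : ℝ) * n)
  set a := Real.log (1 / α)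
  set S := fluctuation n p B α
  set R := tailFluctuation n p B q α
  set T := truncationLevel n p B q α
  have h8 : (1 : ℝ) ≤ 8 ^ (2 / q) := Real.one_le_rpow (by norm_num) (by positivity)
  -- The numerator `L + a` of `c₀` cancels that of `Λ`, so no extra `log (1 / α)` multiplies the
  -- tail term.
  have e1 : K * (L + a) / ((L + a) / (2 * L * T ^ 2)) = 2 * K * (L * T ^ 2) := by
    have : L + a ≠ 0 := by linarith
    field_simp
  rw [e1, hLT]
  have e2 : 2 * K * (8 ^ (2 / q) * R + B * Real.sqrt n * Real.sqrt L)
      ≤ 2 * K * (8 ^ (2 / q) * R + S) := by gcongr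
  have e3 : K * S ≤ K * 8 ^ (2 / q) * S :=
    mul_le_mul_of_nonneg_right (le_mul_of_one_le_right (by linarith) h8) hS0
  have e4 : S ≤ K * S := le_mul_of_one_le_left hS0 hK
  have e5 : 0 ≤ K * 8 ^ (2 / q) * R := by positivity
  linarith

/-- The factor in the deviation bound under the polynomial moment condition. -/
def deviationFactor (q : ℝ) : ℝ := 4 + 2 * ((2 * (2 + q / 2)) ^ (2 + q / 2) * Real.exp 1)

/-- Concentration of the empirical second moments under the polynomial moment condition. -/
lemma concentration_of_condE2 (hn : 4 ≤ n) (hp : 3 ≤ p) (hX : IsCenteredSample P X) (hB : 1 ≤ B)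
    (hα : 0 < α) (hα1 : α < Real.exp (-1)) (hq : 0 < q) (hM2 : CondM2 P X B)
    (hE2 : CondE2 P X B q) :
    1 - α ≤ P.real {ω | ∀ j k, |∑ i, augment (X i ω) j * augment (X i ω) k
        - ∑ i, ∫ ω, augment (X i ω) j * augment (X i ω) k ∂P|
          ≤ 10 * deviationFactor q * 8 ^ (2 / q)
            * (fluctuation n p B α + tailFluctuation n p B q α)} := by
  have hL := two_le_log_mul hn hp
  have ha := one_lt_log_inv hα hα1
  have hcard := log_card_sq_div_le hn hp hα
  have hexpa := exp_neg_log_inv hα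
  have hn0 : (0 : ℝ) < n := by exact_mod_cast (by omega : 0 < n)
  have hB0 : 0 < B := by linarith
  set W := (2 * (2 + q / 2)) ^ (2 + q / 2) * Real.exp 1 with hW
  have hW0 : 0 < W := by positivity
  have hK : deviationFactor q = 4 + 2 * W := rfl
  have hdev := polynomial_deviation_le (q := q) hn hp hB hα hα1 hq (K := deviationFactor q)
    (by linarith)
  have hT := truncationLevel_pos (p := p) (q := q) hn hB hα
  have hTn := mul_div_truncationLevel_rpow_le (p := p) hn hB hq hα
  have hT2 := truncationLevel_sq (n := n) (p := p) (q := q) (α := α) hB0.le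
  set L := Real.log ((p : ℝ) * n)
  set a := Real.log (1 / α)
  set T := truncationLevel n p B q α
  have hsplit : ∀ y : ℝ, (|y| / T) ^ q = (B / T) ^ q * (|y| / B) ^ q := fun y => by
    rw [← Real.mul_rpow (by positivity) (by positivity)]
    congr 1
    field_simp
  have hxm : ∀ i, Measurable fun ω => augment (X i ω) := fun i =>
    measurable_augment.comp (hX.measurable i)
  -- Then `c₀ T² = 1/2 + a / (2 L)`, at most `1/2 + a / 4` since `L ≥ 2`. This is small enough for
  -- `exp (c₀ T²)` to be absorbed by the factor `α` in `n (B / T)^q ≤ α / 8`.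
  set c₀ := (L + a) / (2 * L * T ^ 2) with hc₀
  have hx1 : c₀ * T ^ 2 = (L + a) / (2 * L) := by rw [hc₀]; field_simp
  have hx1a : c₀ * T ^ 2 ≤ 1 / 2 + a / 4 := by
    rw [hx1, div_le_iff₀ (by positivity)]
    nlinarith
  have key := empirical_second_moment_concentration (P := P) (x := fun i ω => augment (X i ω))
    (T := T) (c₀ := c₀) (V := n * B ^ 2) (W := W) (β := B * Real.sqrt n * Real.sqrt L) (α := α)
    (Λ := deviationFactor q * (L + a)) hxm
    (hX.indep.comp (fun _ => augment) fun _ => measurable_augment)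
    (fun i l => hM2.integrable_augment_pow_four i l) hT.le (by positivity)
    (by positivity) (by rw [hK]; positivity) hα
    (fun l => hM2.sum_integral_augment_pow_four_le (by omega) hB l)
    (fun c hc hc' l => by
      set w := (c₀ * T ^ 2) ^ (2 + q / 2) * Real.exp (c₀ * T ^ 2) with hw
      have hw0 : 0 ≤ w := by positivity
      have hαw : α * w ≤ W := by
        rw [← hexpa]
        exact exp_neg_mul_rpow_mul_exp_le (by positivity) (by linarith) hx1a (by positivity)
      calc ∑ i, ∫ ω, excess c T (augment (X i ω) l) ∂P
          ≤ ∑ _i : Fin n, w * (B / T) ^ q * 3 := by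
            refine Finset.sum_le_sum fun i _ => ?_
            calc _ ≤ ∫ ω, w * (B / T) ^ q * (1 + (⨆ j, |X i ω j| / B) ^ q) ∂P := by
                  refine integral_mono_of_nonneg
                    (Filter.Eventually.of_forall fun ω => excess_nonneg _ _ _)
                    ((hE2.integrable i).const_mul _) (Filter.Eventually.of_forall fun ω => ?_)
                  refine (excess_le_rpow hq hT hc hc').trans ?_
                  rw [hsplit, ← mul_assoc]
                  exact mul_le_mul_of_nonneg_left (abs_augment_div_rpow_le hB hq _ _)
                    (by positivity)
              _ ≤ _ := by
                  rw [integral_const_mul]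
                  gcongr
                  exact hE2.integral_le i
        _ = 3 * w * (n * (B / T) ^ q) := by
            simp only [Finset.sum_const, Finset.card_univ, Fintype.card_fin, nsmul_eq_mul]
            ring
        _ ≤ 3 * w * (α / 8) := by gcongr
        _ ≤ W := by nlinarith)
    (fun l => by
      have h4 := hM2.sum_integral_augment_pow_four_le (by omega) hB l
      have h1 : T ^ 2 * ∑ i, ∫ ω, tailSq T (augment (X i ω) l) ∂P ≤ n * B ^ 2 := by
        refine le_trans ?_ h4
        rw [Finset.mul_sum]
        refine Finset.sum_le_sum fun i _ => ?_
        rw [← integral_const_mul]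
        exact integral_mono_of_nonneg (Filter.Eventually.of_forall fun ω =>
          mul_nonneg (sq_nonneg _) (tailSq_nonneg _ _)) (hM2.integrable_augment_pow_four i l)
          (Filter.Eventually.of_forall fun ω => sq_mul_tailSq_le hT.le)
      refine le_of_mul_le_mul_left (h1.trans ?_) (by positivity : 0 < T ^ 2)
      have h2 : B * Real.sqrt n / Real.sqrt L ≤ T ^ 2 := by
        rw [hT2]; exact le_add_of_nonneg_left (by positivity)
      have hLs : 0 < Real.sqrt L := Real.sqrt_pos.2 (by linarith)
      calc n * B ^ 2 = B * Real.sqrt n / Real.sqrt L * (B * Real.sqrt n * Real.sqrt L) := by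
            have : Real.sqrt n ^ 2 = n := Real.sq_sqrt hn0.le
            field_simp
            rw [this]
        _ ≤ _ := by gcongr)
    (by
      have e1 : ∀ i, P.real {ω | ∃ l, T < |augment (X i ω) l|} ≤ 3 * (B / T) ^ q := fun i => by
        have := mul_measureReal_le_integral (hE2.integrable i)
          (fun ω => add_nonneg zero_le_one (Real.rpow_nonneg
            (Real.iSup_nonneg fun j => by positivity) _)) (c := (T / B) ^ q)
          (s := {ω | ∃ l, T < |augment (X i ω) l|})
          (fun ω ⟨l, hl⟩ => (Real.rpow_le_rpow (by positivity) (by gcongr) hq.le).trans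
            (abs_augment_div_rpow_le hB hq _ l)) (by positivity)
        have h3 := this.trans (hE2.integral_le i)
        rw [← inv_div, Real.inv_rpow (by positivity), ← div_eq_mul_inv,
          le_div_iff₀ (by positivity)]
        linarith
      calc _ ≤ ∑ _i : Fin n, 3 * (B / T) ^ q := Finset.sum_le_sum fun i _ => e1 i
        _ = 3 * (n * (B / T) ^ q) := by
            simp only [Finset.sum_const, Finset.card_univ, Fintype.card_fin, nsmul_eq_mul]
            ring
        _ ≤ 3 * (α / 8) := by gcongr
        _ ≤ α / 2 := by linarith)
    -- `2 + 2 L + a + 2 W ≤ (4 + 2 W) (L + a)`, which explains the form of `deviationFactor`.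
    (by
      rw [hK]
      nlinarith)
  exact key.trans (measureReal_mono fun ω hω j k => (hω j k).trans hdev)

end Polynomial

/-! ### Signs of the rates. -/

section Rates

variable {n p : ℕ} {B q α : ℝ}

lemma fluctuation_pos (hn : 4 ≤ n) (hp : 3 ≤ p) (hB : 1 ≤ B) (hα : 0 < α)
    (hα1 : α < Real.exp (-1)) : 0 < fluctuation n p B α := by
  have hL := two_le_log_mul hn hp
  have ha := one_lt_log_inv hα hα1
  have hn0 : (0 : ℝ) < n := by exact_mod_cast (by omega : 0 < n)
  have hL0 : 0 < Real.sqrt (Real.log ((p : ℝ) * n)) := Real.sqrt_pos.2 (by linarith)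
  rw [fluctuation]
  positivity

lemma D1_pos (hn : 4 ≤ n) (hp : 3 ≤ p) (hB : 1 ≤ B) (hα : 0 < α) (hα1 : α < Real.exp (-1)) :
    0 < D1 n p B α := by
  have hL := two_le_log_mul hn hp
  have ha := one_lt_log_inv hα hα1
  have hn0 : (0 : ℝ) < n := by exact_mod_cast (by omega : 0 < n)
  rw [D1]
  positivity

lemma D2_nonneg (hn : 4 ≤ n) (hp : 3 ≤ p) (hα : 0 < α) : 0 ≤ D2 n p B q α := by
  have hL := two_le_log_mul hn hp
  rw [D2]
  positivity

end Rates

end HighDimBootstrap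

end

/-! ### The two bootstrap bounds. -/

theorem mainTheorem12 :
    (∀ b : ℝ, 0 < b → ∃ C : ℝ, 0 < C ∧
      ∀ (n p : ℕ), 4 ≤ n → 3 ≤ p →
      ∀ (Ω Ω' : Type*) [MeasurableSpace Ω] [MeasurableSpace Ω']
        (P : Measure Ω) [IsProbabilityMeasure P] (Q : Measure Ω') [IsProbabilityMeasure Q]
        (X : Fin n → Ω → Fin p → ℝ) (e : Fin n → Ω → ℝ) (Y : Fin n → Ω' → Fin p → ℝ)
        (B α : ℝ),
        HighDimBootstrap.IsCenteredSample P X →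
        HighDimBootstrap.IsGaussianMultiplier P X e →
        HighDimBootstrap.IsGaussianAnalogue P X Q Y →
        1 ≤ B → 0 < α → α < Real.exp (-1) →
        HighDimBootstrap.CondM1 P X b →
        HighDimBootstrap.CondM2 P X B →
        HighDimBootstrap.CondE1 P X B →
        1 - α ≤ P.real {ω |
          HighDimBootstrap.rhoMB P X e Q Y (HighDimBootstrap.hyperrectangles p) ω
            ≤ C * HighDimBootstrap.D1 n p B α}) ∧
    (∀ b q : ℝ, 0 < b → 0 < q → ∃ C : ℝ, 0 < C ∧
      ∀ (n p : ℕ), 4 ≤ n → 3 ≤ p →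
      ∀ (Ω Ω' : Type*) [MeasurableSpace Ω] [MeasurableSpace Ω']
        (P : Measure Ω) [IsProbabilityMeasure P] (Q : Measure Ω') [IsProbabilityMeasure Q]
        (X : Fin n → Ω → Fin p → ℝ) (e : Fin n → Ω → ℝ) (Y : Fin n → Ω' → Fin p → ℝ)
        (B α : ℝ),
        HighDimBootstrap.IsCenteredSample P X →
        HighDimBootstrap.IsGaussianMultiplier P X e →
        HighDimBootstrap.IsGaussianAnalogue P X Q Y →
        1 ≤ B → 0 < α → α < Real.exp (-1) →
        HighDimBootstrap.CondM1 P X b →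
        HighDimBootstrap.CondM2 P X B →
        HighDimBootstrap.CondE2 P X B q →
        1 - α ≤ P.real {ω |
          HighDimBootstrap.rhoMB P X e Q Y (HighDimBootstrap.hyperrectangles p) ω
            ≤ C * (HighDimBootstrap.D1 n p B α + HighDimBootstrap.D2 n p B q α)}) := by
  open HighDimBootstrap in
  constructor
  · intro b hb
    obtain ⟨C, hC, h⟩ := exists_bootstrap_of_concentration (K := 12000) hb (by norm_num)
    refine ⟨C, hC, fun n p hn hp Ω Ω' _ _ P _ Q _ X e Y B α hX he hY hB hα hα1 hM1 hM2 hE1 => ?_⟩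
    have hL := two_le_log_mul hn hp
    have hn0 : (0 : ℝ) < n := by exact_mod_cast (by omega : 0 < n)
    have hS := fluctuation_pos hn hp hB hα hα1
    refine h n p P Q X e Y (Real.log ((p : ℝ) * n)) (D1 n p B α)
      (12000 * (fluctuation n p B α / n)) α (by omega) hX he hY hM1 (by linarith)
      (log_two_mul_le hn hp) hα (D1_pos hn hp hB hα hα1) (by positivity) ?_ fun hD => ?_
    · rw [← fluctuation_mul_sq hn hp hB hα hα1, mul_assoc]
    · have := concentration_of_condE1 hn hp hX hB hα hα1 hM2 hE1 hD
      rwa [show (12000 : ℝ) * fluctuation n p B α = n * (12000 * (fluctuation n p B α / n)) by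
        field_simp] at this
  · intro b q hb hq
    have hK0 : 0 < 10 * deviationFactor q * 8 ^ (2 / q) := by
      rw [deviationFactor]
      positivity
    obtain ⟨C, hC, h⟩ := exists_bootstrap_of_concentration hb hK0
    refine ⟨C, hC, fun n p hn hp Ω Ω' _ _ P _ Q _ X e Y B α hX he hY hB hα hα1 hM1 hM2 hE2 => ?_⟩
    have hL := two_le_log_mul hn hp
    have hn0 : (0 : ℝ) < n := by exact_mod_cast (by omega : 0 < n)
    have hS := fluctuation_pos hn hp hB hα hα1
    have hR : 0 ≤ tailFluctuation n p B q α := by rw [tailFluctuation]; positivity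
    have hD1 := D1_pos hn hp hB hα hα1
    have hD2 : 0 ≤ D2 n p B q α := D2_nonneg hn hp hα
    refine h n p P Q X e Y (Real.log ((p : ℝ) * n)) (D1 n p B α + D2 n p B q α)
      (10 * deviationFactor q * 8 ^ (2 / q)
        * (fluctuation n p B α / n + tailFluctuation n p B q α / n)) α (by omega) hX he hY hM1
      (by linarith) (log_two_mul_le hn hp) hα (by positivity) (by positivity) ?_ fun _ => ?_
    -- The two parts of `τ L²` are multiples of `D1 ^ 3` and `D2 ^ 3`, whose sum is at most `(D1 +
    -- D2) ^ 3`.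
    · rw [mul_assoc, add_mul, fluctuation_mul_sq hn hp hB hα hα1, tailFluctuation_mul_sq hn hp hα]
      gcongr
      exact pow_add_pow_le hD1.le hD2 (by norm_num)
    · have := concentration_of_condE2 hn hp hX hB hα hα1 hq hM2 hE2
      rwa [show 10 * deviationFactor q * 8 ^ (2 / q)
          * (fluctuation n p B α + tailFluctuation n p B q α)
          = n * (10 * deviationFactor q * 8 ^ (2 / q)
            * (fluctuation n p B α / n + tailFluctuation n p B q α / n)) by field_simp] at this
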